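/- **Setting.** Let $A$ be a unital $C^*$-algebra, $G$ a discrete group and $(\rho,\sigma)$ a twisting pair: maps $\rho\colon G\to\mathrm{Aut}(A)$, $\sigma\colon G\times G\to U(A)$ with $\rho_x(\sigma_{y,z})=\sigma_{x,y}\sigma_{xy,z}\sigma_{x,yz}^*$, $\rho_x\rho_y=\mathrm{Ad}(\sigma_{x,y})\rho_{xy}$, $\sigma_{x,e}=\sigma_{e,x}=1$, $\rho_e=\mathrm{id}$. A spectral triple $(\mathcal A,H,D)$ on $A$ consists of a dense unital $*$-subalgebra $\mathcal A\subseteq A$, a unital representation $\pi\colon A\to\mathbb B(H)$ and a self-adjoint operator $D$ such that $(1+D^2)^{-1/2}$ is compact and, for all $a\in\mathcal A$, $\pi(a)$ preserves $\mathrm{Dom}\,D$ and $[D,\pi(a)]$ is bounded. It is *regular* if $\pi(\mathcal A)$ and $[D,\pi(\mathcal A)]$ lie in $\bigcap_k\mathrm{Dom}(\delta^k)$, where $\delta=[|D|,\cdot\,]$ is defined on the $T\in\mathbb B(H)$ that preserve $\mathrm{Dom}|D|$ and have bounded $[|D|,T]$. With $\Delta=1+D^2$ and $W^\infty=\bigcap_n\mathrm{Dom}(\Delta^n)$,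 a linear map $P\colon W^\infty\to W^\infty$ is in $\mathrm{Op}^t(\Delta)$ if for every $s\in\mathbb R$ it is bounded from the norm $\|\Delta^{(s+t)/2}\xi\|$ to the norm $\|\Delta^{s/2}\xi\|$; a bounded operator on $H$ is said to be in $\mathrm{Op}^t(\Delta)$ if it preserves $W^\infty$ and its restriction is. Let $(\mathcal A,H,D,\pi,U)$ be a $G$-equivariant odd spectral triple on $A$ with $\pi$ faithful: $\rho_x(\mathcal A)=\mathcal A$ and $\sigma_{x,y}\in\mathcal A$ for all $x,y$; $U\colon G\to U(H)$ satisfies $U_xU_y=\pi(\sigma_{x,y})U_{xy}$ and $\pi\circ\rho_x=\mathrm{Ad}(U_x)\circ\pi$; and each $U_g$ preserves $\mathrm{Dom}\,D$ with $[D,U_g]$ bounded. Let $V$ be a finite-dimensional Hilbert space and $\ell\colon G\to\mathbb B(V)$ a self-adjoint valued function which is translation bounded ($\sup_x\|\ell(x)-\ell(y^{-1}x)\|<\infty$ for each $y$) and proper ($\ell(g)=0$ iff $g=e$; $\mathcal S=\bigcup_x\mathrm{Sp}\,\ell(x)$ has no accumulation point in $\mathbb R$; each $t\in\mathcal S$ lies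 in $\mathrm{Sp}\,\ell(x)$ for only finitely many $x$). Let $\mathcal B=\{\sum_g\pi(a_g)U_g : a_g\in\mathcal A,\ \text{finite sums}\}$, acting on $H$, with norm closure $B$. Let $C_c(G)$ act on $\ell^2(G)\otimes V$ by left translations $\lambda_g$, and let $M_\ell(\delta_x\otimes v)=\delta_x\otimes\ell(x)v$ (self-adjoint closure). Let $A\rtimes_r^{\rho,\sigma}G$ be the $C^*$-algebra generated on $\ell^2(G,H)$ by the operators $\Pi(a\delta_x)(\xi\otimes\delta_y)=\pi(\rho_{y^{-1}x^{-1}}(a)\sigma_{y^{-1}x^{-1},x})\xi\otimes\delta_{xy}$. The equivariant construction is the triple $(C_c(G,\mathcal A),\widetilde H,\widetilde D)$ on $A\rtimes_r^{\rho,\sigma}G$ with $\widetilde H=(H\otimes\ell^2(G)\otimes V)^{\oplus2}$, the representation given by two copies of $a\delta_h\mapsto\pi(a)U_h\otimes\lambda_h\otimes1_V$ and $\widetilde D$ the closure of $$\begin{pmatrix}0&D\otimes1-i\,1\otimes M_\ell\\ D\otimes1+i\,1\otimes M_\ell&0\end{pmatrix}.$$ **Theorem.** 1. If $(\mathcal B,H,D)$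 and $(C_c(G),\ell^2(G)\otimes V,M_\ell)$ are regular, then the representation of $C_c(G,A)$ above extends to $A\rtimes_r^{\rho,\sigma}G$, and $(C_c(G,\mathcal A),\widetilde H,\widetilde D)$ is a regular spectral triple on $A\rtimes_r^{\rho,\sigma}G$. 2. Suppose that $(\mathcal A,H,D)$ is regular and that for every $g\in G$: $U_g\in\mathrm{Op}^0(\Delta)$, $[D,U_g]\in\mathrm{Op}^0(\Delta)$, and for every integer $k\ge0$ the $k$-fold commutators $[\Delta,[\Delta,\dots[\Delta,U_g]\dots]]$ and $[\Delta,[\Delta,\dots[\Delta,[D,U_g]]\dots]]$ are in $\mathrm{Op}^k(\Delta)$. Then $(\mathcal B,H,D)$ is a regular spectral triple on $B$. 3. Conversely, if $(\mathcal B,H,D)$ is regular, then $(\mathcal A,H,D)$ is regular and, for every $g\in G$ and every integer $k\ge0$, $U_g$ and $[D,U_g]$ satisfy all the conditions listed in 2. -/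

import Mathlib

open scoped TensorProduct

noncomputable section

namespace TwistedTriple

/-! ### Unbounded operators: commutators and functional calculus -/

section Operators

variable {H : Type*} [NormedAddCommGroup H] [InnerProductSpace ℂ H]

/-- `T` leaves the domain of the (unbounded) operator `S` invariant and the commutator
`[S, T] = S T - T S`, defined on that domain, extends to the bounded operator `C`. -/
def IsBoundedCommutator (S : H →ₗ.[ℂ] H) (T C : H →L[ℂ] H) : Prop :=
  ∀ x : S.domain, ∃ hx : T x ∈ S.domain, S ⟨T x, hx⟩ - T (S x) = C x

/-- `T ∈ Dom(δ^k)` for the derivation `δ = [S, ·]`. -/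
def InDomDerivation (S : H →ₗ.[ℂ] H) : ℕ → (H →L[ℂ] H) → Prop
  | 0, _ => True
  | k + 1, T => ∃ C : H →L[ℂ] H, IsBoundedCommutator S T C ∧ InDomDerivation S k C

/-- `T ∈ Dom^∞(δ) = ⋂ₖ Dom(δ^k)` for the derivation `δ = [S, ·]`. -/
def InDomInfty (S : H →ₗ.[ℂ] H) (T : H →L[ℂ] H) : Prop :=
  ∀ k : ℕ, InDomDerivation S k T

/-- The eigenspace `{x ∈ Dom D | D x = t x}` of an unbounded operator. -/
def eigenspace (D : H →ₗ.[ℂ] H) (t : ℝ) : Submodule ℂ H :=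
  (LinearMap.ker (D.toFun - (t : ℂ) • D.domain.subtype)).map D.domain.subtype

variable [CompleteSpace H]

/-- The spectral projection of `D` at the point `t`: the orthogonal projection onto the eigenspace
(which is closed as soon as `D` is). -/
def spectralProj (D : H →ₗ.[ℂ] H) (t : ℝ) : H →L[ℂ] H :=
  (eigenspace D t).topologicalClosure.starProjection

/-- The operator `f(D)` for a self-adjoint `D` with compact resolvent. Such a `D` is diagonal, that
is `H` is the Hilbert sum of the eigenspaces of `D`, so that
`f(D) x = ∑ₜ f(t) Pₜ x` on the domain of all `x` for which this orthogonal series converges. -/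
def funcCalc (D : H →ₗ.[ℂ] H) (f : ℝ → ℝ) : H →ₗ.[ℂ] H where
  domain :=
    { carrier := {x | Summable fun t : ℝ => (f t : ℂ) • spectralProj D t x}
      zero_mem' := by simp
      add_mem' := by
        intro x y hx hy
        simpa using Summable.add hx hy
      smul_mem' := by
        intro c x hx
        have h := Summable.const_smul c hx
        simpa [smul_comm c] using h }
  toFun :=
    { toFun := fun x => ∑' t : ℝ, (f t : ℂ) • spectralProj D t x
      map_add' := by
        intro x y
        rw [← Summable.tsum_add x.2 y.2]
        simp
      map_smul' := by
        intro c x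
        rw [RingHom.id_apply, ← Summable.tsum_const_smul c x.2]
        simp [smul_comm c] }

/-- The absolute value `|D|`. -/
def absOp (D : H →ₗ.[ℂ] H) : H →ₗ.[ℂ] H :=
  funcCalc D fun t => |t|

/-- The power `Δ^{s/2} = (1 + D²)^{s/2}`, for real `s`. -/
def laplacePow (D : H →ₗ.[ℂ] H) (s : ℝ) : H →ₗ.[ℂ] H :=
  funcCalc D fun t => (1 + t ^ 2) ^ (s / 2)

end Operators

/-! ### Spectral triples and regularity -/

section Triples

variable {H : Type*} [NormedAddCommGroup H] [InnerProductSpace ℂ H] [CompleteSpace H]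

/-- `(1 + D²)^{-1/2}` is compact: there is a compact positive operator `T` with
`T² = (1 + D²)⁻¹`. -/
def HasCompactResolvent (D : H →ₗ.[ℂ] H) : Prop :=
  ∃ T : H →L[ℂ] H, T.IsPositive ∧ IsCompactOperator T ∧
    ∀ x : H, ∃ (h₁ : T (T x) ∈ D.domain) (h₂ : D ⟨T (T x), h₁⟩ ∈ D.domain),
      T (T x) + D ⟨D ⟨T (T x), h₁⟩, h₂⟩ = x

/-- `(𝒜, H, D, π)` is a spectral triple (no grading being fixed) on the unital C⋆-algebra `A`. -/
structure IsSpectralTriple {A : Type*} [CStarAlgebra A] (𝒜 : Set A)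
    (π : A →⋆ₐ[ℂ] (H →L[ℂ] H)) (D : H →ₗ.[ℂ] H) : Prop where
  isStarSubalgebra : ∃ S : StarSubalgebra ℂ A, (S : Set A) = 𝒜
  dense : Dense 𝒜
  denseDomain : Dense (D.domain : Set H)
  selfAdjoint : IsSelfAdjoint D
  compactResolvent : HasCompactResolvent D
  boundedCommutator : ∀ a ∈ 𝒜, ∃ C : H →L[ℂ] H, IsBoundedCommutator D (π a) C

/-- Regularity of a spectral triple with Dirac operator `D` whose smooth algebra acts on `H` by the
operators in `𝒮`: both `𝒮` and `[D, 𝒮]` are contained in `Dom^∞(δ)`, where `δ = [|D|, ·]`. -/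
def IsRegular (𝒮 : Set (H →L[ℂ] H)) (D : H →ₗ.[ℂ] H) : Prop :=
  ∀ T ∈ 𝒮, InDomInfty (absOp D) T ∧
    ∃ C : H →L[ℂ] H, IsBoundedCommutator D T C ∧ InDomInfty (absOp D) C

end Triples

/-! ### The Laplacian, Sobolev norms and operators of finite analytic order -/

section Laplacian

variable {H : Type*} [NormedAddCommGroup H] [InnerProductSpace ℂ H]

/-- The Laplacian `Δ = 1 + D²` on `Dom(D²)`. -/
def laplacian (D : H →ₗ.[ℂ] H) : H →ₗ.[ℂ] H where
  domain :=
    { carrier := {x | ∃ hx : x ∈ D.domain, D ⟨x, hx⟩ ∈ D.domain}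
      zero_mem' := ⟨D.domain.zero_mem, by
        have : D ⟨0, D.domain.zero_mem⟩ = 0 := D.map_zero
        rw [this]; exact D.domain.zero_mem⟩
      add_mem' := by
        rintro x y ⟨hx, hx'⟩ ⟨hy, hy'⟩
        refine ⟨D.domain.add_mem hx hy, ?_⟩
        have : D ⟨x + y, D.domain.add_mem hx hy⟩ = D ⟨x, hx⟩ + D ⟨y, hy⟩ :=
          D.map_add ⟨x, hx⟩ ⟨y, hy⟩
        rw [this]; exact D.domain.add_mem hx' hy'
      smul_mem' := by
        rintro c x ⟨hx, hx'⟩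
        refine ⟨D.domain.smul_mem c hx, ?_⟩
        have : D ⟨c • x, D.domain.smul_mem c hx⟩ = c • D ⟨x, hx⟩ := D.map_smul c ⟨x, hx⟩
        rw [this]; exact D.domain.smul_mem c hx' }
  toFun :=
    { toFun := fun x => (x : H) + D ⟨D ⟨x, x.2.fst⟩, x.2.snd⟩
      map_add' := by
        intro x y
        have h : (⟨D ⟨(x + y : H), (x + y).2.fst⟩, (x + y).2.snd⟩ : D.domain) =
            ⟨D ⟨x, x.2.fst⟩, x.2.snd⟩ + ⟨D ⟨y, y.2.fst⟩, y.2.snd⟩ :=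
          Subtype.ext (D.map_add ⟨x, x.2.fst⟩ ⟨y, y.2.fst⟩)
        have h' := congrArg D h
        rw [D.map_add] at h'
        simp only [Submodule.coe_add]
        rw [h']; abel
      map_smul' := by
        intro c x
        have h : (⟨D ⟨(c • x : H), (c • x).2.fst⟩, (c • x).2.snd⟩ : D.domain) =
            c • ⟨D ⟨x, x.2.fst⟩, x.2.snd⟩ :=
          Subtype.ext (D.map_smul c ⟨x, x.2.fst⟩)
        have h' := congrArg D h
        rw [D.map_smul] at h'
        simp only [Submodule.coe_smul, RingHom.id_apply, smul_add]
        rw [h'] }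

/-- `Dom(L^n)`. -/
def powDomain (L : H →ₗ.[ℂ] H) : ℕ → Submodule ℂ H
  | 0 => ⊤
  | n + 1 => ((powDomain L n).comap L.toFun).map L.domain.subtype

lemma mem_powDomain_succ {L : H →ₗ.[ℂ] H} {n : ℕ} {x : H} :
    x ∈ powDomain L (n + 1) ↔ ∃ hx : x ∈ L.domain, L ⟨x, hx⟩ ∈ powDomain L n := by
  constructor
  · rintro ⟨y, hy, rfl⟩
    exact ⟨y.2, hy⟩
  · rintro ⟨hx, h⟩
    exact ⟨⟨x, hx⟩, h, rfl⟩

/-- The space `W^∞ = ⋂ₙ Dom(Δ^n)` of smooth vectors. -/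
def smoothVectors (D : H →ₗ.[ℂ] H) : Submodule ℂ H :=
  ⨅ n : ℕ, powDomain (laplacian D) n

lemma mem_smoothVectors {D : H →ₗ.[ℂ] H} {x : H} :
    x ∈ smoothVectors D ↔ ∀ n, x ∈ powDomain (laplacian D) n := by
  simp [smoothVectors, Submodule.mem_iInf]

lemma smoothVectors_le_laplacian (D : H →ₗ.[ℂ] H) : smoothVectors D ≤ (laplacian D).domain :=
  fun _ hx => (mem_powDomain_succ.1 (mem_smoothVectors.1 hx 1)).fst

lemma smoothVectors_le (D : H →ₗ.[ℂ] H) : smoothVectors D ≤ D.domain :=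
  fun _ hx => (smoothVectors_le_laplacian D hx).fst

lemma laplacian_mem_smoothVectors (D : H →ₗ.[ℂ] H) (x : smoothVectors D) :
    laplacian D ⟨x, smoothVectors_le_laplacian D x.2⟩ ∈ smoothVectors D :=
  mem_smoothVectors.2 fun n => (mem_powDomain_succ.1 (mem_smoothVectors.1 x.2 (n + 1))).snd

lemma dirac_mem_powDomain (D : H →ₗ.[ℂ] H) (n : ℕ) : ∀ (x : H) (hx : x ∈ D.domain),
    x ∈ powDomain (laplacian D) (n + 1) → D ⟨x, hx⟩ ∈ powDomain (laplacian D) n := by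
  induction n with
  | zero => intro x hx _; trivial
  | succ n ih =>
    intro x hx h
    obtain ⟨⟨h₁, h₂⟩, h₃⟩ := mem_powDomain_succ.1 h
    obtain ⟨⟨h₄, -⟩, -⟩ := mem_powDomain_succ.1 h₃
    have hval : laplacian D ⟨x, ⟨h₁, h₂⟩⟩ = x + D ⟨D ⟨x, h₁⟩, h₂⟩ := rfl
    have h₅ : D ⟨D ⟨x, h₁⟩, h₂⟩ ∈ D.domain := by
      have := D.domain.sub_mem h₄ h₁
      rw [hval] at this
      simpa using this
    refine mem_powDomain_succ.2 ⟨⟨h₂, h₅⟩, ?_⟩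
    have key : laplacian D ⟨D ⟨x, hx⟩, ⟨h₂, h₅⟩⟩ = D ⟨laplacian D ⟨x, ⟨h₁, h₂⟩⟩, h₄⟩ := by
      have : (⟨laplacian D ⟨x, ⟨h₁, h₂⟩⟩, h₄⟩ : D.domain) =
          ⟨x, h₁⟩ + ⟨D ⟨D ⟨x, h₁⟩, h₂⟩, h₅⟩ := Subtype.ext hval
      rw [this, D.map_add]
      rfl
    rw [key]
    exact ih _ h₄ h₃

lemma dirac_mem_smoothVectors (D : H →ₗ.[ℂ] H) (x : smoothVectors D) :
    D ⟨x, smoothVectors_le D x.2⟩ ∈ smoothVectors D :=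
  mem_smoothVectors.2 fun n => dirac_mem_powDomain D n x _ (mem_smoothVectors.1 x.2 (n + 1))

/-- `Δ` as an element of `End(W^∞)`. -/
def laplaceEnd (D : H →ₗ.[ℂ] H) : Module.End ℂ (smoothVectors D) :=
  LinearMap.codRestrict _ ((laplacian D).toFun ∘ₗ
    Submodule.inclusion (smoothVectors_le_laplacian D)) (laplacian_mem_smoothVectors D)

/-- `D` as an element of `End(W^∞)`. -/
def diracEnd (D : H →ₗ.[ℂ] H) : Module.End ℂ (smoothVectors D) :=
  LinearMap.codRestrict _ (D.toFun ∘ₗ Submodule.inclusion (smoothVectors_le D))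
    (dirac_mem_smoothVectors D)

/-- The `k`-fold commutator `[Δ, [Δ, … [Δ, P]…]]` in `End(W^∞)`. -/
def iterLaplaceComm (D : H →ₗ.[ℂ] H) (k : ℕ) (P : Module.End ℂ (smoothVectors D)) :
    Module.End ℂ (smoothVectors D) :=
  (fun Q => laplaceEnd D * Q - Q * laplaceEnd D)^[k] P

variable [CompleteSpace H]

/-- The Sobolev norm `‖Δ^{s/2} ξ‖` of a smooth vector `ξ`. For `D` self-adjoint with compact
resolvent, smooth vectors lie in the domain of `Δ^{s/2}` for all real `s`, and the value `0` is
never used. -/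
def sobolevNorm (D : H →ₗ.[ℂ] H) (s : ℝ) (ξ : smoothVectors D) : ℝ :=
  open Classical in
  if h : (ξ : H) ∈ (laplacePow D s).domain then ‖laplacePow D s ⟨ξ, h⟩‖ else 0

/-- `P ∈ Op^t(Δ)`. Since `W^∞` is dense in every Sobolev space `W^s`, the map `P : W^∞ → W^∞`
extends by continuity to a bounded operator `W^{s+t} → W^s` if and only if it is bounded on `W^∞`
for the two Sobolev norms. -/
def HasOrder (D : H →ₗ.[ℂ] H) (t : ℝ) (P : Module.End ℂ (smoothVectors D)) : Prop :=
  ∀ s : ℝ, ∃ C : ℝ, ∀ ξ : smoothVectors D, sobolevNorm D s (P ξ) ≤ C * sobolevNorm D (s + t) ξ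

/-- The bounded operator `T` maps `W^∞` to itself, `T` and `[D, T]` are in `Op^0(Δ)`, and for every
`k` the `k`-fold commutators of `Δ` with `T` and with `[D, T]` are in `Op^k(Δ)`. -/
def IsLaplaceCompatible (D : H →ₗ.[ℂ] H) (T : H →L[ℂ] H) : Prop :=
  ∃ hT : ∀ ξ ∈ smoothVectors D, T.toLinearMap ξ ∈ smoothVectors D,
    let P : Module.End ℂ (smoothVectors D) := T.toLinearMap.restrict hT
    let Q : Module.End ℂ (smoothVectors D) := diracEnd D * P - P * diracEnd D
    HasOrder D 0 P ∧ HasOrder D 0 Q ∧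
      ∀ k : ℕ, HasOrder D k (iterLaplaceComm D k P) ∧ HasOrder D k (iterLaplaceComm D k Q)

end Laplacian

/-! ### Twisted actions and covariant representations -/

section Twisted

variable {A : Type*} [CStarAlgebra A] {G : Type*} [Group G]

variable (A G) in
/-- A twisting pair `(ρ, σ)` for `A` and `G`. -/
structure TwistingPair where
  ρ : G → (A ≃⋆ₐ[ℂ] A)
  σ : G → G → unitary A
  cocycle : ∀ x y z, ρ x (σ y z : A) = σ x y * σ (x * y) z * star (σ x (y * z) : A)
  twist : ∀ x y a, ρ x (ρ y a) = σ x y * ρ (x * y) a * star (σ x y : A)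
  σ_one_right : ∀ x, σ x 1 = 1
  σ_one_left : ∀ x, σ 1 x = 1
  ρ_one : ∀ a, ρ 1 a = a

/-- The twisted action restricts to the smooth algebra `𝒜`. -/
structure TwistingPair.IsSmooth (τ : TwistingPair A G) (𝒜 : StarSubalgebra ℂ A) : Prop where
  ρ_mem : ∀ x, ∀ a ∈ 𝒜, τ.ρ x a ∈ 𝒜
  ρ_symm_mem : ∀ x, ∀ a ∈ 𝒜, (τ.ρ x).symm a ∈ 𝒜
  σ_mem : ∀ x y, (τ.σ x y : A) ∈ 𝒜

variable {H : Type*} [NormedAddCommGroup H] [InnerProductSpace ℂ H] [CompleteSpace H]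

/-- `(π, U)` is a twisted covariant representation of `(A, G, ρ, σ)`. -/
structure IsCovariantRep (τ : TwistingPair A G) (π : A →⋆ₐ[ℂ] (H →L[ℂ] H))
    (U : G → unitary (H →L[ℂ] H)) : Prop where
  mul : ∀ x y, (U x : H →L[ℂ] H) * U y = π (τ.σ x y) * U (x * y)
  covariant : ∀ x a, π (τ.ρ x a) = U x * π a * star (U x : H →L[ℂ] H)

/-- `(𝒜, H, D, π, U)` is a `G`-equivariant odd spectral triple over `A`, for a smooth twisted
action. -/
structure IsEquivariantTriple (τ : TwistingPair A G) (𝒜 : StarSubalgebra ℂ A)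
    (π : A →⋆ₐ[ℂ] (H →L[ℂ] H)) (D : H →ₗ.[ℂ] H) (U : G → unitary (H →L[ℂ] H)) : Prop where
  isSpectralTriple : IsSpectralTriple (𝒜 : Set A) π D
  isSmooth : τ.IsSmooth 𝒜
  isCovariantRep : IsCovariantRep τ π U
  boundedCommutator : ∀ g, ∃ C : H →L[ℂ] H, IsBoundedCommutator D (U g : H →L[ℂ] H) C

/-- `C_c(G, 𝒜)`, inside the finitely supported functions from `G` to `A`. -/
def finSupp (G : Type*) (𝒜 : StarSubalgebra ℂ A) : Set (G →₀ A) :=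
  {f | ∀ g, f g ∈ 𝒜}

/-- The integrated form `∑ₓ aₓ δₓ ↦ ∑ₓ π(aₓ) Uₓ` of `(π, U)` on finitely supported functions. -/
def integratedForm (π : A →⋆ₐ[ℂ] (H →L[ℂ] H)) (U : G → unitary (H →L[ℂ] H)) (f : G →₀ A) :
    H →L[ℂ] H :=
  f.sum fun g a => π a * (U g : H →L[ℂ] H)

/-- The C⋆-algebra generated by the image of `C_c(G, A)` under a representation `R`. -/
def cstarImage (R : (G →₀ A) → (H →L[ℂ] H)) : StarSubalgebra ℂ (H →L[ℂ] H) :=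
  (StarAlgebra.adjoin ℂ (Set.range R)).topologicalClosure

instance (R : (G →₀ A) → (H →L[ℂ] H)) : CStarAlgebra (cstarImage R) :=
  StarSubalgebra.cstarAlgebra _ (h_closed := StarSubalgebra.isClosed_topologicalClosure _)

/-- The element `R f` of the C⋆-algebra generated by the image of `R`. -/
def toImage (R : (G →₀ A) → (H →L[ℂ] H)) (f : G →₀ A) : cstarImage R :=
  ⟨R f, StarSubalgebra.le_topologicalClosure _ (StarAlgebra.subset_adjoin ℂ _ ⟨f, rfl⟩)⟩

end Twisted

/-! ### Weighted translations on `ℓ²(G, E)` and the reduced crossed product -/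

section Lp

variable {G : Type*} {E : Type*} [NormedAddCommGroup E] [InnerProductSpace ℂ E]

lemma weightedShift_sum_le (w : G → E →L[ℂ] E) {C : ℝ} (hw : ∀ z, ‖w z‖ ≤ C) (e : G ≃ G)
    (f : lp (fun _ : G => E) 2) (s : Finset G) :
    ∑ z ∈ s, ‖w z (f (e z))‖ ^ (2 : ENNReal).toReal ≤ (C * ‖f‖) ^ (2 : ENNReal).toReal := by
  have h2 : (0 : ℝ) < (2 : ENNReal).toReal := by norm_num
  have hpt : ∀ z, ‖w z (f (e z))‖ ≤ C * ‖f (e z)‖ := fun z => by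
    refine ((w z).le_opNorm _).trans ?_
    gcongr
    exact hw z
  by_cases hs : s.Nonempty
  · obtain ⟨z₀, -⟩ := hs
    have hC : 0 ≤ C := (norm_nonneg _).trans (hw z₀)
    calc ∑ z ∈ s, ‖w z (f (e z))‖ ^ (2 : ENNReal).toReal
        ≤ ∑ z ∈ s, (C * ‖f (e z)‖) ^ (2 : ENNReal).toReal := by
          gcongr with z _
          exact hpt z
      _ = C ^ (2 : ENNReal).toReal * ∑ z ∈ s, ‖f (e z)‖ ^ (2 : ENNReal).toReal := by
          rw [Finset.mul_sum]
          exact Finset.sum_congr rfl fun z _ => Real.mul_rpow hC (norm_nonneg _)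
      _ ≤ C ^ (2 : ENNReal).toReal * ‖f‖ ^ (2 : ENNReal).toReal := by
          gcongr
          have := lp.sum_rpow_le_norm_rpow h2 f (s.map e.toEmbedding)
          simpa using this
      _ = (C * ‖f‖) ^ (2 : ENNReal).toReal := (Real.mul_rpow hC (norm_nonneg _)).symm
  · rw [Finset.not_nonempty_iff_eq_empty] at hs
    subst hs
    simp only [Finset.sum_empty]
    norm_num
    exact sq_nonneg _

/-- The bounded operator `(T f)(z) = w(z) f(e z)` on `ℓ²(G, E)`, for a bounded family `w` of
operators on `E` and a bijection `e` of `G`. -/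
def weightedShift [Nonempty G] (w : G → E →L[ℂ] E) (C : ℝ) (hw : ∀ z, ‖w z‖ ≤ C) (e : G ≃ G) :
    lp (fun _ : G => E) 2 →L[ℂ] lp (fun _ : G => E) 2 :=
  LinearMap.mkContinuous
    { toFun := fun f => ⟨fun z => w z (f (e z)),
        memℓp_gen' (C := (C * ‖f‖) ^ (2 : ENNReal).toReal) (weightedShift_sum_le w hw e f)⟩
      map_add' := fun f g => by
        ext z
        exact (w z).map_add _ _
      map_smul' := fun c f => by
        ext z
        simp }
    C (fun f => lp.norm_le_of_forall_sum_le (by norm_num)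
        (mul_nonneg ((norm_nonneg _).trans (hw (Classical.arbitrary G))) (norm_nonneg _))
        (weightedShift_sum_le w hw e f))

end Lp

section Reduced

variable {A : Type*} [CStarAlgebra A] {G : Type*} [Group G]
variable {H : Type*} [NormedAddCommGroup H] [InnerProductSpace ℂ H] [CompleteSpace H]

lemma norm_regular_le (τ : TwistingPair A G) (π : A →⋆ₐ[ℂ] (H →L[ℂ] H)) (x : G) (a : A) (z : G) :
    ‖π (τ.ρ z⁻¹ a * τ.σ z⁻¹ x)‖ ≤ ‖a‖ := by
  refine (NonUnitalStarAlgHom.norm_apply_le π _).trans ?_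
  rw [CStarRing.norm_mul_coe_unitary]
  exact NonUnitalStarAlgHom.norm_apply_le (τ.ρ z⁻¹) a

/-- The left regular representation on `ℓ²(G, H)` induced by `π`:
`Π(a δₓ)(ξ ⊗ δ_y) = π(ρ_{y⁻¹x⁻¹}(a) σ_{y⁻¹x⁻¹,x}) ξ ⊗ δ_{xy}`, that is
`(Π(a δₓ) f)(z) = π(ρ_{z⁻¹}(a) σ_{z⁻¹,x}) f(x⁻¹z)`. -/
def regularRep (τ : TwistingPair A G) (π : A →⋆ₐ[ℂ] (H →L[ℂ] H)) (f : G →₀ A) :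
    lp (fun _ : G => H) 2 →L[ℂ] lp (fun _ : G => H) 2 :=
  f.sum fun x a => weightedShift (fun z => π (τ.ρ z⁻¹ a * τ.σ z⁻¹ x)) ‖a‖
    (norm_regular_le τ π x a) (Equiv.mulLeft x⁻¹)

/-- The reduced twisted crossed product, defined by the left regular representation induced by a
faithful representation `π`. -/
abbrev reducedCrossedProduct (τ : TwistingPair A G) (π : A →⋆ₐ[ℂ] (H →L[ℂ] H)) :
    StarSubalgebra ℂ (lp (fun _ : G => H) 2 →L[ℂ] lp (fun _ : G => H) 2) :=
  cstarImage (regularRep τ π)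

end Reduced

/-! ### Length functions and the spectral triple of the group -/

section Group

variable {G : Type*} [Group G] {V : Type*} [NormedAddCommGroup V] [InnerProductSpace ℂ V]

/-- A proper translation bounded length function with values in the self-adjoint operators of `V`.
Discreteness of the union of all spectra is meant in `ℝ`: it has no accumulation point. -/
structure IsProperTranslationBounded [CompleteSpace V] (ℓ : G → V →L[ℂ] V) : Prop where
  selfAdjoint : ∀ x, IsSelfAdjoint (ℓ x)
  translationBounded : ∀ y, ∃ C : ℝ, ∀ x, ‖ℓ x - ℓ (y⁻¹ * x)‖ ≤ C
  eq_zero_iff : ∀ x, ℓ x = 0 ↔ x = 1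
  discrete : ∀ R : ℝ, ((⋃ x, spectrum ℝ (ℓ x)) ∩ Set.Icc (-R) R).Finite
  finite_fibers : ∀ t ∈ ⋃ x, spectrum ℝ (ℓ x), {x | t ∈ spectrum ℝ (ℓ x)}.Finite

/-- The left regular representation, amplified to `ℓ²(G) ⊗ V = ℓ²(G, V)`:
`λ_g(δₓ ⊗ v) = δ_{gx} ⊗ v`. -/
def leftReg (V : Type*) [NormedAddCommGroup V] [InnerProductSpace ℂ V] (g : G) :
    lp (fun _ : G => V) 2 →L[ℂ] lp (fun _ : G => V) 2 :=
  weightedShift (fun _ => ContinuousLinearMap.id ℂ V) 1 (fun _ => ContinuousLinearMap.norm_id_le)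
    (Equiv.mulLeft g⁻¹)

/-- The operators on `ℓ²(G) ⊗ V` given by the group algebra `C_c(G)`. -/
def groupAlgebraOps (G : Type*) [Group G] (V : Type*) [NormedAddCommGroup V]
    [InnerProductSpace ℂ V] :
    Set (lp (fun _ : G => V) 2 →L[ℂ] lp (fun _ : G => V) 2) :=
  {T | ∃ f : G →₀ ℂ, T = f.sum fun g c => c • leftReg V g}

/-- The operator `M_ℓ` of multiplication by `ℓ` on `ℓ²(G) ⊗ V = ℓ²(G, V)`, on its maximal domain;
for self-adjoint `ℓ` this is the closure of its restriction to the finitely supported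
functions. -/
def mulLength (ℓ : G → V →L[ℂ] V) : lp (fun _ : G => V) 2 →ₗ.[ℂ] lp (fun _ : G => V) 2 where
  domain :=
    { carrier := {f | Memℓp (fun x => ℓ x (f x)) 2}
      zero_mem' := by
        have : (fun x => ℓ x ((0 : lp (fun _ : G => V) 2) x)) = 0 := by
          ext x
          simp
        rw [Set.mem_ofPred_eq, this]
        exact zero_memℓp
      add_mem' := by
        intro f g hf hg
        have : (fun x => ℓ x ((f + g) x)) = (fun x => ℓ x (f x)) + fun x => ℓ x (g x) := by
          ext x
          simp
        rw [Set.mem_ofPred_eq, this]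
        exact hf.add hg
      smul_mem' := by
        intro c f hf
        have : (fun x => ℓ x ((c • f) x)) = c • fun x => ℓ x (f x) := by
          ext x
          simp
        rw [Set.mem_ofPred_eq, this]
        exact hf.const_smul c }
  toFun :=
    { toFun := fun f => ⟨fun x => ℓ x ((f : lp (fun _ : G => V) 2) x), f.2⟩
      map_add' := fun f g => by
        ext x
        exact (ℓ x).map_add _ _
      map_smul' := fun c f => by
        ext x
        simp }

end Group

/-! ### Hilbert tensor products and the equivariant construction -/

section Product

variable (H K : Type*) [NormedAddCommGroup H] [InnerProductSpace ℂ H]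
  [NormedAddCommGroup K] [InnerProductSpace ℂ K]

/-- The Hilbert space tensor product: the completion of the algebraic tensor product. -/
def HilbertTensor : Type _ :=
  UniformSpace.Completion (H ⊗[ℂ] K)

instance : NormedAddCommGroup (HilbertTensor H K) :=
  inferInstanceAs (NormedAddCommGroup (UniformSpace.Completion (H ⊗[ℂ] K)))

instance : InnerProductSpace ℂ (HilbertTensor H K) :=
  inferInstanceAs (InnerProductSpace ℂ (UniformSpace.Completion (H ⊗[ℂ] K)))

instance : CompleteSpace (HilbertTensor H K) :=
  inferInstanceAs (CompleteSpace (UniformSpace.Completion (H ⊗[ℂ] K)))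

variable {H K}

/-- The simple tensor `x ⊗ y` in the Hilbert space tensor product. -/
def htmul (x : H) (y : K) : HilbertTensor H K :=
  ((x ⊗ₜ[ℂ] y : H ⊗[ℂ] K) : UniformSpace.Completion (H ⊗[ℂ] K))

/-- The operator `S ⊗ T` on the Hilbert space tensor product. -/
def tensorOp (S : H →L[ℂ] H) (T : K →L[ℂ] K) : HilbertTensor H K →L[ℂ] HilbertTensor H K :=
  (TensorProduct.mapL S T).completion

lemma tensorOp_htmul (S : H →L[ℂ] H) (T : K →L[ℂ] K) (x : H) (y : K) :
    tensorOp S T (htmul x y) = htmul (S x) (T y) :=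
  ContinuousLinearMap.completion_apply_coe (TensorProduct.mapL S T) (x ⊗ₜ[ℂ] y)

/-- The Hilbert space direct sum `E ⊕ E` of two copies of `E`. -/
abbrev Double (E : Type*) : Type _ :=
  WithLp 2 (E × E)

/-- The operator `T ⊕ T` on `E ⊕ E`. -/
def doubleOp {E : Type*} [NormedAddCommGroup E] [InnerProductSpace ℂ E] (T : E →L[ℂ] E) :
    Double E →L[ℂ] Double E :=
  ((WithLp.prodContinuousLinearEquiv 2 ℂ E E).symm : E × E →L[ℂ] Double E) ∘L (T.prodMap T) ∘L
    (WithLp.prodContinuousLinearEquiv 2 ℂ E E : Double E →L[ℂ] E × E)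

/-- The graph of the operator matrix with rows `(0, D₁ ⊗ 1 - i 1 ⊗ D₂)` and
`(D₁ ⊗ 1 + i 1 ⊗ D₂, 0)` on the direct sum of two copies of the algebraic tensor product
`Dom D₁ ⊗ Dom D₂`. -/
def productDiracGraph (D₁ : H →ₗ.[ℂ] H) (D₂ : K →ₗ.[ℂ] K) :
    Submodule ℂ (Double (HilbertTensor H K) × Double (HilbertTensor H K)) :=
  Submodule.span ℂ {p | ∃ (x x' : D₁.domain) (y y' : D₂.domain),
    p = (WithLp.toLp 2 (htmul (x : H) (y : K), htmul (x' : H) (y' : K)),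
      WithLp.toLp 2 (htmul (D₁ x') (y' : K) - Complex.I • htmul (x' : H) (D₂ y'),
        htmul (D₁ x) (y : K) + Complex.I • htmul (x : H) (D₂ y)))}

/-- The Dirac operator `D₁ × D₂` of the exterior product of two odd spectral triples: the closure of
the operator matrix with rows `(0, D₁ ⊗ 1 - i 1 ⊗ D₂)` and `(D₁ ⊗ 1 + i 1 ⊗ D₂, 0)`, which is
symmetric, hence closable, for self-adjoint `D₁` and `D₂`. -/
def productDirac (D₁ : H →ₗ.[ℂ] H) (D₂ : K →ₗ.[ℂ] K) :
    Double (HilbertTensor H K) →ₗ.[ℂ] Double (HilbertTensor H K) :=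
  (productDiracGraph D₁ D₂).topologicalClosure.toLinearPMap

end Product

section Equivariant

variable {A : Type*} [CStarAlgebra A] {G : Type*} [Group G]
variable {H : Type*} [NormedAddCommGroup H] [InnerProductSpace ℂ H] [CompleteSpace H]

/-- The Hilbert space `(H ⊗ ℓ²(G) ⊗ V) ⊕ (H ⊗ ℓ²(G) ⊗ V)` of the equivariant construction. -/
abbrev EquivariantSpace (H G V : Type*) [NormedAddCommGroup H] [InnerProductSpace ℂ H]
    [NormedAddCommGroup V] [InnerProductSpace ℂ V] : Type _ :=
  Double (HilbertTensor H (lp (fun _ : G => V) 2))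

/-- The representation of `C_c(G, A)` in the equivariant construction: two copies of
`a δ_h ↦ (ξ ⊗ δₓ ⊗ v ↦ π(a) U_h ξ ⊗ δ_{hx} ⊗ v)`. -/
def equivariantRep (V : Type*) [NormedAddCommGroup V] [InnerProductSpace ℂ V]
    (π : A →⋆ₐ[ℂ] (H →L[ℂ] H)) (U : G → unitary (H →L[ℂ] H)) (f : G →₀ A) :
    EquivariantSpace H G V →L[ℂ] EquivariantSpace H G V :=
  f.sum fun h a => doubleOp (tensorOp (π a * (U h : H →L[ℂ] H)) (leftReg V h))

/-- The Dirac operator of the equivariant construction. -/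
def equivariantDirac {V : Type*} [NormedAddCommGroup V] [InnerProductSpace ℂ V]
    (D : H →ₗ.[ℂ] H) (ℓ : G → V →L[ℂ] V) :
    EquivariantSpace H G V →ₗ.[ℂ] EquivariantSpace H G V :=
  productDirac D (mulLength ℓ)

end Equivariant

end TwistedTriple

end

/-!
Compactness of the resolvent diagonalises `D` in an orthonormal basis with eigenvalues `dᵢ`. A
bounded operator then becomes a matrix `n` defining a bounded form, and it lies in every
`Dom(δᵏ)` exactly when all the matrices `(|dᵢ| - |dⱼ|)ᵏ nᵢⱼ` are bounded ("smooth" matrices).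

* *Laplacian criterion.* With `aᵢ = √(1 + dᵢ²)`, the `k`-fold commutator with `Δ` is
  `(aᵢ² - aⱼ²)ᵏ nᵢⱼ = (aᵢ - aⱼ)ᵏ (aᵢ + aⱼ)ᵏ nᵢⱼ`. The Schur multiplier `√(aᵢ aⱼ) / (aᵢ + aⱼ)` is
  bounded, being the Gram matrix of the functions `t ↦ √aᵢ exp(-aᵢ t)`, so the factor
  `(aᵢ + aⱼ)ᵏ` can be removed; the three-lines theorem supplies the real Sobolev exponents.
* *Product Dirac operator.* In the product basis `D̃` is off-diagonal with entries `dᵢ ± i eⱼ`, so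
  `|D̃|` is diagonal with entries `√(dᵢ² + eⱼ²)`. As
  `|√(d² + e²) - √(d'² + e'²)| ≤ ||d| - |d'|| + ||e| - |e'||`, Kronecker products of smooth matrices
  are smooth.
* *Extension to the crossed product.* The Fell isometries `ξ ⊗ δ_y ↦ U_{y⁻¹}^* ξ ⊗ δ_y ⊗ v`
  intertwine the regular representation with `π(a) Uₓ ⊗ λₓ ⊗ 1`, and conjugating by them, for `v`
  in an orthonormal basis of `V`, is a `*`-homomorphism on all operators of `ℓ²(G, H)`.
-/

open scoped TensorProduct

noncomputable section

namespace TwistedTriple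

section BoundedMatrices

open ComplexConjugate

variable {ι : Type*}

/-- The sesquilinear form on `ℓ²(ι)` defined by the truncation of the matrix `n` to the finite set
`F` of indices. -/
def truncatedForm (F : Finset ι) (n : ι → ι → ℂ) (x y : ι → ℂ) : ℂ :=
  ∑ i ∈ F, ∑ j ∈ F, conj (y i) * n i j * x j

/-- The matrix `n` defines a bounded operator on `ℓ²(ι)`. By homogeneity the bound
`‖⟨y, n x⟩‖ ≤ 2 K ‖x‖ ‖y‖` on the truncations is equivalent to the one chosen here, which can be
integrated when `x` and `y` depend on a parameter. -/
def IsBoundedMatrix (n : ι → ι → ℂ) : Prop :=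
  ∃ K : ℝ, 0 < K ∧ ∀ (F : Finset ι) (x y : ι → ℂ),
    ‖truncatedForm F n x y‖ ≤ K * (∑ i ∈ F, ‖x i‖ ^ 2 + ∑ i ∈ F, ‖y i‖ ^ 2)

lemma truncatedForm_diag_mul_mul_diag (F : Finset ι) (n : ι → ι → ℂ) (g h x y : ι → ℂ) :
    truncatedForm F (fun i j => g i * n i j * h j) x y =
      truncatedForm F n (fun j => h j * x j) fun i => conj (g i) * y i :=
  Finset.sum_congr rfl fun i _ => Finset.sum_congr rfl fun j _ => by
    rw [map_mul, Complex.conj_conj]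
    ring

namespace IsBoundedMatrix

variable {m n : ι → ι → ℂ}

lemma zero : IsBoundedMatrix fun _ _ : ι => (0 : ℂ) :=
  ⟨1, one_pos, fun F x y => by
    simp only [truncatedForm, mul_zero, zero_mul, Finset.sum_const_zero, norm_zero]
    positivity⟩

lemma add (hm : IsBoundedMatrix m) (hn : IsBoundedMatrix n) :
    IsBoundedMatrix fun i j => m i j + n i j := by
  obtain ⟨K, hK, hm⟩ := hm
  obtain ⟨K', hK', hn⟩ := hn
  refine ⟨K + K', by positivity, fun F x y => ?_⟩
  have hsum : truncatedForm F (fun i j => m i j + n i j) x y =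
      truncatedForm F m x y + truncatedForm F n x y := by
    simp only [truncatedForm, mul_add, add_mul, Finset.sum_add_distrib]
  rw [hsum, add_mul]
  exact (norm_add_le _ _).trans (add_le_add (hm F x y) (hn F x y))

lemma diag_mul_mul_diag (hn : IsBoundedMatrix n) {g h : ι → ℂ} {c : ℝ}
    (hg : ∀ i, ‖g i‖ ≤ c) (hh : ∀ i, ‖h i‖ ≤ c) :
    IsBoundedMatrix fun i j => g i * n i j * h j := by
  obtain ⟨K, hK, hn⟩ := hn
  refine ⟨K * (c ^ 2 + 1), by positivity, fun F x y => ?_⟩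
  have norm_sq_mul_le (f : ι → ℂ) (hf : ∀ i, ‖f i‖ ≤ c) (z : ι → ℂ) :
      ∑ i ∈ F, ‖f i * z i‖ ^ 2 ≤ (c ^ 2 + 1) * ∑ i ∈ F, ‖z i‖ ^ 2 := by
    rw [Finset.mul_sum]
    refine Finset.sum_le_sum fun i _ => ?_
    rw [norm_mul, mul_pow]
    gcongr
    linarith [pow_le_pow_left₀ (norm_nonneg _) (hf i) 2]
  rw [truncatedForm_diag_mul_mul_diag]
  refine (hn F _ _).trans ?_
  rw [mul_assoc, mul_add (c ^ 2 + 1)]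
  gcongr
  · exact norm_sq_mul_le h hh x
  · exact norm_sq_mul_le (fun i => conj (g i)) (fun i => by simpa using hg i) y

lemma diag_mul (hn : IsBoundedMatrix n) {g : ι → ℂ} {c : ℝ} (hg : ∀ i, ‖g i‖ ≤ c) :
    IsBoundedMatrix fun i j => g i * n i j := by
  simpa using hn.diag_mul_mul_diag (h := fun _ => 1) (c := max c 1)
    (fun i => (hg i).trans (le_max_left _ _)) (by simp)

lemma mul_diag (hn : IsBoundedMatrix n) {g : ι → ℂ} {c : ℝ} (hg : ∀ i, ‖g i‖ ≤ c) :
    IsBoundedMatrix fun i j => n i j * g j := by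
  simpa using hn.diag_mul_mul_diag (g := fun _ => 1) (c := max c 1)
    (by simp) fun i => (hg i).trans (le_max_left _ _)

lemma const_mul (hn : IsBoundedMatrix n) (c : ℂ) : IsBoundedMatrix fun i j => c * n i j :=
  hn.diag_mul fun _ => le_refl ‖c‖

lemma sum {κ : Type*} (s : Finset κ) {n : κ → ι → ι → ℂ} (h : ∀ k ∈ s, IsBoundedMatrix (n k)) :
    IsBoundedMatrix fun i j => ∑ k ∈ s, n k i j := by
  classical
  induction s using Finset.induction_on with
  | empty => simpa using zero
  | insert k s hk ih =>
    simp only [Finset.sum_insert hk]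
    exact (h k (Finset.mem_insert_self _ _)).add (ih fun l hl => h l (Finset.mem_insert_of_mem hl))

end IsBoundedMatrix

end BoundedMatrices

section SchurMultipliers

open ComplexConjugate

variable {ι : Type*} {a : ι → ℝ} {n : ι → ι → ℂ}

lemma schurMultiplier_pow {P : (ι → ι → ℂ) → Prop} {k : ι → ι → ℝ}
    (hk : ∀ n, P n → P fun i j => (k i j : ℂ) * n i j) (l : ℕ) (hn : P n) :
    P fun i j => ((k i j ^ l : ℝ) : ℂ) * n i j := by
  induction l with
  | zero => simpa using hn
  | succ l ih => simpa [pow_succ', mul_assoc] using hk _ ih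

/-- The vector `√a e^{-ua} z`, for the diagonal matrix `a` and a time `u ≥ 0`. It serves to write
`√(aᵢaⱼ) / (aᵢ + aⱼ)` as the integral over `u` of `√aᵢ e^{-uaᵢ} √aⱼ e^{-uaⱼ}`. -/
def heatVector (a : ι → ℝ) (z : ι → ℂ) (u : ℝ) (i : ι) : ℂ :=
  ((√(a i) * Real.exp (-a i * u) : ℝ) : ℂ) * z i

open MeasureTheory Set

lemma integrableOn_exp_neg_mul_Ioi_zero {c : ℝ} (hc : 0 < c) :
    IntegrableOn (fun u => Real.exp (-c * u)) (Ioi 0) :=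
  integrableOn_exp_mul_Ioi (neg_lt_zero.2 hc) 0

lemma integral_exp_neg_mul_Ioi_zero {c : ℝ} (hc : 0 < c) :
    ∫ u in Ioi (0 : ℝ), Real.exp (-c * u) = 1 / c := by
  rw [integral_exp_mul_Ioi (neg_lt_zero.2 hc)]
  simp [neg_div_neg_eq]

lemma norm_heatVector_sq {i : ι} (ha : 0 ≤ a i) (z : ι → ℂ) (u : ℝ) :
    ‖heatVector a z u i‖ ^ 2 = a i * ‖z i‖ ^ 2 * Real.exp (-(2 * a i) * u) := by
  rw [heatVector, norm_mul, Complex.norm_real, Real.norm_eq_abs, mul_pow, sq_abs, mul_pow,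
    Real.sq_sqrt ha, ← Real.exp_nat_mul]
  push_cast
  ring_nf

lemma integrableOn_norm_heatVector_sq (ha : ∀ i, 0 < a i) (z : ι → ℂ) (i : ι) :
    IntegrableOn (fun u => ‖heatVector a z u i‖ ^ 2) (Ioi 0) := by
  simp only [norm_heatVector_sq (ha i).le]
  exact (integrableOn_exp_neg_mul_Ioi_zero (mul_pos two_pos (ha i))).const_mul _

lemma integral_sum_norm_heatVector_sq (ha : ∀ i, 0 < a i) (z : ι → ℂ) (F : Finset ι) :
    ∫ u in Ioi (0 : ℝ), ∑ i ∈ F, ‖heatVector a z u i‖ ^ 2 = (∑ i ∈ F, ‖z i‖ ^ 2) / 2 := by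
  rw [integral_finsetSum _ fun i _ => integrableOn_norm_heatVector_sq ha z i, Finset.sum_div]
  refine Finset.sum_congr rfl fun i _ => ?_
  simp only [norm_heatVector_sq (ha i).le]
  rw [integral_const_mul, integral_exp_neg_mul_Ioi_zero (mul_pos two_pos (ha i))]
  have := (ha i).ne'
  field_simp

lemma conj_heatVector_mul_mul_heatVector (x y : ι → ℂ) (u : ℝ) (i j : ι) :
    conj (heatVector a y u i) * n i j * heatVector a x u j =
      conj (y i) * n i j * x j * ((√(a i) * √(a j) : ℝ) : ℂ) *
        ((Real.exp (-(a i + a j) * u) : ℝ) : ℂ) := by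
  simp only [heatVector, map_mul, Complex.conj_ofReal]
  rw [show -(a i + a j) * u = -a i * u + -a j * u by ring, Real.exp_add]
  push_cast
  ring

lemma integral_truncatedForm_heatVector (ha : ∀ i, 0 < a i) (F : Finset ι) (x y : ι → ℂ) :
    ∫ u in Ioi (0 : ℝ), truncatedForm F n (heatVector a x u) (heatVector a y u) =
      truncatedForm F (fun i j => ((√(a i) * √(a j) / (a i + a j) : ℝ) : ℂ) * n i j) x y := by
  simp only [truncatedForm, conj_heatVector_mul_mul_heatVector]
  have hint (i j : ι) : IntegrableOn (fun u => conj (y i) * n i j * x j *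
      ((√(a i) * √(a j) : ℝ) : ℂ) * ((Real.exp (-(a i + a j) * u) : ℝ) : ℂ)) (Ioi 0) :=
    ((integrableOn_exp_neg_mul_Ioi_zero (add_pos (ha i) (ha j))).ofReal (𝕜 := ℂ)).const_mul _
  rw [integral_finsetSum _ fun i _ => integrable_finsetSum _ fun j _ => hint i j]
  refine Finset.sum_congr rfl fun i _ => ?_
  rw [integral_finsetSum _ fun j _ => hint i j]
  refine Finset.sum_congr rfl fun j _ => ?_
  rw [integral_const_mul, integral_complex_ofReal,
    integral_exp_neg_mul_Ioi_zero (add_pos (ha i) (ha j))]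
  push_cast
  ring

lemma IsBoundedMatrix.schur_sqrt_mul_sqrt_div_add (hn : IsBoundedMatrix n) (ha : ∀ i, 0 < a i) :
    IsBoundedMatrix fun i j => ((√(a i) * √(a j) / (a i + a j) : ℝ) : ℂ) * n i j := by
  obtain ⟨K, hK, hn⟩ := hn
  refine ⟨K, hK, fun F x y => ?_⟩
  have hint (z : ι → ℂ) : IntegrableOn (fun u => ∑ i ∈ F, ‖heatVector a z u i‖ ^ 2) (Ioi 0) :=
    integrable_finsetSum _ fun i _ => integrableOn_norm_heatVector_sq ha z i
  rw [← integral_truncatedForm_heatVector ha]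
  refine (norm_integral_le_of_norm_le (((hint x).add (hint y)).const_mul K)
    (Filter.Eventually.of_forall fun u => hn F _ _)).trans ?_
  rw [integral_const_mul, integral_add' (hint x) (hint y), integral_sum_norm_heatVector_sq ha,
    integral_sum_norm_heatVector_sq ha]
  gcongr <;> exact half_le_self (by positivity)

end SchurMultipliers

section Interpolation

open ComplexConjugate

variable {ι : Type*} {a : ι → ℝ} {n : ι → ι → ℂ}

/-- The matrix `a ^ z * n * a ^ (-z)`, for the diagonal matrix `a` and a complex exponent `z`. -/
def conjCpow (a : ι → ℝ) (z : ℂ) (n : ι → ι → ℂ) (i j : ι) : ℂ :=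
  (a i : ℂ) ^ z * n i j * (a j : ℂ) ^ (-z)

lemma conjCpow_ofReal (ha : ∀ i, 0 < a i) (t : ℝ) :
    conjCpow a t n = fun i j => (((a i / a j) ^ t : ℝ) : ℂ) * n i j := by
  ext i j
  rw [conjCpow, ← Complex.ofReal_neg, ← Complex.ofReal_cpow (ha i).le,
    ← Complex.ofReal_cpow (ha j).le, Real.div_rpow (ha i).le (ha j).le, Real.rpow_neg (ha j).le]
  push_cast
  ring

lemma norm_conjCpow (ha : ∀ i, 0 < a i) (z : ℂ) (i j : ι) :
    ‖conjCpow a z n i j‖ = (a i / a j) ^ z.re * ‖n i j‖ := by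
  rw [conjCpow, norm_mul, norm_mul, Complex.norm_cpow_eq_rpow_re_of_pos (ha i),
    Complex.norm_cpow_eq_rpow_re_of_pos (ha j), Complex.neg_re, Real.rpow_neg (ha j).le,
    Real.div_rpow (ha i).le (ha j).le]
  ring

lemma conjCpow_re_add_im (ha : ∀ i, 0 < a i) (z : ℂ) :
    conjCpow a z n = fun i j => (a i : ℂ) ^ (z.im * Complex.I) * conjCpow a z.re n i j *
      (a j : ℂ) ^ (-(z.im * Complex.I)) := by
  ext i j
  have ha' (k : ι) : (a k : ℂ) ≠ 0 := Complex.ofReal_ne_zero.2 (ha k).ne'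
  conv_lhs => rw [← Complex.re_add_im z]
  rw [conjCpow, conjCpow, neg_add, Complex.cpow_add _ _ (ha' i), Complex.cpow_add _ _ (ha' j)]
  ring

-- The imaginary part of the exponent contributes conjugation by a diagonal unitary.
lemma norm_truncatedForm_conjCpow_le (ha : ∀ i, 0 < a i) {K : ℝ} {z : ℂ}
    (hK : ∀ (F : Finset ι) (x y : ι → ℂ), ‖truncatedForm F (conjCpow a z.re n) x y‖ ≤
      K * (∑ i ∈ F, ‖x i‖ ^ 2 + ∑ i ∈ F, ‖y i‖ ^ 2)) (F : Finset ι) (x y : ι → ℂ) :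
    ‖truncatedForm F (conjCpow a z n) x y‖ ≤
      K * (∑ i ∈ F, ‖x i‖ ^ 2 + ∑ i ∈ F, ‖y i‖ ^ 2) := by
  rw [conjCpow_re_add_im ha, truncatedForm_diag_mul_mul_diag]
  refine (hK F _ _).trans_eq ?_
  simp [Complex.norm_cpow_eq_rpow_re_of_pos (ha _)]

lemma differentiable_truncatedForm_conjCpow (ha : ∀ i, 0 < a i) (F : Finset ι) (x y : ι → ℂ) :
    Differentiable ℂ fun z => truncatedForm F (conjCpow a z n) x y := by
  have ha' (k : ι) : (a k : ℂ) ≠ 0 := Complex.ofReal_ne_zero.2 (ha k).ne'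
  refine Differentiable.fun_sum fun i _ => Differentiable.fun_sum fun j _ => ?_
  exact (((differentiable_id.const_cpow (.inl (ha' i))).mul_const _).mul
    (differentiable_id.neg.const_cpow (.inl (ha' j)))).const_mul _ |>.mul_const _

lemma exists_norm_truncatedForm_conjCpow_le (ha : ∀ i, 0 < a i) (F : Finset ι) (x y : ι → ℂ)
    (s t : ℝ) :
    ∃ B, ∀ z : ℂ, z.re ∈ Set.Icc s t → ‖truncatedForm F (conjCpow a z n) x y‖ ≤ B := by
  refine ⟨∑ i ∈ F, ∑ j ∈ F,
    ‖y i‖ * (((a i / a j) ^ s + (a i / a j) ^ t) * ‖n i j‖) * ‖x j‖, fun z hz => ?_⟩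
  refine (norm_sum_le _ _).trans (Finset.sum_le_sum fun i _ => (norm_sum_le _ _).trans
    (Finset.sum_le_sum fun j _ => ?_))
  rw [norm_mul, norm_mul, RCLike.norm_conj, norm_conjCpow ha]
  gcongr
  have hpos : 0 < a i / a j := div_pos (ha i) (ha j)
  rcases le_total 1 (a i / a j) with h | h
  · exact (Real.rpow_le_rpow_of_exponent_le h hz.2).trans
      (le_add_of_nonneg_left (Real.rpow_pos_of_pos hpos s).le)
  · exact (Real.rpow_le_rpow_of_exponent_ge hpos h hz.1).trans
      (le_add_of_nonneg_right (Real.rpow_pos_of_pos hpos t).le)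

lemma IsBoundedMatrix.interpolate (ha : ∀ i, 0 < a i) {r s t : ℝ} (hst : s < t)
    (hs : IsBoundedMatrix fun i j => (((a i / a j) ^ s : ℝ) : ℂ) * n i j)
    (ht : IsBoundedMatrix fun i j => (((a i / a j) ^ t : ℝ) : ℂ) * n i j)
    (hr : r ∈ Set.Icc s t) :
    IsBoundedMatrix fun i j => (((a i / a j) ^ r : ℝ) : ℂ) * n i j := by
  simp only [← conjCpow_ofReal ha] at hs ht ⊢
  obtain ⟨K, hK, hs⟩ := hs
  obtain ⟨K', hK', ht⟩ := ht
  refine ⟨K + K', by positivity, fun F x y => ?_⟩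
  obtain ⟨B, hB⟩ := exists_norm_truncatedForm_conjCpow_le ha F x y s t (n := n)
  refine PhragmenLindelof.vertical_strip
    (differentiable_truncatedForm_conjCpow ha F x y).diffContOnCl
    ⟨0, div_pos Real.pi_pos (sub_pos.2 hst), 0, .of_bound B
      (Filter.eventually_inf_principal.2 (.of_forall fun z hz => ?_))⟩
    (fun z hz => ?_) (fun z hz => ?_) (by simpa using hr.1) (by simpa using hr.2)
  · simpa using hB z (Set.Ioo_subset_Icc_self hz)
  · refine (norm_truncatedForm_conjCpow_le ha (by rwa [hz]) F x y).trans ?_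
    gcongr
    linarith
  · refine (norm_truncatedForm_conjCpow_le ha (by rwa [hz]) F x y).trans ?_
    gcongr
    linarith

end Interpolation

section SmoothMatrices

variable {ι : Type*}

/-- The matrix `n` is in the domain of all powers of the derivation `[a, ·]`, for `a` a diagonal
matrix: the entries of the `k`-th iterated commutator are `(aᵢ - aⱼ) ^ k * nᵢⱼ`. -/
def IsSmoothMatrix (a : ι → ℝ) (n : ι → ι → ℂ) : Prop :=
  ∀ k : ℕ, IsBoundedMatrix fun i j => (((a i - a j) ^ k : ℝ) : ℂ) * n i j

namespace IsSmoothMatrix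

variable {a a' : ι → ℝ} {m n : ι → ι → ℂ}

lemma isBoundedMatrix (h : IsSmoothMatrix a n) : IsBoundedMatrix n := by simpa using h 0

lemma add (hm : IsSmoothMatrix a m) (hn : IsSmoothMatrix a n) :
    IsSmoothMatrix a fun i j => m i j + n i j :=
  fun k => by simpa [mul_add] using (hm k).add (hn k)

lemma const_mul (hn : IsSmoothMatrix a n) (c : ℂ) : IsSmoothMatrix a fun i j => c * n i j :=
  fun k => by simpa [mul_left_comm] using (hn k).const_mul c

lemma diag_mul (hn : IsSmoothMatrix a n) {g : ι → ℝ} {c : ℝ} (hg : ∀ i, |g i| ≤ c) :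
    IsSmoothMatrix a fun i j => (g i : ℂ) * n i j :=
  fun k => by simpa [mul_left_comm] using (hn k).diag_mul (g := fun i => g i) (c := c) (by simpa)

lemma mul_diag (hn : IsSmoothMatrix a n) {g : ι → ℝ} {c : ℝ} (hg : ∀ i, |g i| ≤ c) :
    IsSmoothMatrix a fun i j => n i j * (g j : ℂ) :=
  fun k => by simpa [mul_assoc] using (hn k).mul_diag (g := fun i => g i) (c := c) (by simpa)

lemma commutator (hn : IsSmoothMatrix a n) :
    IsSmoothMatrix a fun i j => ((a i - a j : ℝ) : ℂ) * n i j :=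
  fun k => by simpa [pow_succ, mul_assoc] using hn (k + 1)

lemma of_abs_sub_le (hn : IsSmoothMatrix a' n) {c : ℝ} (hc : ∀ i, |a i - a' i| ≤ c) :
    IsSmoothMatrix a n := by
  intro k
  induction k generalizing n with
  | zero => simpa using hn.isBoundedMatrix
  | succ k ih =>
    have h := (hn.commutator.add (hn.diag_mul hc)).add ((hn.mul_diag hc).const_mul (-1))
    convert ih h using 3 with i j
    push_cast
    ring

lemma schur_div (hn : IsSmoothMatrix a n) (ha : ∀ i, 1 ≤ a i) :
    IsSmoothMatrix a fun i j => ((a i / a j : ℝ) : ℂ) * n i j := by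
  have hinv (i : ι) : |(a i)⁻¹| ≤ 1 := by
    rw [abs_inv]
    exact inv_le_one_of_one_le₀ ((ha i).trans (le_abs_self _))
  convert hn.add (hn.commutator.mul_diag hinv) using 3 with i j
  have : (a j : ℂ) ≠ 0 := by exact_mod_cast (one_pos.trans_le (ha j)).ne'
  push_cast
  field_simp
  ring

lemma schur_div_swap (hn : IsSmoothMatrix a n) (ha : ∀ i, 1 ≤ a i) :
    IsSmoothMatrix a fun i j => ((a j / a i : ℝ) : ℂ) * n i j := by
  have hinv (i : ι) : |(a i)⁻¹| ≤ 1 := by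
    rw [abs_inv]
    exact inv_le_one_of_one_le₀ ((ha i).trans (le_abs_self _))
  convert hn.add ((hn.commutator.diag_mul hinv).const_mul (-1)) using 3 with i j
  have : (a i : ℂ) ≠ 0 := by exact_mod_cast (one_pos.trans_le (ha i)).ne'
  push_cast
  field_simp
  ring

lemma schur_div_rpow (hn : IsSmoothMatrix a n) (ha : ∀ i, 1 ≤ a i) (r : ℝ) :
    IsBoundedMatrix fun i j => (((a i / a j) ^ r : ℝ) : ℂ) * n i j := by
  obtain ⟨N, hN⟩ := exists_nat_gt |r|
  have ha0 (i : ι) : 0 < a i := one_pos.trans_le (ha i)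
  have hN0 : (0 : ℝ) < N := (abs_nonneg r).trans_lt hN
  refine .interpolate (s := -N) (t := N) ha0 (by linarith) ?_ ?_ ⟨(abs_lt.1 hN).1.le,
    (abs_lt.1 hN).2.le⟩
  · convert (schurMultiplier_pow (fun _ h => schur_div_swap h ha) N hn).isBoundedMatrix
      using 5 with i j
    rw [Real.rpow_neg (div_pos (ha0 i) (ha0 j)).le, Real.rpow_natCast, ← inv_pow, inv_div]
  · simp only [Real.rpow_natCast]
    exact (schurMultiplier_pow (fun _ h => schur_div h ha) N hn).isBoundedMatrix

-- `aᵢ² - aⱼ² = (aᵢ - aⱼ) (aᵢ / aⱼ + 1) aⱼ`, so each commutator with `a²` costs one power of `a`.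
lemma iterated_sq_commutator (hn : IsSmoothMatrix a n) (ha : ∀ i, 1 ≤ a i) (r : ℝ) (k : ℕ) :
    IsBoundedMatrix fun i j =>
      ((a i ^ r * (a i ^ 2 - a j ^ 2) ^ k * a j ^ (-(r + k)) : ℝ) : ℂ) * n i j := by
  have ha0 (i : ι) : 0 < a i := one_pos.trans_le (ha i)
  have hstep (m : ι → ι → ℂ) (hm : IsSmoothMatrix a m) :
      IsSmoothMatrix a fun i j => (((a i / a j + 1) * (a i - a j) : ℝ) : ℂ) * m i j := by
    convert (hm.commutator.schur_div ha).add hm.commutator using 3 with i j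
    push_cast
    ring
  convert (schurMultiplier_pow hstep k hn).schur_div_rpow ha r using 3 with i j
  rw [← mul_assoc, ← Complex.ofReal_mul]
  congr 2
  have hj := ha0 j
  rw [Real.div_rpow (ha0 i).le hj.le, Real.rpow_neg hj.le, Real.rpow_add hj, Real.rpow_natCast,
    sq_sub_sq, mul_pow, div_add_one hj.ne', mul_pow, div_pow]
  have := (Real.rpow_pos_of_pos hj r).ne'
  field_simp

lemma iterated_sq_commutator_div_sqrt (hn : IsSmoothMatrix a n) (ha : ∀ i, 1 ≤ a i) (k : ℕ) :
    IsBoundedMatrix fun i j =>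
      (((a i ^ 2 - a j ^ 2) ^ k / (√(a i) * √(a j)) ^ k : ℝ) : ℂ) * n i j := by
  have ha0 (i : ι) : 0 < a i := one_pos.trans_le (ha i)
  convert hn.iterated_sq_commutator ha (-(k / 2)) k using 5 with i j
  have hsqrt (i : ι) : a i ^ (-(k / 2 : ℝ)) = (√(a i) ^ k)⁻¹ := by
    rw [Real.rpow_neg (ha0 i).le, Real.sqrt_eq_rpow, ← Real.rpow_natCast,
      ← Real.rpow_mul (ha0 i).le]
    ring_nf
  rw [hsqrt, show -(-(k / 2 : ℝ) + k) = -(k / 2 : ℝ) by ring, hsqrt, mul_pow]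
  field_simp

lemma of_iterated_sq_commutator_div_sqrt (ha : ∀ i, 0 < a i)
    (h : ∀ k : ℕ, IsBoundedMatrix fun i j =>
      (((a i ^ 2 - a j ^ 2) ^ k / (√(a i) * √(a j)) ^ k : ℝ) : ℂ) * n i j) :
    IsSmoothMatrix a n := by
  intro k
  convert schurMultiplier_pow (fun _ hm => IsBoundedMatrix.schur_sqrt_mul_sqrt_div_add hm ha) k
    (h k) using 3 with i j
  rw [← mul_assoc, ← Complex.ofReal_mul]
  congr 2
  have hij : a i + a j ≠ 0 := (add_pos (ha i) (ha j)).ne'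
  have hsqrt : √(a i) * √(a j) ≠ 0 :=
    (mul_pos (Real.sqrt_pos.2 (ha i)) (Real.sqrt_pos.2 (ha j))).ne'
  rw [sq_sub_sq, div_pow, mul_pow (a i + a j)]
  field_simp

end IsSmoothMatrix

end SmoothMatrices

section Coefficients

open ComplexConjugate

variable {H : Type*} [NormedAddCommGroup H] [InnerProductSpace ℂ H] {ι : Type*}
  (b : HilbertBasis ι ℂ H)

lemma eq_of_forall_inner_basis_eq {x y : H} (h : ∀ i, inner ℂ (b i) x = inner ℂ (b i) y) :
    x = y := by
  apply b.repr.injective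
  ext i
  rw [b.repr_apply_apply, b.repr_apply_apply, h i]

lemma hasSum_norm_inner_basis_sq (x : H) :
    HasSum (fun i => ‖inner ℂ (b i) x‖ ^ 2) (‖x‖ ^ 2) := by
  simpa [b.repr_apply_apply] using lp.hasSum_norm (p := 2) (by norm_num) (b.repr x)

lemma norm_le_of_forall_norm_inner_basis_le {x y : H} {c : ℝ} (hc : 0 ≤ c)
    (h : ∀ i, ‖inner ℂ (b i) y‖ ≤ c * ‖inner ℂ (b i) x‖) : ‖y‖ ≤ c * ‖x‖ := by
  refine le_of_sq_le_sq ?_ (by positivity)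
  rw [mul_pow]
  refine hasSum_le (fun i => ?_) (hasSum_norm_inner_basis_sq b y)
    ((hasSum_norm_inner_basis_sq b x).mul_left _)
  rw [← mul_pow]
  exact pow_le_pow_left₀ (norm_nonneg _) (h i) 2

lemma exists_inner_basis_eq_of_summable {c : ι → ℂ} (h : Summable fun i => ‖c i‖ ^ 2) :
    ∃ w : H, ∀ i, inner ℂ (b i) w = c i := by
  have hc : Memℓp c 2 := memℓp_gen (by simpa using h)
  refine ⟨b.repr.symm ⟨c, hc⟩, fun i => ?_⟩
  rw [← b.repr_apply_apply, LinearIsometryEquiv.apply_symm_apply]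

lemma exists_inner_basis_eq_of_le {c : ι → ℂ} (K : ℝ) (x : H)
    (h : ∀ i, ‖c i‖ ≤ K * ‖inner ℂ (b i) x‖) : ∃ w : H, ∀ i, inner ℂ (b i) w = c i := by
  refine exists_inner_basis_eq_of_summable b (.of_nonneg_of_le (fun i => by positivity)
    (fun i => ?_) ((hasSum_norm_inner_basis_sq b x).summable.mul_left (K ^ 2)))
  rw [← mul_pow]
  exact pow_le_pow_left₀ (norm_nonneg _) (h i) 2

lemma inner_basis_basis [DecidableEq ι] (i j : ι) :
    inner ℂ (b i) (b j) = if i = j then (1 : ℂ) else 0 :=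
  orthonormal_iff_ite.1 b.orthonormal i j

lemma inner_basis_sum_smul_basis [DecidableEq ι] (F : Finset ι) (x : ι → ℂ) (i : ι) :
    inner ℂ (b i) (∑ j ∈ F, x j • b j) = if i ∈ F then x i else 0 := by
  simp only [inner_sum, inner_smul_right, inner_basis_basis, mul_ite, mul_one, mul_zero,
    Finset.sum_ite_eq]

lemma norm_sum_smul_basis_sq (F : Finset ι) (x : ι → ℂ) :
    ‖∑ i ∈ F, x i • b i‖ ^ 2 = ∑ i ∈ F, ‖x i‖ ^ 2 := by
  have h := congrArg Complex.re (b.orthonormal.inner_sum x x F)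
  rw [inner_self_eq_norm_sq_to_K] at h
  simp only [Complex.conj_mul', ← Complex.ofReal_pow, ← Complex.ofReal_sum] at h
  exact_mod_cast h

/-- The matrix of an operator in a Hilbert basis. -/
def matrixOf (T : H →L[ℂ] H) (i j : ι) : ℂ :=
  inner ℂ (b i) (T (b j))

lemma hasSum_matrixOf (T : H →L[ℂ] H) (x : H) (i : ι) :
    HasSum (fun j => matrixOf b T i j * inner ℂ (b j) x) (inner ℂ (b i) (T x)) := by
  have h := ((b.hasSum_repr x).mapL T).mapL (innerSL ℂ (b i))
  simpa [b.repr_apply_apply, matrixOf, mul_comm] using h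

lemma isBoundedMatrix_of_forall_exists {n : ι → ι → ℂ} {K : ℝ}
    (h : ∀ (F : Finset ι) (x : ι → ℂ), ∃ u : H, ‖u‖ ≤ K * ‖∑ j ∈ F, x j • b j‖ ∧
      ∀ i, inner ℂ (b i) u = ∑ j ∈ F, n i j * x j) : IsBoundedMatrix n := by
  refine ⟨|K| + 1, by positivity, fun F x y => ?_⟩
  obtain ⟨u, hu, hun⟩ := h F x
  have hform : truncatedForm F n x y = inner ℂ (∑ i ∈ F, y i • b i) u := by
    rw [sum_inner]
    refine Finset.sum_congr rfl fun i _ => ?_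
    rw [inner_smul_left, hun, Finset.mul_sum]
    exact Finset.sum_congr rfl fun j _ => mul_assoc _ _ _
  rw [hform, ← norm_sum_smul_basis_sq b F x, ← norm_sum_smul_basis_sq b F y]
  set v := ∑ i ∈ F, x i • b i
  set z := ∑ i ∈ F, y i • b i
  calc ‖inner ℂ z u‖ ≤ ‖z‖ * ‖u‖ := norm_inner_le_norm _ _
    _ ≤ ‖z‖ * (|K| * ‖v‖) := by
        gcongr
        exact hu.trans (by gcongr; exact le_abs_self K)
    _ = |K| * (‖v‖ * ‖z‖) := by ring
    _ ≤ (|K| + 1) * (‖v‖ ^ 2 + ‖z‖ ^ 2) := by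
        gcongr
        · linarith
        · nlinarith [sq_nonneg (‖v‖ - ‖z‖), norm_nonneg v, norm_nonneg z]

lemma isBoundedMatrix_matrixOf (T : H →L[ℂ] H) : IsBoundedMatrix (matrixOf b T) :=
  isBoundedMatrix_of_forall_exists b fun _ _ => ⟨_, T.le_opNorm _, fun i => by
    simp only [map_sum, map_smul, inner_sum, inner_smul_right, matrixOf, mul_comm]⟩

namespace IsBoundedMatrix

variable {n : ι → ι → ℂ}

lemma exists_sum_norm_mulVec_sq_le (hn : IsBoundedMatrix n) :
    ∃ M : ℝ, 0 ≤ M ∧ ∀ (F : Finset ι) (x : ι → ℂ),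
      ∑ i ∈ F, ‖∑ j ∈ F, n i j * x j‖ ^ 2 ≤ M * ∑ j ∈ F, ‖x j‖ ^ 2 := by
  obtain ⟨K, hK, hn⟩ := hn
  refine ⟨4 * K ^ 2, by positivity, fun F x => ?_⟩
  set v : ι → ℂ := fun i => ∑ j ∈ F, n i j * x j
  -- Testing the form on `2 K x` and `n x` makes the term `‖n x‖²` absorbable.
  have hform : truncatedForm F n (fun j => (2 * K : ℝ) * x j) v =
      ((2 * K * ∑ i ∈ F, ‖v i‖ ^ 2 : ℝ) : ℂ) := by
    rw [Finset.mul_sum, Complex.ofReal_sum]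
    refine Finset.sum_congr rfl fun i _ => ?_
    rw [Complex.ofReal_mul _ (‖v i‖ ^ 2), Complex.ofReal_pow, ← Complex.conj_mul' (v i),
      ← mul_assoc, Finset.mul_sum]
    exact Finset.sum_congr rfl fun j _ => by ring
  have hnorm : ∑ i ∈ F, ‖((2 * K : ℝ) : ℂ) * x i‖ ^ 2 = 4 * K ^ 2 * ∑ i ∈ F, ‖x i‖ ^ 2 := by
    rw [Finset.mul_sum]
    refine Finset.sum_congr rfl fun i _ => ?_
    rw [norm_mul, Complex.norm_real, Real.norm_of_nonneg (by positivity)]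
    ring
  have h := hn F (fun j => (2 * K : ℝ) * x j) v
  rw [hform, Complex.norm_real, Real.norm_of_nonneg (by positivity), hnorm] at h
  have : 2 * ∑ i ∈ F, ‖v i‖ ^ 2 ≤ 4 * K ^ 2 * ∑ i ∈ F, ‖x i‖ ^ 2 + ∑ i ∈ F, ‖v i‖ ^ 2 :=
    le_of_mul_le_mul_left (by linarith) hK
  linarith

lemma exists_columns (hn : IsBoundedMatrix n) :
    ∃ c : ι → H, ∀ i j, inner ℂ (b i) (c j) = n i j := by
  classical
  obtain ⟨M, -, h⟩ := hn.exists_sum_norm_mulVec_sq_le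
  suffices hcol : ∀ j, ∃ w : H, ∀ i, inner ℂ (b i) w = n i j by
    choose c hc using hcol
    exact ⟨c, fun i j => hc j i⟩
  refine fun j => exists_inner_basis_eq_of_summable b
    (summable_of_sum_le (c := M) (fun i => by positivity) fun F => ?_)
  calc ∑ i ∈ F, ‖n i j‖ ^ 2
      ≤ ∑ i ∈ insert j F, ‖n i j‖ ^ 2 :=
        Finset.sum_le_sum_of_subset_of_nonneg (Finset.subset_insert j F) fun i _ _ => by positivity
    _ ≤ M * ∑ i ∈ insert j F, ‖(Pi.single j 1 : ι → ℂ) i‖ ^ 2 := by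
        simpa [Pi.single_apply] using h (insert j F) (Pi.single j 1)
    _ = M := by
        rw [Finset.sum_eq_single_of_mem j (Finset.mem_insert_self j F) (by simp +contextual)]
        simp

lemma exists_norm_linearCombination_le (hn : IsBoundedMatrix n) {c : ι → H}
    (hc : ∀ i j, inner ℂ (b i) (c j) = n i j) :
    ∃ C : ℝ, ∀ x,
      ‖Finsupp.linearCombination ℂ c x‖ ≤ C * ‖Finsupp.linearCombination ℂ b x‖ := by
  classical
  obtain ⟨M, hM, h⟩ := hn.exists_sum_norm_mulVec_sq_le
  refine ⟨√M, fun x => ?_⟩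
  rw [← Real.sqrt_sq (norm_nonneg (Finsupp.linearCombination ℂ b x)), ← Real.sqrt_mul hM]
  refine Real.le_sqrt_of_sq_le (hasSum_le_of_sum_le (hasSum_norm_inner_basis_sq b _) fun F => ?_)
  have sum_eq (v : ι → H) :
      Finsupp.linearCombination ℂ v x = ∑ j ∈ F ∪ x.support, x j • v j := by
    rw [Finsupp.linearCombination_apply]
    exact Finsupp.sum_of_support_subset _ Finset.subset_union_right _ (by simp)
  have inner_eq (i : ι) : inner ℂ (b i) (Finsupp.linearCombination ℂ c x) =
      ∑ j ∈ F ∪ x.support, n i j * x j := by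
    simp only [sum_eq c, inner_sum, inner_smul_right, hc, mul_comm]
  refine (Finset.sum_le_sum_of_subset_of_nonneg (Finset.subset_union_left (s₂ := x.support))
    fun i _ _ => by positivity).trans ?_
  simp only [inner_eq, sum_eq b, norm_sum_smul_basis_sq]
  exact h _ _

lemma exists_matrixOf_eq [CompleteSpace H] (hn : IsBoundedMatrix n) :
    ∃ C : H →L[ℂ] H, ∀ i j, matrixOf b C i j = n i j := by
  obtain ⟨c, hc⟩ := hn.exists_columns b
  have hdense : DenseRange (Finsupp.linearCombination ℂ b) := by
    have := b.dense_span
    rwa [← Finsupp.range_linearCombination,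
      ← Submodule.dense_iff_topologicalClosure_eq_top] at this
  refine ⟨(Finsupp.linearCombination ℂ c).extendOfNorm (Finsupp.linearCombination ℂ b),
    fun i j => ?_⟩
  have h := LinearMap.extendOfNorm_eq hdense (hn.exists_norm_linearCombination_le b hc)
    (Finsupp.single j 1)
  rw [Finsupp.linearCombination_single, Finsupp.linearCombination_single, one_smul, one_smul] at h
  rw [matrixOf, h, hc]

end IsBoundedMatrix

end Coefficients

section Diagonal

variable {H : Type*} [NormedAddCommGroup H] [InnerProductSpace ℂ H] {ι : Type*}
  {b : HilbertBasis ι ℂ H}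

/-- The operator `S` is the maximal diagonal operator with eigenvalues `s` in the basis `b`. -/
def IsDiagonal (S : H →ₗ.[ℂ] H) (b : HilbertBasis ι ℂ H) (s : ι → ℝ) : Prop :=
  ∀ x w : H, (x, w) ∈ S.graph ↔ ∀ i, inner ℂ (b i) w = s i * inner ℂ (b i) x

namespace IsDiagonal

variable {S : H →ₗ.[ℂ] H} {s : ι → ℝ}

lemma inner_apply (hS : IsDiagonal S b s) (x : S.domain) (i : ι) :
    inner ℂ (b i) (S x) = s i * inner ℂ (b i) (x : H) :=
  (hS _ _).1 (S.mem_graph x) i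

lemma exists_apply_eq (hS : IsDiagonal S b s) {x w : H}
    (h : ∀ i, inner ℂ (b i) w = s i * inner ℂ (b i) x) :
    ∃ hx : x ∈ S.domain, S ⟨x, hx⟩ = w := by
  obtain ⟨y, rfl, rfl⟩ := (S.mem_graph_iff).1 ((hS x w).2 h)
  exact ⟨y.2, rfl⟩

lemma exists_apply_basis (hS : IsDiagonal S b s) (j : ι) :
    ∃ hx : b j ∈ S.domain, S ⟨b j, hx⟩ = (s j : ℂ) • b j := by
  classical
  refine hS.exists_apply_eq fun i => ?_
  rw [inner_smul_right, inner_basis_basis]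
  split_ifs with hij
  · rw [hij]
  · simp

lemma isBoundedCommutator_iff (hS : IsDiagonal S b s) {T C : H →L[ℂ] H} :
    IsBoundedCommutator S T C ↔
      ∀ i j, matrixOf b C i j = ((s i - s j : ℝ) : ℂ) * matrixOf b T i j := by
  constructor
  · intro h i j
    obtain ⟨hj, hSj⟩ := hS.exists_apply_basis j
    obtain ⟨hTj, hCj⟩ := h ⟨b j, hj⟩
    have := congrArg (inner ℂ (b i)) hCj
    rw [inner_sub_right, hS.inner_apply, hSj, map_smul, inner_smul_right] at this
    rw [matrixOf, ← this, Complex.ofReal_sub, sub_mul]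
    rfl
  · intro h x
    have key (i : ι) : inner ℂ (b i) (T (S x) + C x) = s i * inner ℂ (b i) (T x) := by
      rw [inner_add_right]
      refine ((hasSum_matrixOf b T (S x) i).add (hasSum_matrixOf b C x i)).unique ?_
      refine ((hasSum_matrixOf b T x i).mul_left (s i : ℂ)).congr_fun fun j => ?_
      rw [hS.inner_apply, h]
      push_cast
      ring
    obtain ⟨hTx, hSTx⟩ := hS.exists_apply_eq key
    exact ⟨hTx, by rw [hSTx, add_sub_cancel_left]⟩

lemma inDomInfty_iff [CompleteSpace H] (hS : IsDiagonal S b s) {T : H →L[ℂ] H} :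
    InDomInfty S T ↔ IsSmoothMatrix s (matrixOf b T) := by
  constructor
  · intro h k
    replace h := h k
    induction k generalizing T with
    | zero => simpa using isBoundedMatrix_matrixOf b T
    | succ k ih =>
      obtain ⟨C, hC, hCk⟩ := h
      convert ih hCk using 3 with i j
      rw [hS.isBoundedCommutator_iff.1 hC i j, pow_succ]
      push_cast
      ring
  · intro h k
    induction k generalizing T with
    | zero => trivial
    | succ k ih =>
      obtain ⟨C, hC⟩ := h.commutator.isBoundedMatrix.exists_matrixOf_eq b
      refine ⟨C, hS.isBoundedCommutator_iff.2 hC, ih ?_⟩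
      rw [show matrixOf b C = _ from funext₂ hC]
      exact h.commutator

end IsDiagonal

end Diagonal

section SelfAdjoint

variable {H : Type*} [NormedAddCommGroup H] [InnerProductSpace ℂ H] {D : H →ₗ.[ℂ] H}

lemma mem_eigenspace_iff_mem_graph {t : ℝ} {x : H} :
    x ∈ eigenspace D t ↔ (x, (t : ℂ) • x) ∈ D.graph := by
  rw [D.mem_graph_iff]
  constructor
  · rintro ⟨y, hy, rfl⟩
    exact ⟨y, rfl, sub_eq_zero.1 hy⟩
  · rintro ⟨y, rfl, h⟩
    exact ⟨y, sub_eq_zero.2 h, rfl⟩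

lemma isClosed_eigenspace (hD : D.IsClosed) (t : ℝ) : IsClosed (eigenspace D t : Set H) := by
  have : (eigenspace D t : Set H) = (fun x : H => (x, (t : ℂ) • x)) ⁻¹' (D.graph : Set (H × H)) :=
    Set.ext fun x => mem_eigenspace_iff_mem_graph
  rw [this]
  exact IsClosed.preimage (by fun_prop) hD

lemma mem_eigenspace_sup_eigenspace_neg {x w : H} {t : ℝ} (ht : t ≠ 0) (hx : (x, w) ∈ D.graph)
    (hw : (w, ((t ^ 2 : ℝ) : ℂ) • x) ∈ D.graph) : x ∈ eigenspace D t ⊔ eigenspace D (-t) := by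
  have add_mem {r : ℝ} (hr : r ≠ 0) (hrt : r ^ 2 = t ^ 2) :
      x + (r : ℂ)⁻¹ • w ∈ eigenspace D r := by
    have hr' : (r : ℂ) ≠ 0 := Complex.ofReal_ne_zero.2 hr
    rw [mem_eigenspace_iff_mem_graph]
    convert D.graph.add_mem hx (D.graph.smul_mem (r : ℂ)⁻¹ hw) using 1
    ext
    · rfl
    · simp only [Prod.snd_add, Prod.smul_snd, ← hrt, Complex.ofReal_pow]
      match_scalars <;> field_simp
  have hsum : x = (2 : ℂ)⁻¹ • (x + (t : ℂ)⁻¹ • w) + (2 : ℂ)⁻¹ • (x + ((-t : ℝ) : ℂ)⁻¹ • w) := by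
    rw [Complex.ofReal_neg, inv_neg]
    module
  rw [hsum]
  exact Submodule.add_mem_sup (Submodule.smul_mem _ _ (add_mem ht rfl))
    (Submodule.smul_mem _ _ (add_mem (neg_ne_zero.2 ht) (neg_sq t)))

variable [CompleteSpace H]

lemma isSelfAdjoint_iff_mem_graph (hdense : Dense (D.domain : Set H)) :
    IsSelfAdjoint D ↔
      ∀ x w, (x, w) ∈ D.graph ↔ ∀ y z, (y, z) ∈ D.graph → inner ℂ z x = inner ℂ y w := by
  have adjoint_iff (x w : H) :
      (x, w) ∈ D.adjoint.graph ↔ ∀ y z, (y, z) ∈ D.graph → inner ℂ z x = inner ℂ y w := by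
    simp only [LinearPMap.adjoint_graph_eq_graph_adjoint hdense, Submodule.mem_adjoint_iff,
      sub_eq_zero]
  simp only [← adjoint_iff, LinearPMap.isSelfAdjoint_def]
  exact ⟨fun h x w => by rw [h], fun h =>
    LinearPMap.eq_of_eq_graph (Submodule.ext fun p => (h p.1 p.2).symm)⟩

lemma inner_eq_inner_of_mem_graph (hD : IsSelfAdjoint D) {x w y z : H} (hx : (x, w) ∈ D.graph)
    (hy : (y, z) ∈ D.graph) : inner ℂ z x = inner ℂ y w :=
  ((isSelfAdjoint_iff_mem_graph hD.dense_domain).1 hD x w).1 hx y z hy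

lemma orthogonalFamily_eigenspace (hD : IsSelfAdjoint D) :
    OrthogonalFamily ℂ (fun t : ℝ => eigenspace D t) fun t => (eigenspace D t).subtypeₗᵢ := by
  intro s t hst x y
  have h := inner_eq_inner_of_mem_graph hD (mem_eigenspace_iff_mem_graph.1 y.2)
    (mem_eigenspace_iff_mem_graph.1 x.2)
  rw [inner_smul_left, inner_smul_right, Complex.conj_ofReal] at h
  exact (mul_eq_mul_right_iff.1 h).resolve_left (by exact_mod_cast hst)

lemma mem_iSup_eigenspace_of_sq (hD : IsSelfAdjoint D) {y w : H} {c : ℂ} (hy : (y, w) ∈ D.graph)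
    (hw : (w, c • y) ∈ D.graph) : y ∈ ⨆ t : ℝ, eigenspace D t := by
  rcases eq_or_ne y 0 with rfl | hy0
  · exact zero_mem _
  rcases eq_or_ne w 0 with rfl | hw0
  · refine le_iSup (eigenspace D) 0 (mem_eigenspace_iff_mem_graph.2 ?_)
    rwa [Complex.ofReal_zero, zero_smul]
  -- The eigenvalue `c` of `D²` is a square: `‖w‖² = ⟨D y, D y⟩ = ⟨y, D² y⟩ = c ‖y‖²`.
  have hc : c = (((‖w‖ / ‖y‖) ^ 2 : ℝ) : ℂ) := by
    have h := inner_eq_inner_of_mem_graph hD hw hy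
    rw [inner_smul_right, inner_self_eq_norm_sq_to_K, inner_self_eq_norm_sq_to_K] at h
    have : (‖y‖ : ℂ) ≠ 0 := Complex.ofReal_ne_zero.2 (norm_ne_zero_iff.2 hy0)
    rw [Complex.ofReal_pow, Complex.ofReal_div, div_pow, eq_div_iff (pow_ne_zero 2 this)]
    exact h.symm
  rw [hc] at hw
  exact sup_le (le_iSup (eigenspace D) _) (le_iSup (eigenspace D) _)
    (mem_eigenspace_sup_eigenspace_neg (by positivity) hy hw)

lemma orthogonal_iSup_eigenspace_eq_bot (hD : IsSelfAdjoint D) (hc : HasCompactResolvent D) :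
    (⨆ t : ℝ, eigenspace D t)ᗮ = ⊥ := by
  obtain ⟨T, hT, hTc, hTD⟩ := hc
  refine eq_bot_mono (Submodule.orthogonal_le (iSup_le fun μ y hy => ?_))
    (ContinuousLinearMap.orthogonalComplement_iSup_eigenspaces_eq_bot hTc hT.isSymmetric)
  have hTT : T (T y) = μ ^ 2 • y := by
    have : T y = μ • y := Module.End.mem_eigenspace_iff.1 hy
    rw [this, map_smul, this, smul_smul, sq]
  obtain ⟨w, hDy, hDDy⟩ : ∃ w, (μ ^ 2 • y, w) ∈ D.graph ∧ (w, y - μ ^ 2 • y) ∈ D.graph := by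
    obtain ⟨h₁, h₂, hsum⟩ := hTD y
    rw [← hTT, ← eq_sub_of_add_eq' hsum]
    exact ⟨_, D.mem_graph ⟨_, h₁⟩, D.mem_graph ⟨_, h₂⟩⟩
  rcases eq_or_ne (μ ^ 2) 0 with hμ | hμ
  · rw [hμ, zero_smul] at hDy hDDy
    have hw : w = 0 := D.graph_fst_eq_zero_snd hDy rfl
    have hy0 : y = 0 := by simpa using D.graph_fst_eq_zero_snd hDDy hw
    exact hy0 ▸ zero_mem _
  · have hy_inv : (μ ^ 2)⁻¹ • μ ^ 2 • y = y := inv_smul_smul₀ hμ y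
    have hDy' := D.graph.smul_mem (μ ^ 2)⁻¹ hDy
    have hDDy' := D.graph.smul_mem (μ ^ 2)⁻¹ hDDy
    rw [Prod.smul_mk, hy_inv] at hDy'
    rw [Prod.smul_mk, smul_sub, hy_inv] at hDDy'
    exact mem_iSup_eigenspace_of_sq hD (c := (μ ^ 2)⁻¹ - 1) hDy' (by rwa [sub_smul, one_smul])

lemma isDiagonal_of_basis_mem_eigenspace {ι : Type*} {b : HilbertBasis ι ℂ H} {d : ι → ℝ}
    (hD : IsSelfAdjoint D) (hb : ∀ i, b i ∈ eigenspace D (d i)) : IsDiagonal D b d := by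
  have inner_basis {x w : H} (h : (x, w) ∈ D.graph) (i : ι) :
      inner ℂ (b i) w = d i * inner ℂ (b i) x := by
    have := inner_eq_inner_of_mem_graph hD h (mem_eigenspace_iff_mem_graph.1 (hb i))
    rwa [inner_smul_left, Complex.conj_ofReal, eq_comm] at this
  refine fun x w => ⟨inner_basis, fun h => ?_⟩
  refine ((isSelfAdjoint_iff_mem_graph hD.dense_domain).1 hD x w).2 fun y z hyz => ?_
  refine (b.hasSum_inner_mul_inner z x).unique ?_
  refine (b.hasSum_inner_mul_inner y w).congr_fun fun i => ?_
  rw [h i, ← inner_conj_symm z, inner_basis hyz, map_mul, Complex.conj_ofReal, inner_conj_symm]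
  ring

lemma exists_isDiagonal.{u} {H : Type u} [NormedAddCommGroup H] [InnerProductSpace ℂ H]
    [CompleteSpace H] {D : H →ₗ.[ℂ] H} (hD : IsSelfAdjoint D) (hc : HasCompactResolvent D) :
    ∃ (ι : Type u) (b : HilbertBasis ι ℂ H) (d : ι → ℝ), IsDiagonal D b d := by
  have (t : ℝ) : CompleteSpace (eigenspace D t) :=
    (isClosed_eigenspace hD.isClosed t).completeSpace_coe
  choose w e _ using fun t : ℝ => exists_hilbertBasis ℂ (eigenspace D t)
  have hon := (orthogonalFamily_eigenspace hD).orthonormal_sigma_orthonormal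
    fun t => (e t).orthonormal
  have hperp : (Submodule.span ℂ (Set.range fun a : Σ t, w t =>
      (eigenspace D a.1).subtypeₗᵢ (e a.1 a.2)))ᗮ = ⊥ := by
    refine eq_bot_mono (fun x hx => ?_) (orthogonal_iSup_eigenspace_eq_bot hD hc)
    rw [Submodule.mem_orthogonal'] at hx
    rw [← Submodule.iInf_orthogonal, Submodule.mem_iInf]
    refine fun t => (Submodule.mem_orthogonal' _ _).2 fun y hy => ?_
    have h := (((e t).hasSum_repr ⟨y, hy⟩).mapL (eigenspace D t).subtypeL).mapL (innerSL ℂ x)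
    have hxe (i : w t) : inner ℂ x ((e t i : eigenspace D t) : H) = 0 :=
      hx _ (Submodule.subset_span ⟨⟨t, i⟩, rfl⟩)
    simp only [map_smul, Submodule.subtypeL_apply, innerSL_apply_apply, hxe, smul_zero] at h
    exact h.unique hasSum_zero
  refine ⟨_, HilbertBasis.mkOfOrthogonalEqBot hon hperp, fun a => a.1,
    isDiagonal_of_basis_mem_eigenspace hD fun a => ?_⟩
  rw [HilbertBasis.coe_mkOfOrthogonalEqBot]
  exact (e a.1 a.2).2

end SelfAdjoint

section DiagonalOperators

variable {H : Type*} [NormedAddCommGroup H] [InnerProductSpace ℂ H] {ι : Type*}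
  {b : HilbertBasis ι ℂ H}

lemma exists_inner_basis_apply_eq_mul [CompleteSpace H] (b : HilbertBasis ι ℂ H) {g : ι → ℝ} {c : ℝ}
    (hg : ∀ i, |g i| ≤ c) :
    ∃ T : H →L[ℂ] H, ∀ x i, inner ℂ (b i) (T x) = g i * inner ℂ (b i) x := by
  have hbdd := (isBoundedMatrix_matrixOf b (ContinuousLinearMap.id ℂ H)).diag_mul
    (g := fun i => (g i : ℂ)) (c := c) fun i => by simpa using hg i
  obtain ⟨T, hT⟩ := hbdd.exists_matrixOf_eq b
  refine ⟨T, fun x i => (hasSum_matrixOf b T x i).unique ?_⟩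
  refine ((hasSum_matrixOf b (ContinuousLinearMap.id ℂ H) x i).mul_left (g i : ℂ)).congr_fun
    fun j => ?_
  rw [hT, mul_assoc]

variable {T : H →L[ℂ] H} {g : ι → ℝ}

lemma isPositive_of_inner_basis_apply_eq_mul (hg : ∀ i, 0 ≤ g i)
    (hT : ∀ x i, inner ℂ (b i) (T x) = g i * inner ℂ (b i) x) : T.IsPositive := by
  have hinner (x y : H) : HasSum (fun i => (g i : ℂ) * (inner ℂ x (b i) * inner ℂ (b i) y))
      (inner ℂ (T x) y) := by
    refine (b.hasSum_inner_mul_inner (T x) y).congr_fun fun i => ?_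
    rw [← inner_conj_symm (T x), hT, map_mul, Complex.conj_ofReal, inner_conj_symm, mul_assoc]
  refine ⟨fun x y => (hinner x y).unique ?_, fun x => ?_⟩
  · refine (b.hasSum_inner_mul_inner x (T y)).congr_fun fun i => ?_
    rw [hT, mul_left_comm]
  · refine (Complex.hasSum_re (hinner x x)).nonneg fun i => ?_
    rw [← inner_conj_symm, Complex.conj_mul', ← Complex.ofReal_pow, ← Complex.ofReal_mul,
      Complex.ofReal_re]
    exact mul_nonneg (hg i) (sq_nonneg _)

lemma isCompactOperator_of_inner_basis_apply_eq_mul [CompleteSpace H]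
    (hT : ∀ x i, inner ℂ (b i) (T x) = g i * inner ℂ (b i) x)
    (hg : ∀ ε > 0, {i | ε ≤ |g i|}.Finite) : IsCompactOperator T := by
  classical
  let F (n : ℕ) : Finset ι := (hg (1 / ((n : ℝ) + 1)) (by positivity)).toFinset
  let A (n : ℕ) : H →L[ℂ] H :=
    ∑ i ∈ F n, (ContinuousLinearMap.toSpanSingleton ℂ (b i)).comp ((g i : ℂ) • innerSL ℂ (b i))
  have hA (n : ℕ) (x : H) (j : ι) :
      inner ℂ (b j) (A n x) = if j ∈ F n then g j * inner ℂ (b j) x else 0 := by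
    rw [← inner_basis_sum_smul_basis b (F n) (fun j => g j * inner ℂ (b j) x)]
    simp [A, mul_assoc]
  have hAcompact (n : ℕ) : IsCompactOperator (A n) :=
    (compactOperator (RingHom.id ℂ) H H).sum_mem fun i _ =>
      (isCompactOperator_of_locallyCompactSpace_dom ((g i : ℂ) • innerSL ℂ (b i))).clm_comp
        (ContinuousLinearMap.toSpanSingleton ℂ (b i))
  refine isCompactOperator_of_tendsto (F := A) (l := Filter.atTop) ?_
    (Filter.Eventually.of_forall hAcompact)
  rw [tendsto_iff_norm_sub_tendsto_zero]
  refine squeeze_zero (fun n => norm_nonneg _) (fun n => ?_)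
    tendsto_one_div_add_atTop_nhds_zero_nat
  refine ContinuousLinearMap.opNorm_le_bound _ (by positivity) fun x => ?_
  refine norm_le_of_forall_norm_inner_basis_le b (by positivity) fun i => ?_
  rw [sub_apply, inner_sub_right, hA, hT]
  split_ifs with hi
  · rw [sub_self, norm_zero]
    positivity
  · simp only [F, Set.Finite.mem_toFinset, Set.mem_ofPred_eq, not_le] at hi
    rw [zero_sub, norm_neg, norm_mul, Complex.norm_real]
    gcongr
    exact hi.le

lemma finite_setOf_le_norm_inner_apply (hT : IsCompactOperator T) {v : ι → H}
    (hv : Orthonormal ℂ v) {c : ℝ} (hc : 0 < c) :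
    {i | c ≤ ‖inner ℂ (v i) (T (v i))‖}.Finite := by
  by_contra hinf
  let f := Set.Infinite.natEmbedding _ hinf
  obtain ⟨K, hK, hsub⟩ :=
    hT.image_closedBall_subset_compact (r := 1) (𝕜₁ := ℂ) (f := (T : H →ₗ[ℂ] H))
  have hmem (n : ℕ) : T (v (f n)) ∈ K := hsub ⟨v (f n), by simp [hv.1], rfl⟩
  obtain ⟨a, -, φ, hφ, hlim⟩ := hK.tendsto_subseq hmem
  have hweak : Filter.Tendsto (fun n => ‖inner ℂ (v (f (φ n))) a‖ ^ 2) .atTop (nhds 0) :=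
    (hv.inner_products_summable a).tendsto_cofinite_zero.comp
      ((Function.Injective.tendsto_cofinite (Subtype.val_injective.comp f.injective)).comp
        (Nat.cofinite_eq_atTop ▸ hφ.tendsto_atTop))
  have hdist : Filter.Tendsto (fun n => ‖T (v (f (φ n))) - a‖) .atTop (nhds 0) :=
    tendsto_iff_norm_sub_tendsto_zero.1 hlim
  obtain ⟨n, hn₁, hn₂⟩ := ((hweak.eventually_lt_const (u := (c / 2) ^ 2) (by positivity)).and
    (hdist.eventually_lt_const (half_pos hc))).exists
  have hle : c ≤ ‖inner ℂ (v (f (φ n))) (T (v (f (φ n))))‖ := (f (φ n)).2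
  refine hle.not_gt ?_
  set w := v (f (φ n))
  calc ‖inner ℂ w (T w)‖ = ‖inner ℂ w (T w - a) + inner ℂ w a‖ := by
        rw [← inner_add_right, sub_add_cancel]
    _ ≤ ‖inner ℂ w (T w - a)‖ + ‖inner ℂ w a‖ := norm_add_le _ _
    _ ≤ ‖T w - a‖ + ‖inner ℂ w a‖ := by
        gcongr
        exact (norm_inner_le_norm _ _).trans_eq (by simp [w, hv.1])
    _ < c / 2 + c / 2 := add_lt_add hn₂ (lt_of_pow_lt_pow_left₀ 2 (by positivity) hn₁)
    _ = c := add_halves c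

end DiagonalOperators

section Weight

variable {ι : Type*} (d : ι → ℝ)

/-- The eigenvalues of `Δ^{1/2} = (1 + D²)^{1/2}`, where `d` are those of `D`. -/
def weight (i : ι) : ℝ :=
  √(1 + d i ^ 2)

lemma one_le_weight (i : ι) : 1 ≤ weight d i :=
  Real.one_le_sqrt.2 (by nlinarith [sq_nonneg (d i)])

lemma weight_pos (i : ι) : 0 < weight d i :=
  one_pos.trans_le (one_le_weight d i)

lemma weight_sq (i : ι) : weight d i ^ 2 = 1 + d i ^ 2 :=
  Real.sq_sqrt (by positivity)

lemma abs_le_weight (i : ι) : |d i| ≤ weight d i :=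
  Real.abs_le_sqrt (by linarith)

lemma weight_le_add_one (i : ι) : weight d i ≤ |d i| + 1 := by
  rw [weight, Real.sqrt_le_left (by positivity)]
  nlinarith [sq_abs (d i), abs_nonneg (d i)]

lemma ofReal_weight_rpow_neg_mul (r : ℝ) (i : ι) :
    ((weight d i ^ (-r) : ℝ) : ℂ) * ((weight d i ^ r : ℝ) : ℂ) = 1 := by
  rw [← Complex.ofReal_mul, ← Real.rpow_add (weight_pos d i)]
  simp

variable {d} in
lemma isSmoothMatrix_weight_iff {n : ι → ι → ℂ} :
    IsSmoothMatrix (weight d) n ↔ IsSmoothMatrix (fun i => |d i|) n := by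
  have hdist (i : ι) : |weight d i - (|d i|)| ≤ 1 := by
    rw [abs_le]
    constructor <;> linarith [abs_le_weight d i, weight_le_add_one d i]
  exact ⟨fun h => h.of_abs_sub_le fun i => (abs_sub_comm _ _).trans_le (hdist i),
    fun h => h.of_abs_sub_le hdist⟩

end Weight

section DiagonalConverse

variable {H : Type*} [NormedAddCommGroup H] [InnerProductSpace ℂ H] {ι : Type*}
  {b : HilbertBasis ι ℂ H} {D : H →ₗ.[ℂ] H} {d : ι → ℝ}

lemma IsDiagonal.dense_domain (hD : IsDiagonal D b d) : Dense (D.domain : Set H) := by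
  have hspan : Submodule.span ℂ (Set.range b) ≤ D.domain :=
    Submodule.span_le.2 (Set.range_subset_iff.2 fun i => (hD.exists_apply_basis i).fst)
  exact (Submodule.dense_iff_topologicalClosure_eq_top.2 b.dense_span).mono hspan

lemma IsDiagonal.isSelfAdjoint [CompleteSpace H] (hD : IsDiagonal D b d) : IsSelfAdjoint D := by
  refine (isSelfAdjoint_iff_mem_graph hD.dense_domain).2 fun x w => ⟨fun hx y z hy => ?_,
    fun h => (hD x w).2 fun i => ?_⟩
  · refine (b.hasSum_inner_mul_inner z x).unique ?_
    refine (b.hasSum_inner_mul_inner y w).congr_fun fun i => ?_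
    rw [← inner_conj_symm z, (hD y z).1 hy, (hD x w).1 hx, map_mul, Complex.conj_ofReal,
      inner_conj_symm]
    ring
  · obtain ⟨hi, hi'⟩ := hD.exists_apply_basis i
    have := h (b i) ((d i : ℂ) • b i) (hi' ▸ D.mem_graph ⟨b i, hi⟩)
    rw [← this, inner_smul_left, Complex.conj_ofReal]

lemma mem_graph_laplacian {x w : H} :
    (x, w) ∈ (laplacian D).graph ↔ ∃ v, (x, v) ∈ D.graph ∧ (v, w - x) ∈ D.graph := by
  constructor
  · intro h
    obtain ⟨⟨y, hy, hy'⟩, rfl, rfl⟩ := (LinearPMap.mem_graph_iff _).1 h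
    refine ⟨D ⟨y, hy⟩, D.mem_graph ⟨y, hy⟩, ?_⟩
    change (D ⟨y, hy⟩, y + D ⟨D ⟨y, hy⟩, hy'⟩ - y) ∈ D.graph
    rw [add_sub_cancel_left]
    exact D.mem_graph ⟨D ⟨y, hy⟩, hy'⟩
  · rintro ⟨v, hx, hv⟩
    obtain ⟨⟨x, h₁⟩, rfl, rfl⟩ := D.mem_graph_iff.1 hx
    obtain ⟨⟨v, h₂⟩, rfl, h₃⟩ := D.mem_graph_iff.1 hv
    refine (LinearPMap.mem_graph_iff _).2 ⟨⟨x, ⟨h₁, h₂⟩⟩, rfl, ?_⟩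
    change x + D ⟨D ⟨x, h₁⟩, h₂⟩ = w
    rw [h₃, add_sub_cancel]

lemma IsDiagonal.laplacian (hD : IsDiagonal D b d) :
    IsDiagonal (laplacian D) b fun i => weight d i ^ 2 := by
  intro x w
  simp only [mem_graph_laplacian, hD _ _, weight_sq]
  constructor
  · rintro ⟨v, hv, hw⟩ i
    have := hw i
    rw [hv, inner_sub_right] at this
    push_cast
    linear_combination this
  · intro hw
    obtain ⟨v, hv⟩ := exists_inner_basis_eq_of_le b (c := fun i => d i * inner ℂ (b i) x) 1 w
      fun i => by
        rw [hw, norm_mul, norm_mul, Complex.norm_real, Complex.norm_real, one_mul,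
          Real.norm_eq_abs, Real.norm_of_nonneg (by positivity)]
        gcongr
        nlinarith [sq_abs (d i), sq_nonneg (|d i| - 1), abs_nonneg (d i)]
    refine ⟨v, hv, fun i => ?_⟩
    rw [inner_sub_right, hv, hw]
    push_cast
    ring

lemma hasCompactResolvent_iff [CompleteSpace H] : HasCompactResolvent D ↔
    ∃ T : H →L[ℂ] H, T.IsPositive ∧ IsCompactOperator T ∧
      ∀ x, (T (T x), x) ∈ (laplacian D).graph := by
  have mem_iff (T : H →L[ℂ] H) (x : H) : (T (T x), x) ∈ (laplacian D).graph ↔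
      ∃ (h₁ : T (T x) ∈ D.domain) (h₂ : D ⟨T (T x), h₁⟩ ∈ D.domain),
        T (T x) + D ⟨D ⟨T (T x), h₁⟩, h₂⟩ = x := by
    rw [LinearPMap.mem_graph_iff]
    exact ⟨fun ⟨⟨_, h₁, h₂⟩, hy, h⟩ => by subst hy; exact ⟨h₁, h₂, h⟩,
      fun ⟨h₁, h₂, h⟩ => ⟨⟨_, h₁, h₂⟩, rfl, h⟩⟩
  simp only [mem_iff, HasCompactResolvent]

lemma IsDiagonal.hasCompactResolvent [CompleteSpace H] (hD : IsDiagonal D b d)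
    (hd : ∀ R : ℝ, {i | |d i| ≤ R}.Finite) : HasCompactResolvent D := by
  have hinv (i : ι) : 0 < (weight d i)⁻¹ := inv_pos.2 (weight_pos d i)
  obtain ⟨T, hT⟩ := exists_inner_basis_apply_eq_mul b (g := fun i => (weight d i)⁻¹) (c := 1)
    fun i => by
      rw [abs_of_pos (hinv i)]
      exact inv_le_one_of_one_le₀ (one_le_weight d i)
  refine hasCompactResolvent_iff.2 ⟨T,
    isPositive_of_inner_basis_apply_eq_mul (fun i => (hinv i).le) hT,
    isCompactOperator_of_inner_basis_apply_eq_mul hT fun ε hε => (hd ε⁻¹).subset fun i hi => ?_,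
    fun x => (hD.laplacian _ _).2 fun i => ?_⟩
  · simp only [Set.mem_ofPred_eq, abs_of_pos (hinv i)] at hi
    exact (abs_le_weight d i).trans ((le_inv_comm₀ hε (weight_pos d i)).1 hi)
  · have hne : (weight d i : ℂ) ≠ 0 := by exact_mod_cast (weight_pos d i).ne'
    simp only [hT]
    push_cast
    field_simp

lemma IsDiagonal.finite_of_hasCompactResolvent [CompleteSpace H] (hD : IsDiagonal D b d)
    (hc : HasCompactResolvent D) (R : ℝ) : {i | |d i| ≤ R}.Finite := by
  classical
  obtain ⟨T, -, hTc, hTD⟩ := hasCompactResolvent_iff.1 hc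
  have hentry (i : ι) : inner ℂ (b i) ((T ∘L T) (b i)) = ((weight d i ^ 2)⁻¹ : ℝ) := by
    have := (hD.laplacian _ _).1 (hTD (b i)) i
    rw [inner_basis_basis, if_pos rfl] at this
    rw [Complex.ofReal_inv]
    exact eq_inv_of_mul_eq_one_right this.symm
  have hfin := finite_setOf_le_norm_inner_apply (T := T ∘L T) (hTc.comp_clm T) b.orthonormal
    (c := (1 + R ^ 2)⁻¹) (by positivity)
  refine hfin.subset fun i hi => ?_
  rw [Set.mem_ofPred_eq, hentry, Complex.norm_real, Real.norm_of_nonneg (by positivity), weight_sq,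
    ← sq_abs (d i)]
  have hi : |d i| ≤ R := hi
  gcongr

end DiagonalConverse

section FunctionalCalculus

variable {H : Type*} [NormedAddCommGroup H] [InnerProductSpace ℂ H] {ι : Type*}
  {b : HilbertBasis ι ℂ H} {D : H →ₗ.[ℂ] H} {d : ι → ℝ}

lemma IsDiagonal.mem_eigenspace_iff (hD : IsDiagonal D b d) {t : ℝ} {x : H} :
    x ∈ eigenspace D t ↔ ∀ i, d i ≠ t → inner ℂ (b i) x = 0 := by
  rw [mem_eigenspace_iff_mem_graph, hD]
  refine forall_congr' fun i => ?_
  rw [inner_smul_right, mul_eq_mul_right_iff, Complex.ofReal_inj, eq_comm, or_iff_not_imp_left]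

lemma IsDiagonal.mem_powDomain_iff {L : H →ₗ.[ℂ] H} {l : ι → ℝ} (hL : IsDiagonal L b l)
    (hl : ∀ i, 1 ≤ l i) (n : ℕ) (x : H) :
    x ∈ powDomain L n ↔ ∃ w, ∀ i, inner ℂ (b i) w = ((l i ^ n : ℝ) : ℂ) * inner ℂ (b i) x := by
  induction n generalizing x with
  | zero => exact ⟨fun _ => ⟨x, by simp⟩, fun _ => trivial⟩
  | succ n ih =>
    rw [mem_powDomain_succ]
    constructor
    · rintro ⟨hx, h⟩
      obtain ⟨w, hw⟩ := (ih _).1 h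
      refine ⟨w, fun i => ?_⟩
      rw [hw, hL.inner_apply, pow_succ]
      push_cast
      ring
    · rintro ⟨w, hw⟩
      obtain ⟨v, hv⟩ := exists_inner_basis_eq_of_le b (c := fun i => l i * inner ℂ (b i) x) 1 w
        fun i => by
          have h1 := hl i
          rw [hw, norm_mul, norm_mul, Complex.norm_real, Complex.norm_real, one_mul,
            Real.norm_of_nonneg (by linarith), Real.norm_of_nonneg (by positivity)]
          gcongr
          exact le_self_pow₀ h1 n.succ_ne_zero
      obtain ⟨hx, rfl⟩ := hL.exists_apply_eq hv
      refine ⟨hx, (ih _).2 ⟨w, fun i => ?_⟩⟩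
      rw [hw, hv, pow_succ]
      push_cast
      ring

lemma IsDiagonal.mem_smoothVectors_iff (hD : IsDiagonal D b d) {x : H} :
    x ∈ smoothVectors D ↔
      ∀ s : ℝ, ∃ w, ∀ i, inner ℂ (b i) w = ((weight d i ^ s : ℝ) : ℂ) * inner ℂ (b i) x := by
  have hl : ∀ i, 1 ≤ weight d i ^ 2 := fun i => one_le_pow₀ (one_le_weight d i)
  rw [mem_smoothVectors]
  simp only [hD.laplacian.mem_powDomain_iff hl]
  constructor
  · intro h s
    obtain ⟨n, hn⟩ := exists_nat_ge s
    obtain ⟨w, hw⟩ := h n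
    refine exists_inner_basis_eq_of_le b 1 w fun i => ?_
    have := weight_pos d i
    rw [hw, norm_mul, norm_mul, Complex.norm_real, Complex.norm_real, one_mul,
      Real.norm_of_nonneg (by positivity), Real.norm_of_nonneg (by positivity)]
    gcongr
    rw [← pow_mul, ← Real.rpow_natCast]
    refine Real.rpow_le_rpow_of_exponent_le (one_le_weight d i) (hn.trans ?_)
    exact_mod_cast Nat.le_mul_of_pos_left n two_pos
  · intro h n
    obtain ⟨w, hw⟩ := h (2 * n : ℕ)
    refine ⟨w, fun i => ?_⟩
    rw [hw, Real.rpow_natCast, pow_mul]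

lemma IsDiagonal.basis_mem_smoothVectors (hD : IsDiagonal D b d) (j : ι) :
    b j ∈ smoothVectors D := by
  classical
  rw [hD.mem_smoothVectors_iff]
  intro s
  refine ⟨((weight d j ^ s : ℝ) : ℂ) • b j, fun i => ?_⟩
  rw [inner_smul_right, inner_basis_basis]
  split_ifs with h
  · rw [h]
  · simp

variable [CompleteSpace H]

lemma IsDiagonal.inner_spectralProj (hD : IsDiagonal D b d) (t : ℝ) (x : H) (i : ι) :
    inner ℂ (b i) (spectralProj D t x) = if d i = t then inner ℂ (b i) x else 0 := by
  classical
  rw [spectralProj, ← Submodule.inner_starProjection_left_eq_right]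
  split_ifs with hi
  · rw [Submodule.starProjection_eq_self_iff.2]
    refine Submodule.le_topologicalClosure _ (hD.mem_eigenspace_iff.2 fun j hj => ?_)
    rw [inner_basis_basis, if_neg]
    rintro rfl
    exact hj hi
  · rw [(Submodule.starProjection_apply_eq_zero_iff _).2, inner_zero_left]
    rw [Submodule.mem_orthogonal]
    intro y hy
    rw [(isClosed_eigenspace hD.isSelfAdjoint.isClosed t).submodule_topologicalClosure_eq] at hy
    rw [← inner_conj_symm, hD.mem_eigenspace_iff.1 hy i hi, map_zero]

lemma IsDiagonal.hasSum_spectralProj (hD : IsDiagonal D b d) (x : H) :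
    HasSum (fun t => spectralProj D t x) x := by
  have hexpand (y : H) : HasSum (fun i => inner ℂ (b i) y • b i) y := by
    simpa [b.repr_apply_apply] using b.hasSum_repr y
  refine ((Equiv.hasSum_iff (Equiv.sigmaFiberEquiv d)).2 (hexpand x)).sigma fun t => ?_
  have hP := hexpand (spectralProj D t x)
  have hzero (i : ι) (hi : i ∉ Set.range (Subtype.val : {i // d i = t} → ι)) :
      inner ℂ (b i) (spectralProj D t x) • b i = 0 := by
    rw [hD.inner_spectralProj, if_neg fun h => hi ⟨⟨i, h⟩, rfl⟩, zero_smul]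
  rw [← Function.Injective.hasSum_iff Subtype.val_injective hzero] at hP
  refine hP.congr_fun fun i => ?_
  simp [hD.inner_spectralProj, i.2, Equiv.sigmaFiberEquiv]

lemma IsDiagonal.funcCalc (hD : IsDiagonal D b d) (f : ℝ → ℝ) :
    IsDiagonal (funcCalc D f) b fun i => f (d i) := by
  intro x w
  have hgraph : (x, w) ∈ (TwistedTriple.funcCalc D f).graph ↔
      HasSum (fun t => (f t : ℂ) • spectralProj D t x) w := by
    rw [LinearPMap.mem_graph_iff]
    constructor
    · rintro ⟨y, rfl, rfl⟩
      exact Summable.hasSum y.2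
    · intro h
      exact ⟨⟨x, h.summable⟩, rfl, h.tsum_eq⟩
  rw [hgraph]
  constructor
  · intro h i
    refine (h.mapL (innerSL ℂ (b i))).unique ?_
    refine (hasSum_ite_eq (d i) ((f (d i) : ℂ) * inner ℂ (b i) x)).congr_fun fun t => ?_
    rw [map_smul, innerSL_apply_apply, hD.inner_spectralProj, smul_eq_mul]
    by_cases h : t = d i
    · simp [h]
    · rw [if_neg (Ne.symm h), if_neg h, mul_zero]
  · intro h
    refine (hD.hasSum_spectralProj w).congr_fun fun t => eq_of_forall_inner_basis_eq b fun i => ?_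
    rw [inner_smul_right, hD.inner_spectralProj, hD.inner_spectralProj]
    split_ifs with hi
    · rw [h, ← hi]
    · rw [mul_zero]

lemma IsDiagonal.absOp (hD : IsDiagonal D b d) : IsDiagonal (absOp D) b fun i => |d i| :=
  hD.funcCalc _

lemma IsDiagonal.laplacePow (hD : IsDiagonal D b d) (s : ℝ) :
    IsDiagonal (laplacePow D s) b fun i => weight d i ^ s := by
  have h := hD.funcCalc fun t => (1 + t ^ 2) ^ (s / 2)
  have e : (fun i => weight d i ^ s) = fun i => (1 + d i ^ 2) ^ (s / 2) := by
    funext i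
    rw [weight, Real.sqrt_eq_rpow, ← Real.rpow_mul (by positivity)]
    congr 1
    ring
  rw [e]
  exact h

lemma IsDiagonal.sobolevNorm_eq (hD : IsDiagonal D b d) {s : ℝ} {ξ : smoothVectors D} {w : H}
    (hw : ∀ i, inner ℂ (b i) w = ((weight d i ^ s : ℝ) : ℂ) * inner ℂ (b i) (ξ : H)) :
    sobolevNorm D s ξ = ‖w‖ := by
  obtain ⟨h, h'⟩ := (hD.laplacePow s).exists_apply_eq hw
  rw [sobolevNorm, dif_pos h, h']

end FunctionalCalculus

section Order

variable {H : Type*} [NormedAddCommGroup H] [InnerProductSpace ℂ H] {ι : Type*}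
  {b : HilbertBasis ι ℂ H} {D : H →ₗ.[ℂ] H} {d : ι → ℝ}

/-- The matrix `m` represents the endomorphism `P` of the space of smooth vectors. -/
def HasMatrix (b : HilbertBasis ι ℂ H) {D : H →ₗ.[ℂ] H} (P : Module.End ℂ (smoothVectors D))
    (m : ι → ι → ℂ) : Prop :=
  ∀ (ξ : smoothVectors D) (i : ι),
    HasSum (fun j => m i j * inner ℂ (b j) (ξ : H)) (inner ℂ (b i) (P ξ : H))

lemma hasMatrix_restrict (T : H →L[ℂ] H)
    (hT : ∀ ξ ∈ smoothVectors D, T.toLinearMap ξ ∈ smoothVectors D) :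
    HasMatrix b (T.toLinearMap.restrict hT) (matrixOf b T) :=
  fun ξ i => hasSum_matrixOf b T ξ i

lemma HasMatrix.commutator {P S : Module.End ℂ (smoothVectors D)} {m : ι → ι → ℂ} {s : ι → ℝ}
    (hP : HasMatrix b P m)
    (hS : ∀ (ξ : smoothVectors D) i, inner ℂ (b i) (S ξ : H) = s i * inner ℂ (b i) (ξ : H)) :
    HasMatrix b (S * P - P * S) fun i j => ((s i - s j : ℝ) : ℂ) * m i j := by
  intro ξ i
  have h := ((hP ξ i).mul_left (s i : ℂ)).sub (hP (S ξ) i)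
  rw [← hS, ← inner_sub_right] at h
  refine h.congr_fun fun j => ?_
  rw [hS]
  push_cast
  ring

lemma HasMatrix.inner_apply_of_eq_sum {P : Module.End ℂ (smoothVectors D)} {m : ι → ι → ℂ}
    (hP : HasMatrix b P m) {F : Finset ι} {x : ι → ℂ} {ξ : smoothVectors D}
    (hξ : (ξ : H) = ∑ j ∈ F, x j • b j) (i : ι) :
    inner ℂ (b i) (P ξ : H) = ∑ j ∈ F, m i j * x j := by
  classical
  refine (hP ξ i).unique ?_
  have hsum : ∑ j ∈ F, m i j * x j = ∑ j ∈ F, m i j * inner ℂ (b j) (ξ : H) :=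
    Finset.sum_congr rfl fun j hj => by rw [hξ, inner_basis_sum_smul_basis, if_pos hj]
  rw [hsum]
  refine hasSum_sum_of_ne_finset_zero fun j hj => ?_
  rw [hξ, inner_basis_sum_smul_basis, if_neg hj, mul_zero]

lemma IsDiagonal.inner_diracEnd (hD : IsDiagonal D b d) (ξ : smoothVectors D) (i : ι) :
    inner ℂ (b i) (diracEnd D ξ : H) = d i * inner ℂ (b i) (ξ : H) :=
  hD.inner_apply ⟨ξ, smoothVectors_le D ξ.2⟩ i

lemma IsDiagonal.inner_laplaceEnd (hD : IsDiagonal D b d) (ξ : smoothVectors D) (i : ι) :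
    inner ℂ (b i) (laplaceEnd D ξ : H) = ((weight d i ^ 2 : ℝ) : ℂ) * inner ℂ (b i) (ξ : H) :=
  hD.laplacian.inner_apply ⟨ξ, smoothVectors_le_laplacian D ξ.2⟩ i

lemma IsDiagonal.hasMatrix_iterLaplaceComm (hD : IsDiagonal D b d)
    {P : Module.End ℂ (smoothVectors D)} {m : ι → ι → ℂ} (hP : HasMatrix b P m) (k : ℕ) :
    HasMatrix b (iterLaplaceComm D k P) fun i j =>
      (((weight d i ^ 2 - weight d j ^ 2) ^ k : ℝ) : ℂ) * m i j := by
  induction k with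
  | zero => simpa [iterLaplaceComm] using hP
  | succ k ih =>
    have h := ih.commutator (hD.inner_laplaceEnd)
    have e : iterLaplaceComm D (k + 1) P =
        laplaceEnd D * iterLaplaceComm D k P - iterLaplaceComm D k P * laplaceEnd D :=
      Function.iterate_succ_apply' _ _ _
    rw [e]
    convert h using 3 with i j
    rw [pow_succ]
    push_cast
    ring

variable [CompleteSpace H]

lemma IsDiagonal.isBoundedMatrix_of_hasOrder (hD : IsDiagonal D b d)
    {P : Module.End ℂ (smoothVectors D)} {m : ι → ι → ℂ} (hP : HasMatrix b P m) {t : ℝ}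
    (h : HasOrder D t P) (r : ℝ) :
    IsBoundedMatrix fun i j => ((weight d i ^ r * weight d j ^ (-(r + t)) : ℝ) : ℂ) * m i j := by
  classical
  obtain ⟨K, hK⟩ := h r
  refine isBoundedMatrix_of_forall_exists b (K := K) fun F x => ?_
  let ξ : smoothVectors D := ⟨∑ j ∈ F, (((weight d j ^ (-(r + t)) : ℝ) : ℂ) * x j) • b j,
    Submodule.sum_mem _ fun j _ => Submodule.smul_mem _ _ (hD.basis_mem_smoothVectors j)⟩
  have hξ : sobolevNorm D (r + t) ξ = ‖∑ j ∈ F, x j • b j‖ := by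
    refine hD.sobolevNorm_eq fun j => ?_
    rw [inner_basis_sum_smul_basis, inner_basis_sum_smul_basis, mul_ite, mul_zero, ← mul_assoc,
      mul_comm ((weight d j ^ (r + t) : ℝ) : ℂ), ofReal_weight_rpow_neg_mul, one_mul]
  obtain ⟨u, hu⟩ := hD.mem_smoothVectors_iff.1 (P ξ).2 r
  refine ⟨u, ?_, fun i => ?_⟩
  · rw [← hξ, ← hD.sobolevNorm_eq hu]
    exact hK ξ
  · rw [hu, hP.inner_apply_of_eq_sum rfl, Finset.mul_sum]
    refine Finset.sum_congr rfl fun j _ => ?_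
    push_cast
    ring

lemma IsDiagonal.hasOrder_of_isBoundedMatrix (hD : IsDiagonal D b d)
    {P : Module.End ℂ (smoothVectors D)} {m : ι → ι → ℂ} (hP : HasMatrix b P m) {t : ℝ}
    (h : ∀ r : ℝ, IsBoundedMatrix fun i j =>
      ((weight d i ^ r * weight d j ^ (-(r + t)) : ℝ) : ℂ) * m i j) : HasOrder D t P := by
  intro r
  obtain ⟨C, hC⟩ := (h r).exists_matrixOf_eq b
  refine ⟨‖C‖, fun ξ => ?_⟩
  obtain ⟨η, hη⟩ := hD.mem_smoothVectors_iff.1 ξ.2 (r + t)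
  have hCη (i : ι) :
      inner ℂ (b i) (C η) = ((weight d i ^ r : ℝ) : ℂ) * inner ℂ (b i) (P ξ : H) := by
    refine (hasSum_matrixOf b C η i).unique ?_
    refine ((hP ξ i).mul_left ((weight d i ^ r : ℝ) : ℂ)).congr_fun fun j => ?_
    rw [hC, hη]
    push_cast
    linear_combination ((weight d i ^ r : ℝ) : ℂ) * m i j * inner ℂ (b j) (ξ : H) *
      ofReal_weight_rpow_neg_mul d (r + t) j
  rw [hD.sobolevNorm_eq hCη, hD.sobolevNorm_eq hη]
  exact C.le_opNorm η

lemma IsDiagonal.hasOrder_iff (hD : IsDiagonal D b d) {P : Module.End ℂ (smoothVectors D)}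
    {m : ι → ι → ℂ} (hP : HasMatrix b P m) (t : ℝ) :
    HasOrder D t P ↔ ∀ r : ℝ, IsBoundedMatrix fun i j =>
      ((weight d i ^ r * weight d j ^ (-(r + t)) : ℝ) : ℂ) * m i j :=
  ⟨hD.isBoundedMatrix_of_hasOrder hP, hD.hasOrder_of_isBoundedMatrix hP⟩

lemma IsDiagonal.isSmoothMatrix_iff_hasOrder (hD : IsDiagonal D b d)
    {P : Module.End ℂ (smoothVectors D)} {m : ι → ι → ℂ} (hP : HasMatrix b P m) :
    IsSmoothMatrix (fun i => |d i|) m ↔ ∀ k : ℕ, HasOrder D k (iterLaplaceComm D k P) := by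
  rw [← isSmoothMatrix_weight_iff]
  simp only [fun k => hD.hasOrder_iff (hD.hasMatrix_iterLaplaceComm hP k)]
  constructor
  · intro h k r
    convert h.iterated_sq_commutator (one_le_weight d) r k using 3 with i j
    push_cast
    ring
  · intro h
    refine IsSmoothMatrix.of_iterated_sq_commutator_div_sqrt (weight_pos d) fun k => ?_
    convert h k (-(k / 2)) using 3 with i j
    have hr : ∀ i, weight d i ^ (-(k / 2 : ℝ)) = (√(weight d i) ^ k)⁻¹ := fun i => by
      rw [Real.rpow_neg (weight_pos d i).le, Real.sqrt_eq_rpow, ← Real.rpow_natCast,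
        ← Real.rpow_mul (weight_pos d i).le]
      ring_nf
    rw [hr, show -(-(k / 2 : ℝ) + k) = -(k / 2 : ℝ) by ring, hr, mul_pow]
    push_cast
    ring

lemma IsDiagonal.map_smoothVectors (hD : IsDiagonal D b d) {T : H →L[ℂ] H}
    (hT : IsSmoothMatrix (fun i => |d i|) (matrixOf b T)) :
    ∀ ξ ∈ smoothVectors D, T.toLinearMap ξ ∈ smoothVectors D := by
  intro ξ hξ
  rw [hD.mem_smoothVectors_iff] at hξ ⊢
  intro s
  have hbdd := (isSmoothMatrix_weight_iff.2 hT).schur_div_rpow (one_le_weight d) s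
  obtain ⟨C, hC⟩ := hbdd.exists_matrixOf_eq b
  obtain ⟨η, hη⟩ := hξ s
  refine ⟨C η, fun i => (hasSum_matrixOf b C η i).unique ?_⟩
  refine ((hasSum_matrixOf b T ξ i).mul_left ((weight d i ^ s : ℝ) : ℂ)).congr_fun fun j => ?_
  rw [hC, hη, Real.div_rpow (weight_pos d i).le (weight_pos d j).le]
  have : ((weight d j ^ s : ℝ) : ℂ) ≠ 0 := by
    exact_mod_cast (Real.rpow_pos_of_pos (weight_pos d j) s).ne'
  push_cast at this ⊢
  field_simp

lemma IsDiagonal.isLaplaceCompatible_iff (hD : IsDiagonal D b d) {T C : H →L[ℂ] H}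
    (hC : IsBoundedCommutator D T C) :
    IsLaplaceCompatible D T ↔ InDomInfty (TwistedTriple.absOp D) T ∧
      InDomInfty (TwistedTriple.absOp D) C := by
  rw [hD.absOp.inDomInfty_iff, hD.absOp.inDomInfty_iff]
  have hCm := hD.isBoundedCommutator_iff.1 hC
  have hQ : ∀ hT : ∀ ξ ∈ smoothVectors D, T.toLinearMap ξ ∈ smoothVectors D,
      HasMatrix b (diracEnd D * T.toLinearMap.restrict hT - T.toLinearMap.restrict hT * diracEnd D)
        (matrixOf b C) := by
    intro hT
    have h := (hasMatrix_restrict (b := b) T hT).commutator hD.inner_diracEnd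
    convert h using 1
    funext i j
    exact hCm i j
  constructor
  · rintro ⟨hT, -, -, h⟩
    exact ⟨(hD.isSmoothMatrix_iff_hasOrder (hasMatrix_restrict T hT)).2 fun k => (h k).1,
      (hD.isSmoothMatrix_iff_hasOrder (hQ hT)).2 fun k => (h k).2⟩
  · rintro ⟨h₁, h₂⟩
    have hT := hD.map_smoothVectors h₁
    have h₃ := (hD.isSmoothMatrix_iff_hasOrder (hasMatrix_restrict T hT)).1 h₁
    have h₄ := (hD.isSmoothMatrix_iff_hasOrder (hQ hT)).1 h₂
    refine ⟨hT, ?_, ?_, fun k => ⟨h₃ k, h₄ k⟩⟩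
    · simpa [iterLaplaceComm] using h₃ 0
    · simpa [iterLaplaceComm] using h₄ 0

end Order

section RegularOperators

variable {H : Type*} [NormedAddCommGroup H] [InnerProductSpace ℂ H]

namespace IsBoundedCommutator

variable {S : H →ₗ.[ℂ] H} {T T' C C' : H →L[ℂ] H}

lemma add (h : IsBoundedCommutator S T C) (h' : IsBoundedCommutator S T' C') :
    IsBoundedCommutator S (T + T') (C + C') := by
  intro x
  obtain ⟨h₁, h₂⟩ := h x
  obtain ⟨h₁', h₂'⟩ := h' x
  refine ⟨S.domain.add_mem h₁ h₁', ?_⟩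
  have e : (⟨(T + T') x, S.domain.add_mem h₁ h₁'⟩ : S.domain) = ⟨T x, h₁⟩ + ⟨T' x, h₁'⟩ := rfl
  rw [e, S.map_add, add_apply, add_apply, ← h₂, ← h₂']
  abel

lemma mul (h : IsBoundedCommutator S T C) (h' : IsBoundedCommutator S T' C') :
    IsBoundedCommutator S (T * T') (C * T' + T * C') := by
  intro x
  obtain ⟨h₁', h₂'⟩ := h' x
  obtain ⟨h₁, h₂⟩ := h ⟨T' x, h₁'⟩
  refine ⟨h₁, ?_⟩
  have h₂ : S ⟨T (T' x), h₁⟩ - T (S ⟨T' x, h₁'⟩) = C (T' x) := h₂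
  change S ⟨T (T' x), h₁⟩ - T (T' (S x)) = C (T' x) + T (C' x)
  rw [← h₂, ← h₂', map_sub]
  abel

lemma zero (S : H →ₗ.[ℂ] H) : IsBoundedCommutator S 0 0 := fun x =>
  ⟨S.domain.zero_mem, by
    have : S ⟨(0 : H →L[ℂ] H) x, S.domain.zero_mem⟩ = 0 := S.map_zero
    rw [this]
    simp⟩

end IsBoundedCommutator

variable {S : H →ₗ.[ℂ] H} {T T' : H →L[ℂ] H} {k : ℕ}

lemma InDomDerivation.of_succ (h : InDomDerivation S (k + 1) T) : InDomDerivation S k T := by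
  induction k generalizing T with
  | zero => trivial
  | succ k ih =>
    obtain ⟨C, hC, hC'⟩ := h
    exact ⟨C, hC, ih hC'⟩

lemma InDomDerivation.add (h : InDomDerivation S k T) (h' : InDomDerivation S k T') :
    InDomDerivation S k (T + T') := by
  induction k generalizing T T' with
  | zero => trivial
  | succ k ih =>
    obtain ⟨C, hC, hk⟩ := h
    obtain ⟨C', hC', hk'⟩ := h'
    exact ⟨C + C', hC.add hC', ih hk hk'⟩

lemma InDomDerivation.mul (h : InDomDerivation S k T) (h' : InDomDerivation S k T') :
    InDomDerivation S k (T * T') := by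
  induction k generalizing T T' with
  | zero => trivial
  | succ k ih =>
    have h₀ := h.of_succ
    have h₀' := h'.of_succ
    obtain ⟨C, hC, hk⟩ := h
    obtain ⟨C', hC', hk'⟩ := h'
    exact ⟨C * T' + T * C', hC.mul hC', (ih hk h₀').add (ih h₀ hk')⟩

lemma InDomDerivation.zero : InDomDerivation S k 0 := by
  induction k with
  | zero => trivial
  | succ k ih => exact ⟨0, .zero S, ih⟩

variable [CompleteSpace H]

/-- `T` and `[D, T]` are smooth for the derivation `[|D|, ·]`: the condition that a regular spectral
triple imposes on each element of its algebra. -/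
def IsRegularOp (D : H →ₗ.[ℂ] H) (T : H →L[ℂ] H) : Prop :=
  InDomInfty (absOp D) T ∧ ∃ C : H →L[ℂ] H, IsBoundedCommutator D T C ∧ InDomInfty (absOp D) C

namespace IsRegularOp

variable {D : H →ₗ.[ℂ] H}

lemma zero : IsRegularOp D 0 :=
  ⟨fun _ => .zero, 0, .zero D, fun _ => .zero⟩

lemma add (h : IsRegularOp D T) (h' : IsRegularOp D T') : IsRegularOp D (T + T') := by
  obtain ⟨h, C, hC, hk⟩ := h
  obtain ⟨h', C', hC', hk'⟩ := h'
  exact ⟨fun k => (h k).add (h' k), C + C', hC.add hC', fun k => (hk k).add (hk' k)⟩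

lemma mul (h : IsRegularOp D T) (h' : IsRegularOp D T') : IsRegularOp D (T * T') := by
  obtain ⟨h, C, hC, hk⟩ := h
  obtain ⟨h', C', hC', hk'⟩ := h'
  exact ⟨fun k => (h k).mul (h' k), C * T' + T * C', hC.mul hC',
    fun k => ((hk k).mul (h' k)).add ((h k).mul (hk' k))⟩

lemma sum {κ : Type*} {s : Finset κ} {T : κ → H →L[ℂ] H} (h : ∀ i ∈ s, IsRegularOp D (T i)) :
    IsRegularOp D (∑ i ∈ s, T i) :=
  Finset.sum_induction T (IsRegularOp D) (fun _ _ => add) zero h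

lemma iff_isLaplaceCompatible (hD : IsSelfAdjoint D) (hc : HasCompactResolvent D)
    (hT : ∃ C, IsBoundedCommutator D T C) : IsRegularOp D T ↔ IsLaplaceCompatible D T := by
  obtain ⟨ι, b, d, hd⟩ := exists_isDiagonal hD hc
  constructor
  · rintro ⟨h, C, hC, h'⟩
    exact (hd.isLaplaceCompatible_iff hC).2 ⟨h, h'⟩
  · obtain ⟨C, hC⟩ := hT
    intro h
    obtain ⟨h₁, h₂⟩ := (hd.isLaplaceCompatible_iff hC).1 h
    exact ⟨h₁, C, hC, h₂⟩

end IsRegularOp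

end RegularOperators

section Tensor

variable {H K : Type*} [NormedAddCommGroup H] [InnerProductSpace ℂ H]
  [NormedAddCommGroup K] [InnerProductSpace ℂ K]

variable (H K) in
/-- The simple tensor `x ⊗ y` of the Hilbert space tensor product, as a continuous bilinear map. -/
def htmulL : H →L[ℂ] K →L[ℂ] HilbertTensor H K :=
  (ContinuousLinearMap.compL ℂ K (H ⊗[ℂ] K) (UniformSpace.Completion (H ⊗[ℂ] K))
    UniformSpace.Completion.toComplL).comp (TensorProduct.mkL ℂ H K)

lemma htmulL_apply (x : H) (y : K) : htmulL H K x y = htmul x y := rfl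

lemma inner_htmul (x x' : H) (y y' : K) :
    inner ℂ (htmul x y) (htmul x' y') = inner ℂ x x' * inner ℂ y y' :=
  (UniformSpace.Completion.inner_coe (𝕜 := ℂ) (x ⊗ₜ[ℂ] y) (x' ⊗ₜ[ℂ] y')).trans
    (by simp)

lemma htmul_add_left (x x' : H) (y : K) : htmul (x + x') y = htmul x y + htmul x' y := by
  simp only [← htmulL_apply, map_add, add_apply]

lemma htmul_add_right (x : H) (y y' : K) : htmul x (y + y') = htmul x y + htmul x y' := by
  simp only [← htmulL_apply, map_add]

lemma htmul_smul_left (c : ℂ) (x : H) (y : K) : htmul (c • x) y = c • htmul x y := by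
  simp only [← htmulL_apply, map_smul, smul_apply]

lemma htmul_smul_right (c : ℂ) (x : H) (y : K) : htmul x (c • y) = c • htmul x y := by
  simp only [← htmulL_apply, map_smul]

lemma dense_span_htmul :
    Dense (Submodule.span ℂ {z : HilbertTensor H K | ∃ x y, z = htmul x y} :
      Set (HilbertTensor H K)) := by
  have hr : DenseRange ((↑) : H ⊗[ℂ] K → UniformSpace.Completion (H ⊗[ℂ] K)) :=
    UniformSpace.Completion.denseRange_coe
  refine Dense.mono ?_ hr
  rintro _ ⟨t, rfl⟩
  induction t using TensorProduct.induction_on with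
  | zero => exact (UniformSpace.Completion.coe_zero (α := H ⊗[ℂ] K)) ▸ Submodule.zero_mem _
  | tmul x y => exact Submodule.subset_span ⟨x, y, rfl⟩
  | add s t hs ht =>
    rw [UniformSpace.Completion.coe_add]
    exact Submodule.add_mem _ hs ht

lemma ext_htmul {F : Type*} [NormedAddCommGroup F] [NormedSpace ℂ F]
    {S T : HilbertTensor H K →L[ℂ] F} (h : ∀ x y, S (htmul x y) = T (htmul x y)) : S = T := by
  refine ContinuousLinearMap.ext_on (dense_span_htmul (H := H) (K := K)) ?_
  rintro _ ⟨x, y, rfl⟩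
  exact h x y

variable {ι κ : Type*}

lemma eq_zero_of_forall_inner_htmul_basis_eq_zero (b : HilbertBasis ι ℂ H)
    (c : HilbertBasis κ ℂ K) {z : HilbertTensor H K}
    (hz : ∀ i j, inner ℂ (htmul (b i) (c j)) z = 0) : z = 0 := by
  have inner_htmul_basis (x : H) (j : κ) : inner ℂ z (htmul x (c j)) = 0 := by
    refine (((b.hasSum_repr x).mapL ((htmulL H K).flip (c j))).mapL (innerSL ℂ z)).unique
      (hasSum_zero.congr_fun fun i => ?_)
    rw [map_smul, map_smul, ContinuousLinearMap.flip_apply, htmulL_apply, innerSL_apply_apply,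
      ← inner_conj_symm, hz, map_zero, smul_zero]
  have inner_htmul_eq_zero (x : H) (y : K) : inner ℂ z (htmul x y) = 0 := by
    refine (((c.hasSum_repr y).mapL (htmulL H K x)).mapL (innerSL ℂ z)).unique
      (hasSum_zero.congr_fun fun j => ?_)
    rw [map_smul, map_smul, htmulL_apply, innerSL_apply_apply, inner_htmul_basis, smul_zero]
  have inner_eq_zero : innerSL ℂ z = 0 := ext_htmul fun x y => by
    rw [innerSL_apply_apply, inner_htmul_eq_zero, zero_apply]
  exact inner_self_eq_zero.1 (by rw [← innerSL_apply_apply, inner_eq_zero, zero_apply] :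
    inner ℂ z z = (0 : ℂ))

lemma orthonormal_htmul (b : HilbertBasis ι ℂ H) (c : HilbertBasis κ ℂ K) :
    Orthonormal ℂ fun p : ι × κ => htmul (b p.1) (c p.2) := by
  classical
  rw [orthonormal_iff_ite]
  rintro ⟨i, j⟩ ⟨i', j'⟩
  rw [inner_htmul, inner_basis_basis, inner_basis_basis]
  simp only [Prod.mk.injEq]
  split_ifs <;> simp_all

/-- The product basis of the Hilbert space tensor product. -/
def tensorBasis (b : HilbertBasis ι ℂ H) (c : HilbertBasis κ ℂ K) :
    HilbertBasis (ι × κ) ℂ (HilbertTensor H K) :=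
  HilbertBasis.mkOfOrthogonalEqBot (orthonormal_htmul b c) <| by
    rw [Submodule.eq_bot_iff]
    intro z hz
    rw [Submodule.mem_orthogonal] at hz
    exact eq_zero_of_forall_inner_htmul_basis_eq_zero b c fun i j =>
      hz _ (Submodule.subset_span ⟨(i, j), rfl⟩)

lemma tensorBasis_apply (b : HilbertBasis ι ℂ H) (c : HilbertBasis κ ℂ K) (p : ι × κ) :
    tensorBasis b c p = htmul (b p.1) (c p.2) := by
  rw [tensorBasis, HilbertBasis.coe_mkOfOrthogonalEqBot]

lemma inner_tensorBasis_htmul (b : HilbertBasis ι ℂ H) (c : HilbertBasis κ ℂ K) (p : ι × κ)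
    (x : H) (y : K) :
    inner ℂ (tensorBasis b c p) (htmul x y) = inner ℂ (b p.1) x * inner ℂ (c p.2) y := by
  rw [tensorBasis_apply, inner_htmul]

lemma matrixOf_tensorOp (b : HilbertBasis ι ℂ H) (c : HilbertBasis κ ℂ K) (S : H →L[ℂ] H)
    (T : K →L[ℂ] K) (p q : ι × κ) :
    matrixOf (tensorBasis b c) (tensorOp S T) p q =
      matrixOf b S p.1 q.1 * matrixOf c T p.2 q.2 := by
  rw [matrixOf, tensorBasis_apply b c q, tensorOp_htmul, inner_tensorBasis_htmul, matrixOf,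
    matrixOf]

end Tensor

section Kronecker

open scoped lp

variable {ι κ : Type*} {m : ι → ι → ℂ} {n : κ → κ → ℂ}

lemma IsBoundedMatrix.kronecker (hm : IsBoundedMatrix m) (hn : IsBoundedMatrix n) :
    IsBoundedMatrix fun p q : ι × κ => m p.1 q.1 * n p.2 q.2 := by
  let b : HilbertBasis ι ℂ ℓ²(ι, ℂ) := ⟨.refl ℂ _⟩
  let c : HilbertBasis κ ℂ ℓ²(κ, ℂ) := ⟨.refl ℂ _⟩
  obtain ⟨S, hS⟩ := hm.exists_matrixOf_eq b
  obtain ⟨T, hT⟩ := hn.exists_matrixOf_eq c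
  convert isBoundedMatrix_matrixOf (tensorBasis b c) (tensorOp S T) using 3 with p q
  rw [matrixOf_tensorOp, hS, hT]

lemma sqrt_pow_mul_sqrt_pow_div_le_one {x y z : ℝ} (hz : 0 < z) (hxz : x ≤ z)
    (hyz : y ≤ z) {k l : ℕ} (hlk : l ≤ k) : √x ^ l * √y ^ (k - l) / √z ^ k ≤ 1 := by
  rw [div_le_one (pow_pos (Real.sqrt_pos.2 hz) k)]
  calc √x ^ l * √y ^ (k - l) ≤ √z ^ l * √z ^ (k - l) := by gcongr
    _ = √z ^ k := by rw [← pow_add, Nat.add_sub_cancel' hlk]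

lemma add_pow_div_eq_sum {α β u u' v v' w w' : ℝ} (hu : 0 < u) (hu' : 0 < u') (hv : 0 < v)
    (hv' : 0 < v') (k : ℕ) :
    (α + β) ^ k / (w * w') ^ k = ∑ l ∈ Finset.range (k + 1), k.choose l *
      (u ^ l * v ^ (k - l) / w ^ k * (α ^ l / (u * u') ^ l * (β ^ (k - l) / (v * v') ^ (k - l))) *
        (u' ^ l * v' ^ (k - l) / w' ^ k)) := by
  rw [add_pow, Finset.sum_div]
  refine Finset.sum_congr rfl fun l _ => ?_
  simp only [mul_pow]
  field_simp

/- Under tensor products the squares of the weights add up, whereas the weights themselves do not: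
iterated commutators with the squares therefore expand binomially. -/
lemma IsSmoothMatrix.kronecker_of_one_le {u : ι → ℝ} {v : κ → ℝ} (hu : ∀ i, 1 ≤ u i)
    (hv : ∀ j, 1 ≤ v j) (hm : IsSmoothMatrix u m) (hn : IsSmoothMatrix v n) :
    IsSmoothMatrix (fun p : ι × κ => √(u p.1 ^ 2 + v p.2 ^ 2))
      fun p q => m p.1 q.1 * n p.2 q.2 := by
  have hu0 (i : ι) : 0 < u i := one_pos.trans_le (hu i)
  have hv0 (j : κ) : 0 < v j := one_pos.trans_le (hv j)
  set w : ι × κ → ℝ := fun p => √(u p.1 ^ 2 + v p.2 ^ 2)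
  have hw0 (p : ι × κ) : 0 < w p := Real.sqrt_pos.2 (by have := hu0 p.1; positivity)
  have hw_sq (p : ι × κ) : w p ^ 2 = u p.1 ^ 2 + v p.2 ^ 2 := Real.sq_sqrt (by positivity)
  have hw_sub (p q : ι × κ) :
      w p ^ 2 - w q ^ 2 = (u p.1 ^ 2 - u q.1 ^ 2) + (v p.2 ^ 2 - v q.2 ^ 2) := by
    rw [hw_sq, hw_sq]
    ring
  refine IsSmoothMatrix.of_iterated_sq_commutator_div_sqrt hw0 fun k => ?_
  let g (l : ℕ) (p : ι × κ) : ℝ := √(u p.1) ^ l * √(v p.2) ^ (k - l) / √(w p) ^ k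
  have hg (l : ℕ) (hl : l ∈ Finset.range (k + 1)) (p : ι × κ) : ‖(g l p : ℂ)‖ ≤ 1 := by
    rw [Complex.norm_real, Real.norm_of_nonneg (by positivity)]
    exact sqrt_pow_mul_sqrt_pow_div_le_one (hw0 p)
      (Real.le_sqrt_of_sq_le (le_add_of_nonneg_right (sq_nonneg _)))
      (Real.le_sqrt_of_sq_le (le_add_of_nonneg_left (sq_nonneg _)))
      (Finset.mem_range_succ_iff.1 hl)
  convert IsBoundedMatrix.sum (Finset.range (k + 1)) fun l hl =>
    (((hm.iterated_sq_commutator_div_sqrt hu l).kronecker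
      (hn.iterated_sq_commutator_div_sqrt hv (k - l))).diag_mul_mul_diag
        (hg l hl) (hg l hl)).const_mul (k.choose l) using 3 with p q
  rw [hw_sub, add_pow_div_eq_sum (Real.sqrt_pos.2 (hu0 p.1)) (Real.sqrt_pos.2 (hu0 q.1))
    (Real.sqrt_pos.2 (hv0 p.2)) (Real.sqrt_pos.2 (hv0 q.2)), Complex.ofReal_sum, Finset.sum_mul]
  refine Finset.sum_congr rfl fun l _ => ?_
  push_cast [g]
  ring

lemma IsSmoothMatrix.kronecker {d : ι → ℝ} {e : κ → ℝ} (hm : IsSmoothMatrix (fun i => |d i|) m)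
    (hn : IsSmoothMatrix (fun j => |e j|) n) :
    IsSmoothMatrix (fun p : ι × κ => √(d p.1 ^ 2 + e p.2 ^ 2))
      fun p q => m p.1 q.1 * n p.2 q.2 := by
  rw [← isSmoothMatrix_weight_iff] at hm hn
  refine (IsSmoothMatrix.kronecker_of_one_le (one_le_weight d) (one_le_weight e) hm
    hn).of_abs_sub_le (c := 2) fun p => ?_
  simp only [weight_sq]
  have h₁ := Real.sq_sqrt (by positivity : 0 ≤ d p.1 ^ 2 + e p.2 ^ 2)
  have h₂ := Real.sq_sqrt (by positivity : 0 ≤ 1 + d p.1 ^ 2 + (1 + e p.2 ^ 2))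
  have h₃ := Real.sqrt_nonneg (d p.1 ^ 2 + e p.2 ^ 2)
  have h₄ := Real.sqrt_nonneg (1 + d p.1 ^ 2 + (1 + e p.2 ^ 2))
  rw [abs_le]
  constructor <;> nlinarith

end Kronecker

section Double

open ComplexConjugate

variable {E : Type*} [NormedAddCommGroup E] [InnerProductSpace ℂ E] {κ : Type*}

/-- The operator matrix with rows `(0, X)` and `(Y, 0)`. -/
def offDiagOp (X Y : E →L[ℂ] E) : Double E →L[ℂ] Double E :=
  ((WithLp.prodContinuousLinearEquiv 2 ℂ E E).symm : E × E →L[ℂ] Double E) ∘L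
    ((X ∘L ContinuousLinearMap.snd ℂ E E).prod (Y ∘L ContinuousLinearMap.fst ℂ E E)) ∘L
    (WithLp.prodContinuousLinearEquiv 2 ℂ E E : Double E →L[ℂ] E × E)

lemma offDiagOp_apply (X Y : E →L[ℂ] E) (z : Double E) :
    offDiagOp X Y z = WithLp.toLp 2 (X z.snd, Y z.fst) := rfl

lemma doubleOp_apply (T : E →L[ℂ] E) (z : Double E) :
    doubleOp T z = WithLp.toLp 2 (T z.fst, T z.snd) := rfl

lemma inner_eq_inner_fst_add_inner_snd (z w : Double E) :
    inner ℂ z w = inner ℂ z.fst w.fst + inner ℂ z.snd w.snd := WithLp.prod_inner_apply z w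

lemma eq_of_fst_eq_of_snd_eq {E : Type*} {z w : Double E} (h₁ : z.fst = w.fst)
    (h₂ : z.snd = w.snd) : z = w :=
  WithLp.ofLp_injective 2 (Prod.ext h₁ h₂)

/-- The vectors `(f_k, 0)` and `(0, f_k)` of `E ⊕ E`, indexed by `(k, false)` and `(k, true)`. -/
def doubleVec (f : HilbertBasis κ ℂ E) (p : κ × Bool) : Double E :=
  if p.2 then WithLp.toLp 2 (0, f p.1) else WithLp.toLp 2 (f p.1, 0)

lemma orthonormal_doubleVec (f : HilbertBasis κ ℂ E) : Orthonormal ℂ (doubleVec f) := by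
  classical
  rw [orthonormal_iff_ite]
  rintro ⟨k, ε⟩ ⟨l, ε'⟩
  rw [inner_eq_inner_fst_add_inner_snd]
  cases ε <;> cases ε' <;> simp [doubleVec, inner_basis_basis]

/-- The graph of the maximal operator matrix on `E ⊕ E` with rows `(0, z̄)` and `(z, 0)`, where `z`
stands for the operator that is diagonal with entries `z_k` in the basis `f`. -/
def offDiagonalGraph (f : HilbertBasis κ ℂ E) (z : κ → ℂ) : Submodule ℂ (Double E × Double E) where
  carrier := {p | ∀ k, inner ℂ (f k) p.2.fst = conj (z k) * inner ℂ (f k) p.1.snd ∧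
    inner ℂ (f k) p.2.snd = z k * inner ℂ (f k) p.1.fst}
  zero_mem' := by simp
  add_mem' {p q} hp hq k := by simp [hp k, hq k, mul_add]
  smul_mem' r p hp k := by simp [hp k, mul_left_comm]

lemma mem_offDiagonalGraph {f : HilbertBasis κ ℂ E} {z : κ → ℂ} {p : Double E × Double E} :
    p ∈ offDiagonalGraph f z ↔ ∀ k,
      inner ℂ (f k) p.2.fst = conj (z k) * inner ℂ (f k) p.1.snd ∧
        inner ℂ (f k) p.2.snd = z k * inner ℂ (f k) p.1.fst :=
  Iff.rfl

lemma isClosed_offDiagonalGraph (f : HilbertBasis κ ℂ E) (z : κ → ℂ) :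
    IsClosed (offDiagonalGraph f z : Set (Double E × Double E)) := by
  have h : (offDiagonalGraph f z : Set (Double E × Double E)) =
      ⋂ k, {p | inner ℂ (f k) p.2.fst = conj (z k) * inner ℂ (f k) p.1.snd} ∩
        {p | inner ℂ (f k) p.2.snd = z k * inner ℂ (f k) p.1.fst} := by
    ext p
    simp [mem_offDiagonalGraph]
  rw [h]
  exact isClosed_iInter fun k =>
    (isClosed_eq (by fun_prop) (by fun_prop)).inter (isClosed_eq (by fun_prop) (by fun_prop))

lemma eq_zero_of_zero_mem_offDiagonalGraph {f : HilbertBasis κ ℂ E} {z : κ → ℂ} {η : Double E}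
    (h : (0, η) ∈ offDiagonalGraph f z) : η = 0 :=
  eq_of_fst_eq_of_snd_eq
    (eq_of_forall_inner_basis_eq f fun k => by simpa using (mem_offDiagonalGraph.1 h k).1)
    (eq_of_forall_inner_basis_eq f fun k => by simpa using (mem_offDiagonalGraph.1 h k).2)

lemma conj_coe_circle_mul_self (u : Circle) : conj (u : ℂ) * u = 1 := by
  rw [Complex.conj_mul', Circle.norm_coe]
  simp

/-- The vectors `2^{-1/2} (f_k, ± u_k f_k)` of `E ⊕ E`: eigenvectors of the off-diagonal operator
matrix with rows `(0, z̄)` and `(z, 0)` when `u` is the phase of `z`. -/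
def phaseVec (f : HilbertBasis κ ℂ E) (u : κ → Circle) (p : κ × Bool) : Double E :=
  (((√2)⁻¹ : ℝ) : ℂ) • WithLp.toLp 2 (f p.1, (if p.2 then -(u p.1 : ℂ) else u p.1) • f p.1)

lemma inner_phaseVec (f : HilbertBasis κ ℂ E) (u : κ → Circle) (p : κ × Bool) (z : Double E) :
    inner ℂ (phaseVec f u p) z = (((√2)⁻¹ : ℝ) : ℂ) * (inner ℂ (f p.1) z.fst +
      (if p.2 then -conj (u p.1 : ℂ) else conj (u p.1 : ℂ)) * inner ℂ (f p.1) z.snd) := by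
  rw [phaseVec, inner_smul_left, Complex.conj_ofReal, inner_eq_inner_fst_add_inner_snd]
  simp only [WithLp.toLp_fst, WithLp.toLp_snd, inner_smul_left]
  congr 3
  split_ifs <;> simp

lemma orthonormal_phaseVec (f : HilbertBasis κ ℂ E) (u : κ → Circle) :
    Orthonormal ℂ (phaseVec f u) := by
  classical
  rw [orthonormal_iff_ite]
  rintro ⟨k, ε⟩ ⟨l, ε'⟩
  have h2 : (((√2)⁻¹ : ℝ) : ℂ) * (((√2)⁻¹ : ℝ) : ℂ) = 1 / 2 := by
    rw [← Complex.ofReal_mul, ← mul_inv, Real.mul_self_sqrt (by norm_num)]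
    norm_num
  have hfst : (phaseVec f u (l, ε')).fst = (((√2)⁻¹ : ℝ) : ℂ) • f l := rfl
  have hsnd : (phaseVec f u (l, ε')).snd =
      (((√2)⁻¹ : ℝ) : ℂ) • (if ε' then -(u l : ℂ) else u l) • f l := rfl
  rw [inner_phaseVec, hfst, hsnd]
  simp only [inner_smul_right, inner_basis_basis, Prod.mk.injEq]
  by_cases hkl : k = l
  · subst hkl
    have hu := conj_coe_circle_mul_self (u k)
    set v : ℂ := (u k : ℂ)
    cases ε <;> cases ε' <;> simp only [if_true, if_false, true_and, mul_one, Bool.false_eq_true,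
      reduceCtorEq]
    · linear_combination (1 + conj v * v) * h2 + 1 / 2 * hu
    · linear_combination (1 - conj v * v) * h2 - 1 / 2 * hu
    · linear_combination (1 - conj v * v) * h2 - 1 / 2 * hu
    · linear_combination (1 + conj v * v) * h2 + 1 / 2 * hu
  · simp [hkl]

lemma forall_inner_phaseVec_eq_iff (f : HilbertBasis κ ℂ E) (u : κ → Circle) (s : κ × Bool → ℂ)
    (ξ η : Double E) :
    (∀ p, inner ℂ (phaseVec f u p) η = s p * inner ℂ (phaseVec f u p) ξ) ↔
      ∀ k, inner ℂ (f k) η.fst + conj (u k : ℂ) * inner ℂ (f k) η.snd =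
          s (k, false) * (inner ℂ (f k) ξ.fst + conj (u k : ℂ) * inner ℂ (f k) ξ.snd) ∧
        inner ℂ (f k) η.fst - conj (u k : ℂ) * inner ℂ (f k) η.snd =
          s (k, true) * (inner ℂ (f k) ξ.fst - conj (u k : ℂ) * inner ℂ (f k) ξ.snd) := by
  have h0 : (((√2)⁻¹ : ℝ) : ℂ) ≠ 0 := by
    exact_mod_cast (inv_pos.2 (Real.sqrt_pos.2 two_pos)).ne'
  simp only [Prod.forall, Bool.forall_bool, inner_phaseVec, mul_left_comm (s _),
    mul_right_inj' h0, if_true, if_false, Bool.false_eq_true, neg_mul, ← sub_eq_add_neg]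

lemma eq_zero_of_forall_inner_phaseVec_eq_zero (f : HilbertBasis κ ℂ E) (u : κ → Circle)
    {z : Double E} (hz : ∀ p, inner ℂ (phaseVec f u p) z = 0) : z = 0 := by
  have h := (forall_inner_phaseVec_eq_iff f u 0 0 z).1 fun p => by simp [hz]
  simp only [Pi.zero_apply, zero_mul] at h
  refine eq_of_fst_eq_of_snd_eq (eq_of_forall_inner_basis_eq f fun k => ?_)
    (eq_of_forall_inner_basis_eq f fun k => ?_)
  · obtain ⟨h₁, h₂⟩ := h k
    simp only [WithLp.zero_fst, inner_zero_right]
    linear_combination (h₁ + h₂) / 2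
  · obtain ⟨h₁, h₂⟩ := h k
    simp only [WithLp.zero_snd, inner_zero_right]
    linear_combination (u k : ℂ) * (h₁ - h₂) / 2 -
      inner ℂ (f k) z.snd * conj_coe_circle_mul_self (u k)

variable [CompleteSpace E]

/-- The basis of `E ⊕ E` consisting of the vectors `(f_k, 0)` and `(0, f_k)`. -/
def doubleBasis (f : HilbertBasis κ ℂ E) : HilbertBasis (κ × Bool) ℂ (Double E) :=
  HilbertBasis.mkOfOrthogonalEqBot (orthonormal_doubleVec f) <| by
    rw [Submodule.eq_bot_iff]
    intro z hz
    rw [Submodule.mem_orthogonal] at hz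
    refine eq_of_fst_eq_of_snd_eq (eq_of_forall_inner_basis_eq f fun k => ?_)
      (eq_of_forall_inner_basis_eq f fun k => ?_)
    · have := hz _ (Submodule.subset_span ⟨(k, false), rfl⟩)
      simpa [inner_eq_inner_fst_add_inner_snd, doubleVec] using this
    · have := hz _ (Submodule.subset_span ⟨(k, true), rfl⟩)
      simpa [inner_eq_inner_fst_add_inner_snd, doubleVec] using this

lemma doubleBasis_apply (f : HilbertBasis κ ℂ E) (p : κ × Bool) :
    doubleBasis f p = doubleVec f p := by
  rw [doubleBasis, HilbertBasis.coe_mkOfOrthogonalEqBot]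

lemma inner_doubleBasis (f : HilbertBasis κ ℂ E) (p : κ × Bool) (z : Double E) :
    inner ℂ (doubleBasis f p) z = inner ℂ (f p.1) (if p.2 then z.snd else z.fst) := by
  obtain ⟨k, ε⟩ := p
  rw [doubleBasis_apply, inner_eq_inner_fst_add_inner_snd]
  cases ε <;> simp [doubleVec]

lemma matrixOf_doubleOp (f : HilbertBasis κ ℂ E) (T : E →L[ℂ] E) (p q : κ × Bool) :
    matrixOf (doubleBasis f) (doubleOp T) p q = if p.2 = q.2 then matrixOf f T p.1 q.1 else 0 := by
  obtain ⟨k, ε⟩ := p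
  obtain ⟨l, ε'⟩ := q
  rw [matrixOf, inner_doubleBasis, doubleBasis_apply, doubleOp_apply]
  cases ε <;> cases ε' <;> simp [doubleVec, matrixOf]

lemma matrixOf_offDiagOp (f : HilbertBasis κ ℂ E) (X Y : E →L[ℂ] E) (p q : κ × Bool) :
    matrixOf (doubleBasis f) (offDiagOp X Y) p q =
      if p.2 = q.2 then 0 else if p.2 then matrixOf f Y p.1 q.1 else matrixOf f X p.1 q.1 := by
  obtain ⟨k, ε⟩ := p
  obtain ⟨l, ε'⟩ := q
  rw [matrixOf, inner_doubleBasis, doubleBasis_apply, offDiagOp_apply]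
  cases ε <;> cases ε' <;> simp [doubleVec, matrixOf]

lemma isSmoothMatrix_doubleOp {f : HilbertBasis κ ℂ E} {r : κ → ℝ} {T : E →L[ℂ] E}
    (h : IsSmoothMatrix r (matrixOf f T)) :
    IsSmoothMatrix (fun p : κ × Bool => r p.1) (matrixOf (doubleBasis f) (doubleOp T)) := by
  intro k
  obtain ⟨C, hC⟩ := (h k).exists_matrixOf_eq f
  convert isBoundedMatrix_matrixOf (doubleBasis f) (doubleOp C) using 3 with p q
  rw [matrixOf_doubleOp, matrixOf_doubleOp, hC, mul_ite, mul_zero]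

lemma isSmoothMatrix_offDiagOp {f : HilbertBasis κ ℂ E} {r : κ → ℝ} {X Y : E →L[ℂ] E}
    (hX : IsSmoothMatrix r (matrixOf f X)) (hY : IsSmoothMatrix r (matrixOf f Y)) :
    IsSmoothMatrix (fun p : κ × Bool => r p.1) (matrixOf (doubleBasis f) (offDiagOp X Y)) := by
  intro k
  obtain ⟨C, hC⟩ := (hX k).exists_matrixOf_eq f
  obtain ⟨C', hC'⟩ := (hY k).exists_matrixOf_eq f
  convert isBoundedMatrix_matrixOf (doubleBasis f) (offDiagOp C C') using 3 with p q
  rw [matrixOf_offDiagOp, matrixOf_offDiagOp, hC, hC', mul_ite, mul_ite, mul_zero]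

/-- The basis of `E ⊕ E` consisting of the vectors `2^{-1/2} (f_k, ± u_k f_k)`. -/
def phaseBasis (f : HilbertBasis κ ℂ E) (u : κ → Circle) :
    HilbertBasis (κ × Bool) ℂ (Double E) :=
  HilbertBasis.mkOfOrthogonalEqBot (orthonormal_phaseVec f u) <| by
    rw [Submodule.eq_bot_iff]
    intro z hz
    rw [Submodule.mem_orthogonal] at hz
    exact eq_zero_of_forall_inner_phaseVec_eq_zero f u fun p =>
      hz _ (Submodule.subset_span ⟨p, rfl⟩)

lemma phaseBasis_apply (f : HilbertBasis κ ℂ E) (u : κ → Circle) (p : κ × Bool) :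
    phaseBasis f u p = phaseVec f u p := by
  rw [phaseBasis, HilbertBasis.coe_mkOfOrthogonalEqBot]

lemma exists_eq_norm_mul_circle (z : κ → ℂ) : ∃ u : κ → Circle, ∀ k, z k = (‖z k‖ : ℂ) * u k :=
  ⟨fun k => Circle.exp (z k).arg, fun k => by
    rw [Circle.coe_exp, Complex.norm_mul_exp_arg_mul_I]⟩

variable {S : Double E →ₗ.[ℂ] Double E} {f : HilbertBasis κ ℂ E} {z : κ → ℂ}

lemma isDiagonal_phaseBasis_of_graph_eq (hS : S.graph = offDiagonalGraph f z) {u : κ → Circle}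
    (hz : ∀ k, z k = (‖z k‖ : ℂ) * u k) :
    IsDiagonal S (phaseBasis f u) fun p => if p.2 then -‖z p.1‖ else ‖z p.1‖ := by
  intro ξ η
  simp only [hS, mem_offDiagonalGraph, phaseBasis_apply]
  rw [forall_inner_phaseVec_eq_iff f u
    (fun p => ((if p.2 then -‖z p.1‖ else ‖z p.1‖ : ℝ) : ℂ))]
  simp only [if_true, if_false, Bool.false_eq_true, Complex.ofReal_neg]
  refine forall_congr' fun k => ?_
  have hu := conj_coe_circle_mul_self (u k)
  have hzk := hz k
  have hconj : conj (z k) = (‖z k‖ : ℂ) * conj (u k : ℂ) := by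
    conv_lhs => rw [hz k]
    rw [map_mul, Complex.conj_ofReal]
  set v : ℂ := (u k : ℂ)
  constructor
  · rintro ⟨h₁, h₂⟩
    rw [h₁, h₂, hconj]
    constructor
    · linear_combination inner ℂ (f k) ξ.fst * (conj v * hzk + (‖z k‖ : ℂ) * hu)
    · linear_combination -inner ℂ (f k) ξ.fst * (conj v * hzk + (‖z k‖ : ℂ) * hu)
  · rintro ⟨h₁, h₂⟩
    constructor
    · linear_combination (h₁ + h₂) / 2 - inner ℂ (f k) ξ.snd * hconj
    · linear_combination v * (h₁ - h₂) / 2 - inner ℂ (f k) η.snd * hu - inner ℂ (f k) ξ.fst * hzk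

lemma isDiagonal_absOp_of_graph_eq (hS : S.graph = offDiagonalGraph f z) :
    IsDiagonal (absOp S) (doubleBasis f) fun p => ‖z p.1‖ := by
  obtain ⟨u, hz⟩ := exists_eq_norm_mul_circle z
  intro ξ η
  have habs (p : κ × Bool) : |if p.2 then -‖z p.1‖ else ‖z p.1‖| = ‖z p.1‖ := by
    split_ifs <;> simp
  simp only [(isDiagonal_phaseBasis_of_graph_eq hS hz).absOp ξ η, phaseBasis_apply, habs]
  rw [forall_inner_phaseVec_eq_iff f u (fun p => (‖z p.1‖ : ℂ))]
  simp only [inner_doubleBasis, Prod.forall, Bool.forall_bool, if_true, if_false,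
    Bool.false_eq_true]
  refine forall_congr' fun k => ?_
  have hu := conj_coe_circle_mul_self (u k)
  set v : ℂ := (u k : ℂ)
  constructor
  · rintro ⟨h₁, h₂⟩
    constructor
    · linear_combination (h₁ + h₂) / 2
    · linear_combination v * (h₁ - h₂) / 2 -
        (inner ℂ (f k) η.snd - (‖z k‖ : ℂ) * inner ℂ (f k) ξ.snd) * hu
  · rintro ⟨h₁, h₂⟩
    rw [h₁, h₂]
    constructor <;> ring

end Double

section Core

variable {E : Type*} [NormedAddCommGroup E] [InnerProductSpace ℂ E]

lemma isBoundedCommutator_of_graph_eq_topologicalClosure_span {S : E →ₗ.[ℂ] E} {T C : E →L[ℂ] E}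
    {s : Set (E × E)} (hS : S.graph = (Submodule.span ℂ s).topologicalClosure)
    (hs : ∀ p ∈ s, (T p.1, T p.2 + C p.1) ∈ Submodule.span ℂ s) : IsBoundedCommutator S T C := by
  let Λ : E × E →L[ℂ] E × E :=
    (T ∘L ContinuousLinearMap.fst ℂ E E).prod
      (T ∘L ContinuousLinearMap.snd ℂ E E + C ∘L ContinuousLinearMap.fst ℂ E E)
  have hspan : Submodule.span ℂ s ≤ (Submodule.span ℂ s).comap Λ.toLinearMap :=
    Submodule.span_le.2 hs
  have hgraph : S.graph ≤ S.graph.comap Λ.toLinearMap := by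
    rw [hS]
    exact Submodule.topologicalClosure_minimal _
      (hspan.trans (Submodule.comap_mono (Submodule.le_topologicalClosure _)))
      ((Submodule.isClosed_topologicalClosure _).preimage Λ.continuous)
  intro x
  obtain ⟨y, hy, hSy⟩ := (LinearPMap.mem_graph_iff _).1 (hgraph (S.mem_graph x))
  change (y : E) = T x at hy
  change S y = T (S x) + C x at hSy
  refine ⟨hy ▸ y.2, ?_⟩
  have hTx : (⟨T x, hy ▸ y.2⟩ : S.domain) = y := Subtype.ext hy.symm
  rw [hTx, hSy, add_sub_cancel_left]

end Core

section ProductDirac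

open ComplexConjugate

variable {H K : Type*} [NormedAddCommGroup H] [InnerProductSpace ℂ H]
  [NormedAddCommGroup K] [InnerProductSpace ℂ K] {ι κ : Type*}
  {b : HilbertBasis ι ℂ H} {c : HilbertBasis κ ℂ K} {D : H →ₗ.[ℂ] H} {M : K →ₗ.[ℂ] K}
  {d : ι → ℝ} {e : κ → ℝ}

variable (d e) in
/-- The eigenvalues of `D ⊗ 1 + i 1 ⊗ M`, where `d` are those of `D` and `e` those of `M`. -/
def productEigenvalue (k : ι × κ) : ℂ :=
  d k.1 + Complex.I * e k.2

lemma conj_productEigenvalue (k : ι × κ) :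
    conj (productEigenvalue d e k) = d k.1 - Complex.I * e k.2 := by
  simp [productEigenvalue, sub_eq_add_neg]

lemma norm_productEigenvalue (k : ι × κ) :
    ‖productEigenvalue d e k‖ = √(d k.1 ^ 2 + e k.2 ^ 2) := by
  rw [productEigenvalue, mul_comm, Complex.norm_add_mul_I]

lemma productDiracGraph_le_offDiagonalGraph (hD : IsDiagonal D b d) (hM : IsDiagonal M c e) :
    productDiracGraph D M ≤ offDiagonalGraph (tensorBasis b c) (productEigenvalue d e) := by
  refine Submodule.span_le.2 ?_
  rintro _ ⟨x, x', y, y', rfl⟩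
  refine mem_offDiagonalGraph.2 fun k => ⟨?_, ?_⟩
  · simp only [WithLp.toLp_fst, WithLp.toLp_snd, inner_sub_right, inner_smul_right,
      inner_tensorBasis_htmul, hD.inner_apply, hM.inner_apply, conj_productEigenvalue]
    ring
  · simp only [WithLp.toLp_fst, WithLp.toLp_snd, inner_add_right, inner_smul_right,
      inner_tensorBasis_htmul, hD.inner_apply, hM.inner_apply, productEigenvalue]
    ring

lemma toLp_basis_mem_productDiracGraph (hD : IsDiagonal D b d) (hM : IsDiagonal M c e)
    (k : ι × κ) (s t : ℂ) :
    (WithLp.toLp 2 (s • tensorBasis b c k, t • tensorBasis b c k),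
      WithLp.toLp 2 ((conj (productEigenvalue d e k) * t) • tensorBasis b c k,
        (productEigenvalue d e k * s) • tensorBasis b c k)) ∈ productDiracGraph D M := by
  obtain ⟨hb, hDb⟩ := hD.exists_apply_basis k.1
  obtain ⟨hc, hMc⟩ := hM.exists_apply_basis k.2
  refine Submodule.subset_span ⟨s • ⟨b k.1, hb⟩, t • ⟨b k.1, hb⟩, ⟨c k.2, hc⟩, ⟨c k.2, hc⟩, ?_⟩
  rw [D.map_smul, D.map_smul, hDb, hMc, conj_productEigenvalue, productEigenvalue]
  simp only [Submodule.coe_smul, htmul_smul_left, htmul_smul_right, ← tensorBasis_apply]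
  refine congrArg (Prod.mk _) (congrArg (WithLp.toLp 2) (Prod.ext ?_ ?_)) <;> simp only <;> module

lemma offDiagonalGraph_le_topologicalClosure (hD : IsDiagonal D b d) (hM : IsDiagonal M c e) :
    offDiagonalGraph (tensorBasis b c) (productEigenvalue d e) ≤
      (productDiracGraph D M).topologicalClosure := by
  rintro ⟨ξ, η⟩ h
  let toLpL : HilbertTensor H K × HilbertTensor H K →L[ℂ] Double (HilbertTensor H K) :=
    (WithLp.prodContinuousLinearEquiv 2 ℂ (HilbertTensor H K) (HilbertTensor H K)).symm
  have hasSum_double (ζ : Double (HilbertTensor H K)) : HasSum (fun k =>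
      toLpL (inner ℂ (tensorBasis b c k) ζ.fst • tensorBasis b c k,
        inner ℂ (tensorBasis b c k) ζ.snd • tensorBasis b c k)) ζ := by
    have hasSum_expansion (x : HilbertTensor H K) :
        HasSum (fun k => inner ℂ (tensorBasis b c k) x • tensorBasis b c k) x := by
      simpa [HilbertBasis.repr_apply_apply] using (tensorBasis b c).hasSum_repr x
    exact ((hasSum_expansion ζ.fst).prodMk (hasSum_expansion ζ.snd)).mapL toLpL
  refine (Submodule.isClosed_topologicalClosure _).mem_of_tendsto
    ((hasSum_double ξ).prodMk (hasSum_double η)) (Filter.Eventually.of_forall fun F => ?_)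
  refine Submodule.le_topologicalClosure _ (Submodule.sum_mem _ fun k _ => ?_)
  obtain ⟨h₁, h₂⟩ := mem_offDiagonalGraph.1 h k
  simp only at h₁ h₂
  rw [h₁, h₂]
  exact toLp_basis_mem_productDiracGraph hD hM k _ _

lemma topologicalClosure_productDiracGraph (hD : IsDiagonal D b d) (hM : IsDiagonal M c e) :
    (productDiracGraph D M).topologicalClosure =
      offDiagonalGraph (tensorBasis b c) (productEigenvalue d e) :=
  le_antisymm
    (Submodule.topologicalClosure_minimal _ (productDiracGraph_le_offDiagonalGraph hD hM)
      (isClosed_offDiagonalGraph _ _))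
    (offDiagonalGraph_le_topologicalClosure hD hM)

lemma graph_productDirac (hD : IsDiagonal D b d) (hM : IsDiagonal M c e) :
    (productDirac D M).graph = offDiagonalGraph (tensorBasis b c) (productEigenvalue d e) := by
  rw [productDirac, topologicalClosure_productDiracGraph hD hM, Submodule.toLinearPMap_graph_eq]
  rintro ⟨ξ, η⟩ h (rfl : ξ = 0)
  exact eq_zero_of_zero_mem_offDiagonalGraph h

lemma isBoundedCommutator_productDirac (hD : IsDiagonal D b d) (hM : IsDiagonal M c e)
    {T C : H →L[ℂ] H} {T' C' : K →L[ℂ] K} (hC : IsBoundedCommutator D T C)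
    (hC' : IsBoundedCommutator M T' C') :
    IsBoundedCommutator (productDirac D M) (doubleOp (tensorOp T T'))
      (offDiagOp (tensorOp C T' + (-Complex.I) • tensorOp T C')
        (tensorOp C T' + Complex.I • tensorOp T C')) := by
  refine isBoundedCommutator_of_graph_eq_topologicalClosure_span
    ((graph_productDirac hD hM).trans (topologicalClosure_productDiracGraph hD hM).symm) ?_
  rintro _ ⟨x, x', y, y', rfl⟩
  obtain ⟨hTx, hDTx⟩ := hC x
  obtain ⟨hTx', hDTx'⟩ := hC x'
  obtain ⟨hTy, hMTy⟩ := hC' y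
  obtain ⟨hTy', hMTy'⟩ := hC' y'
  refine Submodule.subset_span ⟨⟨T x, hTx⟩, ⟨T x', hTx'⟩, ⟨T' y, hTy⟩, ⟨T' y', hTy'⟩, ?_⟩
  rw [eq_add_of_sub_eq hDTx, eq_add_of_sub_eq hDTx', eq_add_of_sub_eq hMTy,
    eq_add_of_sub_eq hMTy', doubleOp_apply, doubleOp_apply, offDiagOp_apply]
  refine Prod.ext (eq_of_fst_eq_of_snd_eq ?_ ?_) (eq_of_fst_eq_of_snd_eq ?_ ?_)
  · exact tensorOp_htmul _ _ _ _
  · exact tensorOp_htmul _ _ _ _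
  all_goals
    simp only [WithLp.add_fst, WithLp.add_snd, WithLp.toLp_fst, WithLp.toLp_snd, map_sub, map_add,
      map_smul, add_apply, smul_apply, tensorOp_htmul, htmul_add_left, htmul_add_right]
    module

lemma isSelfAdjoint_productDirac (hD : IsDiagonal D b d) (hM : IsDiagonal M c e) :
    IsSelfAdjoint (productDirac D M) := by
  obtain ⟨u, hu⟩ := exists_eq_norm_mul_circle (productEigenvalue d e)
  exact (isDiagonal_phaseBasis_of_graph_eq (graph_productDirac hD hM) hu).isSelfAdjoint

lemma hasCompactResolvent_productDirac (hD : IsDiagonal D b d) (hM : IsDiagonal M c e)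
    (hd : ∀ R : ℝ, {i | |d i| ≤ R}.Finite) (he : ∀ R : ℝ, {j | |e j| ≤ R}.Finite) :
    HasCompactResolvent (productDirac D M) := by
  obtain ⟨u, hu⟩ := exists_eq_norm_mul_circle (productEigenvalue d e)
  refine (isDiagonal_phaseBasis_of_graph_eq (graph_productDirac hD hM) hu).hasCompactResolvent
    fun R => (((hd R).prod (he R)).prod (Set.finite_univ (α := Bool))).subset ?_
  rintro ⟨⟨i, j⟩, ε⟩ h
  have hR : √(d i ^ 2 + e j ^ 2) ≤ R := by
    rw [← norm_productEigenvalue (i, j)]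
    refine le_trans (le_of_eq ?_) (show |_| ≤ R from h)
    cases ε <;> simp
  refine ⟨⟨?_, ?_⟩, trivial⟩
  · exact (Real.abs_le_sqrt (le_add_of_nonneg_right (sq_nonneg _))).trans hR
  · exact (Real.abs_le_sqrt (le_add_of_nonneg_left (sq_nonneg _))).trans hR

lemma matrixOf_add_smul {μ : Type*} (f : HilbertBasis μ ℂ H) (S T : H →L[ℂ] H) (z : ℂ) :
    matrixOf f (S + z • T) = fun i j => matrixOf f S i j + z * matrixOf f T i j := by
  funext i j
  simp only [matrixOf, add_apply, smul_apply, inner_add_right, inner_smul_right]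

lemma isSmoothMatrix_matrixOf_tensorOp {S : H →L[ℂ] H} {T : K →L[ℂ] K}
    (hS : IsSmoothMatrix (fun i => |d i|) (matrixOf b S))
    (hT : IsSmoothMatrix (fun j => |e j|) (matrixOf c T)) :
    IsSmoothMatrix (fun k => ‖productEigenvalue d e k‖)
      (matrixOf (tensorBasis b c) (tensorOp S T)) := by
  have hmatrix : matrixOf (tensorBasis b c) (tensorOp S T) =
      fun p q => matrixOf b S p.1 q.1 * matrixOf c T p.2 q.2 :=
    funext fun p => funext (matrixOf_tensorOp b c S T p)
  simp only [norm_productEigenvalue]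
  rw [hmatrix]
  exact hS.kronecker hT

variable [CompleteSpace H] [CompleteSpace K]

lemma IsRegularOp.doubleOp_tensorOp (hD : IsDiagonal D b d) (hM : IsDiagonal M c e)
    {T : H →L[ℂ] H} {T' : K →L[ℂ] K} (hT : IsRegularOp D T) (hT' : IsRegularOp M T') :
    IsRegularOp (productDirac D M) (doubleOp (tensorOp T T')) := by
  obtain ⟨hT, C, hC, hCsmooth⟩ := hT
  obtain ⟨hT', C', hC', hCsmooth'⟩ := hT'
  have habs := isDiagonal_absOp_of_graph_eq (graph_productDirac hD hM)
  rw [hD.absOp.inDomInfty_iff] at hT hCsmooth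
  rw [hM.absOp.inDomInfty_iff] at hT' hCsmooth'
  have hsmooth (z : ℂ) : IsSmoothMatrix (fun k => ‖productEigenvalue d e k‖)
      (matrixOf (tensorBasis b c) (tensorOp C T' + z • tensorOp T C')) := by
    rw [matrixOf_add_smul]
    exact (isSmoothMatrix_matrixOf_tensorOp hCsmooth hT').add
      ((isSmoothMatrix_matrixOf_tensorOp hT hCsmooth').const_mul z)
  have hdouble := isSmoothMatrix_doubleOp (isSmoothMatrix_matrixOf_tensorOp hT hT')
  have hoffDiag := isSmoothMatrix_offDiagOp (hsmooth (-Complex.I)) (hsmooth Complex.I)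
  refine ⟨habs.inDomInfty_iff.2 hdouble, _, isBoundedCommutator_productDirac hD hM hC hC', ?_⟩
  exact habs.inDomInfty_iff.2 hoffDiag

end ProductDirac

section Length

variable {G : Type*} {V : Type*} [NormedAddCommGroup V] [InnerProductSpace ℂ V] {ι : Type*}
  [Fintype ι] {ℓ : G → V →L[ℂ] V}

lemma orthonormal_lp_single [DecidableEq G] (v : G → OrthonormalBasis ι ℂ V) :
    Orthonormal ℂ fun p : G × ι => (lp.single 2 p.1 (v p.1 p.2) : lp (fun _ : G => V) 2) := by
  classical
  rw [orthonormal_iff_ite]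
  rintro ⟨x, k⟩ ⟨y, l⟩
  rw [lp.inner_single_left]
  by_cases h : x = y
  · subst h
    simp [orthonormal_iff_ite.1 (v x).orthonormal k l]
  · simp [h, lp.single_apply]

lemma mem_spectrum_of_apply_eq_smul {T : V →L[ℂ] V} {t : ℝ} {v : V} (hv : v ≠ 0)
    (h : T v = (t : ℂ) • v) : t ∈ spectrum ℝ T := by
  rw [spectrum.mem_iff]
  rintro ⟨S, hS⟩
  refine hv ?_
  calc v = (↑S⁻¹ : V →L[ℂ] V) ((↑S : V →L[ℂ] V) v) := by
        rw [← mul_apply_eq_comp, S.inv_mul, one_apply_eq_self]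
    _ = 0 := by
        rw [hS, sub_apply, h, Algebra.algebraMap_eq_smul_one, smul_apply, one_apply_eq_self,
          Complex.coe_smul, sub_self, map_zero]

variable [CompleteSpace V]

open Classical in
/-- The basis `δₓ ⊗ v_{x,k}` of `ℓ²(G, V)` obtained from orthonormal bases `v_x` of `V`. -/
def lpBasis (v : G → OrthonormalBasis ι ℂ V) : HilbertBasis (G × ι) ℂ (lp (fun _ : G => V) 2) :=
  HilbertBasis.mkOfOrthogonalEqBot (orthonormal_lp_single v) <| by
    rw [Submodule.eq_bot_iff]
    intro z hz
    rw [Submodule.mem_orthogonal] at hz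
    ext x
    refine eq_of_forall_inner_basis_eq (v x).toHilbertBasis fun k => ?_
    have h := hz _ (Submodule.subset_span ⟨(x, k), rfl⟩)
    simp only [lp.inner_single_left] at h
    simpa using h

lemma inner_lpBasis (v : G → OrthonormalBasis ι ℂ V) (p : G × ι) (f : lp (fun _ : G => V) 2) :
    inner ℂ (lpBasis v p) f = inner ℂ (v p.1 p.2) (f p.1) := by
  classical
  rw [lpBasis, HilbertBasis.coe_mkOfOrthogonalEqBot, lp.inner_single_left]

lemma isDiagonal_mulLength {v : G → OrthonormalBasis ι ℂ V} {e : G → ι → ℝ}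
    (hv : ∀ x k w, inner ℂ (v x k) (ℓ x w) = e x k * inner ℂ (v x k) w) :
    IsDiagonal (mulLength ℓ) (lpBasis v) fun p => e p.1 p.2 := by
  intro f w
  simp only [inner_lpBasis, ← hv]
  constructor
  · intro h p
    obtain ⟨g, rfl, rfl⟩ := (LinearPMap.mem_graph_iff _).1 h
    rfl
  · intro h
    have hw (x : G) : w x = ℓ x (f x) :=
      eq_of_forall_inner_basis_eq (v x).toHilbertBasis fun k => by
        simpa only [OrthonormalBasis.coe_toHilbertBasis] using h (x, k)
    have hmem : Memℓp (fun x => ℓ x (f x)) 2 := by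
      simpa only [← hw] using lp.memℓp w
    exact (LinearPMap.mem_graph_iff _).2 ⟨⟨f, hmem⟩, rfl, by ext x; exact (hw x).symm⟩

lemma exists_isDiagonal_mulLength [FiniteDimensional ℂ V] (hsa : ∀ x, IsSelfAdjoint (ℓ x))
    (hproper : ∀ R : ℝ, {x | (spectrum ℝ (ℓ x) ∩ Set.Icc (-R) R).Nonempty}.Finite) :
    ∃ (c : HilbertBasis (G × Fin (Module.finrank ℂ V)) ℂ (lp (fun _ : G => V) 2))
      (e : G × Fin (Module.finrank ℂ V) → ℝ),
      IsDiagonal (mulLength ℓ) c e ∧ ∀ R : ℝ, {j | |e j| ≤ R}.Finite := by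
  have hsymm (x : G) : (ℓ x : V →ₗ[ℂ] V).IsSymmetric := (hsa x).isSymmetric
  let v (x : G) : OrthonormalBasis (Fin (Module.finrank ℂ V)) ℂ V :=
    (hsymm x).eigenvectorBasis rfl
  let e (x : G) : Fin (Module.finrank ℂ V) → ℝ := (hsymm x).eigenvalues rfl
  have heigen (x : G) (k : Fin (Module.finrank ℂ V)) : ℓ x (v x k) = (e x k : ℂ) • v x k :=
    (hsymm x).apply_eigenvectorBasis rfl k
  refine ⟨lpBasis v, _, isDiagonal_mulLength (e := e) fun x k w => ?_, fun R => ?_⟩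
  · have h : inner ℂ (ℓ x (v x k)) w = inner ℂ (v x k) (ℓ x w) := hsymm x (v x k) w
    rw [← h, heigen, inner_smul_left, Complex.conj_ofReal]
  · refine ((hproper R).prod Set.finite_univ).subset fun p hp => ⟨⟨e p.1 p.2, ?_, ?_⟩, trivial⟩
    · exact mem_spectrum_of_apply_eq_smul ((v p.1).orthonormal.ne_zero p.2) (heigen p.1 p.2)
    · exact abs_le.1 hp

lemma IsProperTranslationBounded.finite_setOf_spectrum_inter_Icc_nonempty [Group G]
    (hℓ : IsProperTranslationBounded ℓ) (R : ℝ) :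
    {x | (spectrum ℝ (ℓ x) ∩ Set.Icc (-R) R).Nonempty}.Finite := by
  refine ((hℓ.discrete R).biUnion fun t ht => hℓ.finite_fibers t ht.1).subset ?_
  rintro x ⟨t, ht, htR⟩
  exact Set.mem_biUnion ⟨Set.mem_iUnion.2 ⟨x, ht⟩, htR⟩ ht

end Length

section CrossedRep

variable {A : Type*} [CStarAlgebra A] {G : Type*}
  {K : Type*} [NormedAddCommGroup K] [InnerProductSpace ℂ K]

/-- The integrated form `∑ aₓ δₓ ↦ ∑ r x aₓ` of a family of operators `r x a` representing `a δₓ`.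
Both `integratedForm` and `regularRep` are of this shape by definition. -/
def crossedSum (r : G → A →L[ℂ] (K →L[ℂ] K)) : (G →₀ A) →ₗ[ℂ] (K →L[ℂ] K) :=
  Finsupp.lsum ℂ fun x => (r x : A →ₗ[ℂ] (K →L[ℂ] K))

lemma crossedSum_single (r : G → A →L[ℂ] (K →L[ℂ] K)) (x : G) (a : A) :
    crossedSum r (Finsupp.single x a) = r x a := by
  simp [crossedSum]

lemma crossedSum_apply (r : G → A →L[ℂ] (K →L[ℂ] K)) (f : G →₀ A) :
    crossedSum r f = f.sum fun x a => r x a := rfl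

/-- `C_c(G, 𝒜)` as a linear subspace of `C_c(G, A)`. -/
def finSuppSubmodule (G : Type*) (𝒜 : StarSubalgebra ℂ A) : Submodule ℂ (G →₀ A) where
  carrier := finSupp G 𝒜
  zero_mem' := fun _ => 𝒜.zero_mem
  add_mem' := fun hf hg x => 𝒜.add_mem (hf x) (hg x)
  smul_mem' := fun c _ hf x => 𝒜.smul_mem (hf x) c

lemma single_mem_finSupp {𝒜 : StarSubalgebra ℂ A} (x : G) {a : A} (ha : a ∈ 𝒜) :
    Finsupp.single x a ∈ finSupp G 𝒜 := by
  classical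
  intro y
  rw [Finsupp.single_apply]
  split_ifs
  exacts [ha, 𝒜.zero_mem]

variable [Group G] [CompleteSpace K]

/-- The operators `r x a` multiply and star like the elements `a δₓ` of the twisted crossed
product. -/
structure IsCrossedRep (τ : TwistingPair A G) (r : G → A → K →L[ℂ] K) : Prop where
  one : r 1 1 = 1
  mul : ∀ x y a b, r x a * r y b = r (x * y) (a * τ.ρ x b * τ.σ x y)
  star : ∀ x a, star (r x a) = r x⁻¹ (star (τ.σ x⁻¹ x : A) * τ.ρ x⁻¹ (star a))

variable {τ : TwistingPair A G}

lemma IsCrossedRep.of_intertwines {L : Type*} [NormedAddCommGroup L] [InnerProductSpace ℂ L]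
    [CompleteSpace L] {r : G → A → K →L[ℂ] K} {s : G → A → L →L[ℂ] L} (hs : IsCrossedRep τ s)
    (J : K →ₗᵢ[ℂ] L) (hJ : ∀ x a ξ, J (r x a ξ) = s x a (J ξ)) : IsCrossedRep τ r where
  one := ContinuousLinearMap.ext fun ξ => J.injective <| by
    rw [hJ, hs.one, one_apply_eq_self, one_apply_eq_self]
  mul x y a b := ContinuousLinearMap.ext fun ξ => J.injective <| by
    rw [mul_apply_eq_comp, hJ, hJ, hJ, ← hs.mul, mul_apply_eq_comp]
  star x a := by
    refine ContinuousLinearMap.ext fun ξ => ext_inner_left ℂ fun η => ?_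
    rw [ContinuousLinearMap.star_eq_adjoint, ContinuousLinearMap.adjoint_inner_right,
      ← J.inner_map_map, ← J.inner_map_map, hJ, hJ, ← hs.star,
      ContinuousLinearMap.star_eq_adjoint, ContinuousLinearMap.adjoint_inner_right]

variable {𝒜 : StarSubalgebra ℂ A} {r : G → A →L[ℂ] (K →L[ℂ] K)}

/-- The image of `C_c(G, 𝒜)` under `crossedSum r`, a `*`-subalgebra by the relations of `r`. -/
def IsCrossedRep.subalgebra (hr : IsCrossedRep τ fun x => r x) (h𝒜 : τ.IsSmooth 𝒜) :
    StarSubalgebra ℂ (K →L[ℂ] K) :=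
  have single_mem : ∀ x, ∀ a ∈ 𝒜, r x a ∈ (finSuppSubmodule G 𝒜).map (crossedSum r) :=
    fun x a ha => ⟨_, single_mem_finSupp x ha, crossedSum_single r x a⟩
  { carrier := (finSuppSubmodule G 𝒜).map (crossedSum r)
    mul_mem' := by
      rintro _ _ ⟨f, hf, rfl⟩ ⟨g, hg, rfl⟩
      rw [crossedSum_apply, crossedSum_apply, Finsupp.sum, Finsupp.sum, Finset.sum_mul_sum]
      refine Submodule.sum_mem _ fun x _ => Submodule.sum_mem _ fun y _ => ?_
      rw [hr.mul]
      exact single_mem _ _ (𝒜.mul_mem (𝒜.mul_mem (hf x) (h𝒜.ρ_mem x _ (hg y))) (h𝒜.σ_mem x y))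
    add_mem' := Submodule.add_mem _
    algebraMap_mem' := by
      intro c
      rw [Algebra.algebraMap_eq_smul_one, ← hr.one]
      exact Submodule.smul_mem _ _ (single_mem _ _ 𝒜.one_mem)
    star_mem' := by
      rintro _ ⟨f, hf, rfl⟩
      rw [crossedSum_apply, Finsupp.sum, star_sum]
      refine Submodule.sum_mem _ fun x _ => ?_
      rw [hr.star]
      exact single_mem _ _ (𝒜.mul_mem (𝒜.star_mem' (h𝒜.σ_mem _ _))
        (h𝒜.ρ_mem _ _ (𝒜.star_mem' (hf x)))) }

lemma IsCrossedRep.cstarImage_le_topologicalClosure (hr : IsCrossedRep τ fun x => r x)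
    (h𝒜 : τ.IsSmooth 𝒜) (hd : Dense (𝒜 : Set A)) :
    cstarImage (crossedSum r) ≤ (hr.subalgebra h𝒜).topologicalClosure := by
  refine StarSubalgebra.topologicalClosure_minimal (StarAlgebra.adjoin_le ?_)
    (StarSubalgebra.isClosed_topologicalClosure _)
  rintro _ ⟨f, rfl⟩
  rw [crossedSum_apply]
  refine sum_mem fun x _ => ?_
  exact map_mem_closure (r x).continuous (hd (f x)) fun a ha =>
    ⟨_, single_mem_finSupp x ha, crossedSum_single r x a⟩

lemma IsCrossedRep.exists_starSubalgebra (hr : IsCrossedRep τ fun x => r x) (h𝒜 : τ.IsSmooth 𝒜) :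
    ∃ S : StarSubalgebra ℂ (cstarImage (crossedSum r)),
      (S : Set (cstarImage (crossedSum r))) = toImage (crossedSum r) '' finSupp G 𝒜 := by
  refine ⟨(hr.subalgebra h𝒜).comap (cstarImage (crossedSum r)).subtype, ?_⟩
  ext T
  constructor
  · rintro ⟨f, hf, h⟩
    exact ⟨f, hf, Subtype.ext h⟩
  · rintro ⟨f, hf, rfl⟩
    exact ⟨f, hf, rfl⟩

lemma IsCrossedRep.dense_toImage_finSupp (hr : IsCrossedRep τ fun x => r x) (h𝒜 : τ.IsSmooth 𝒜)
    (hd : Dense (𝒜 : Set A)) : Dense (toImage (crossedSum r) '' finSupp G 𝒜) := by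
  intro T
  rw [closure_subtype, Set.image_image]
  exact hr.cstarImage_le_topologicalClosure h𝒜 hd T.2

end CrossedRep

section Integrated

variable {A : Type*} [CStarAlgebra A] {G : Type*}
  {H : Type*} [NormedAddCommGroup H] [InnerProductSpace ℂ H] [CompleteSpace H]
  {π : A →⋆ₐ[ℂ] (H →L[ℂ] H)} {U : G → unitary (H →L[ℂ] H)}

lemma continuous_starAlgHom (π : A →⋆ₐ[ℂ] (H →L[ℂ] H)) : Continuous π :=
  AddMonoidHomClass.continuous_of_bound π 1 fun a => by
    simpa using NonUnitalStarAlgHom.norm_apply_le π a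

/-- The operators `π(a) Uₓ` representing `a δₓ` on `H`, linear and bounded in `a`. -/
def covariantMap (π : A →⋆ₐ[ℂ] (H →L[ℂ] H)) (U : G → unitary (H →L[ℂ] H)) (x : G) :
    A →L[ℂ] (H →L[ℂ] H) where
  toFun a := π a * U x
  map_add' a b := by rw [map_add, add_mul]
  map_smul' c a := by rw [map_smul, smul_mul_assoc, RingHom.id_apply]
  cont := (continuous_starAlgHom π).mul continuous_const

lemma covariantMap_apply (x : G) (a : A) : covariantMap π U x a = π a * U x := rfl

variable [Group G] {τ : TwistingPair A G}

lemma IsCovariantRep.unitary_one (h : IsCovariantRep τ π U) : (U 1 : H →L[ℂ] H) = 1 := by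
  have h1 := h.mul 1 1
  rw [τ.σ_one_left, OneMemClass.coe_one, map_one, one_mul, mul_one] at h1
  calc (U 1 : H →L[ℂ] H) = star (U 1 : H →L[ℂ] H) * (U 1 * U 1) := by
        rw [← mul_assoc, Unitary.coe_star_mul_self, one_mul]
    _ = 1 := by rw [h1, Unitary.coe_star_mul_self]

lemma IsCovariantRep.unitary_mul_apply (h : IsCovariantRep τ π U) (x : G) (a : A) :
    (U x : H →L[ℂ] H) * π a = π (τ.ρ x a) * U x := by
  rw [h.covariant, mul_assoc, Unitary.coe_star_mul_self, mul_one]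

lemma IsCovariantRep.star_unitary (h : IsCovariantRep τ π U) (x : G) :
    star (U x : H →L[ℂ] H) = π (star (τ.σ x⁻¹ x : A)) * U x⁻¹ := by
  have h1 := h.mul x⁻¹ x
  rw [inv_mul_cancel, h.unitary_one, mul_one] at h1
  have h2 : (U x⁻¹ : H →L[ℂ] H) = π (τ.σ x⁻¹ x) * star (U x : H →L[ℂ] H) := by
    rw [← h1, mul_assoc, Unitary.mul_star_self_of_mem (U x).2, mul_one]
  rw [h2, ← mul_assoc, ← map_mul, Unitary.coe_star_mul_self, map_one, one_mul]

lemma IsCovariantRep.isCrossedRep (h : IsCovariantRep τ π U) :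
    IsCrossedRep τ fun x => covariantMap π U x where
  one := by rw [covariantMap_apply, map_one, h.unitary_one, one_mul]
  mul x y a b := by
    simp only [covariantMap_apply]
    rw [mul_assoc, ← mul_assoc _ (π b), h.unitary_mul_apply, map_mul, map_mul, mul_assoc, mul_assoc,
      h.mul, mul_assoc]
  star x a := by
    simp only [covariantMap_apply]
    rw [star_mul, h.star_unitary, ← map_star, mul_assoc, h.unitary_mul_apply, map_mul, mul_assoc]

end Integrated

section TensorOp

variable {H K : Type*} [NormedAddCommGroup H] [InnerProductSpace ℂ H]
  [NormedAddCommGroup K] [InnerProductSpace ℂ K]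

lemma tensorOp_mul (S S' : H →L[ℂ] H) (T T' : K →L[ℂ] K) :
    tensorOp S T * tensorOp S' T' = tensorOp (S * S') (T * T') :=
  ext_htmul fun x y => by
    simp only [mul_apply_eq_comp, tensorOp_htmul]

lemma tensorOp_one : tensorOp (1 : H →L[ℂ] H) (1 : K →L[ℂ] K) = 1 :=
  ext_htmul fun x y => by
    simp only [one_apply_eq_self, tensorOp_htmul]

lemma star_tensorOp [CompleteSpace H] [CompleteSpace K] (S : H →L[ℂ] H) (T : K →L[ℂ] K) :
    star (tensorOp S T) = tensorOp (star S) (star T) := by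
  refine ext_htmul fun x y => ?_
  refine ext_inner_right ℂ fun z => ?_
  rw [ContinuousLinearMap.star_eq_adjoint, ContinuousLinearMap.adjoint_inner_left]
  have h : innerSL ℂ (htmul x y) ∘L tensorOp S T =
      innerSL ℂ (tensorOp (star S) (star T) (htmul x y)) := by
    refine ext_htmul fun x' y' => ?_
    change inner ℂ (htmul x y) (tensorOp S T (htmul x' y')) =
      inner ℂ (tensorOp (star S) (star T) (htmul x y)) (htmul x' y')
    rw [tensorOp_htmul, tensorOp_htmul, inner_htmul, inner_htmul,
      ContinuousLinearMap.star_eq_adjoint, ContinuousLinearMap.star_eq_adjoint,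
      ContinuousLinearMap.adjoint_inner_left, ContinuousLinearMap.adjoint_inner_left]
  exact DFunLike.congr_fun h z

/-- The diagonal embedding `T ↦ T ⊕ T` as a `*`-homomorphism. -/
def doubleHom (E : Type*) [NormedAddCommGroup E] [InnerProductSpace ℂ E] [CompleteSpace E] :
    (E →L[ℂ] E) →⋆ₐ[ℂ] (Double E →L[ℂ] Double E) where
  toFun := doubleOp
  map_one' := rfl
  map_mul' _ _ := rfl
  map_zero' := rfl
  map_add' _ _ := rfl
  commutes' _ := rfl
  map_star' T := by
    rw [ContinuousLinearMap.star_eq_adjoint, ContinuousLinearMap.star_eq_adjoint,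
      ContinuousLinearMap.eq_adjoint_iff]
    intro z w
    rw [inner_eq_inner_fst_add_inner_snd, inner_eq_inner_fst_add_inner_snd, doubleOp_apply]
    change inner ℂ (ContinuousLinearMap.adjoint T z.fst) w.fst +
      inner ℂ (ContinuousLinearMap.adjoint T z.snd) w.snd =
        inner ℂ z.fst (T w.fst) + inner ℂ z.snd (T w.snd)
    rw [ContinuousLinearMap.adjoint_inner_left, ContinuousLinearMap.adjoint_inner_left]

end TensorOp

section Shift

variable {G : Type*} {E : Type*} [NormedAddCommGroup E] [InnerProductSpace ℂ E]

lemma ext_lp_single [DecidableEq G] {F : Type*} [NormedAddCommGroup F] [NormedSpace ℂ F]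
    {S T : lp (fun _ : G => E) 2 →L[ℂ] F}
    (h : ∀ y ξ, S (lp.single 2 y ξ) = T (lp.single 2 y ξ)) : S = T :=
  lp.ext_continuousLinearMap ENNReal.ofNat_ne_top fun y => ContinuousLinearMap.ext fun ξ => h y ξ

lemma ext_inner_lp_single [DecidableEq G] {f g : lp (fun _ : G => E) 2}
    (h : ∀ y ξ, inner ℂ (lp.single 2 y ξ : lp (fun _ : G => E) 2) f =
      inner ℂ (lp.single 2 y ξ : lp (fun _ : G => E) 2) g) : f = g := by
  ext y
  refine ext_inner_left ℂ fun ξ => ?_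
  simpa only [lp.inner_single_left] using h y ξ

lemma inner_lp_single_single [DecidableEq G] (y z : G) (ξ η : E) :
    inner ℂ (lp.single 2 y ξ : lp (fun _ : G => E) 2) (lp.single 2 z η) =
      if y = z then inner ℂ ξ η else 0 := by
  rw [lp.inner_single_left]
  split_ifs with h
  · subst h
    rw [lp.single_apply_self]
  · rw [lp.single_apply_ne _ _ _ h, inner_zero_right]

lemma norm_weightedShift_le [Nonempty G] (w : G → E →L[ℂ] E) (C : ℝ)
    (hw : ∀ z, ‖w z‖ ≤ C) (e : G ≃ G) : ‖weightedShift w C hw e‖ ≤ C := by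
  unfold weightedShift
  exact LinearMap.mkContinuous_norm_le _ ((norm_nonneg _).trans (hw (Classical.arbitrary G))) _

lemma weightedShift_single [Nonempty G] [DecidableEq G] (w : G → E →L[ℂ] E) (C : ℝ)
    (hw : ∀ z, ‖w z‖ ≤ C) (e : G ≃ G) (y : G) (ξ : E) :
    weightedShift w C hw e (lp.single 2 y ξ) = lp.single 2 (e.symm y) (w (e.symm y) ξ) := by
  ext z
  change w z ((lp.single 2 y ξ : lp (fun _ : G => E) 2) (e z)) = _
  by_cases h : e z = y
  · obtain rfl : z = e.symm y := e.eq_symm_apply.2 h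
    rw [e.apply_symm_apply, lp.single_apply_self, lp.single_apply_self]
  · rw [lp.single_apply_ne _ _ _ h, lp.single_apply_ne _ _ _ (mt e.eq_symm_apply.1 h), map_zero]

lemma leftReg_single [Group G] [DecidableEq G] (g y : G) (v : E) :
    leftReg E g (lp.single 2 y v) = lp.single 2 (g * y) v := by
  have h := weightedShift_single (fun _ => ContinuousLinearMap.id ℂ E) 1
    (fun _ => ContinuousLinearMap.norm_id_le) (Equiv.mulLeft g⁻¹) y v
  rwa [Equiv.mulLeft_symm_apply, inv_inv] at h

lemma leftReg_mul [Group G] (g h : G) : leftReg E g * leftReg E h = leftReg E (g * h) := by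
  classical
  refine ext_lp_single fun y v => ?_
  rw [mul_apply_eq_comp, leftReg_single, leftReg_single, leftReg_single, mul_assoc]

lemma leftReg_one [Group G] : leftReg E (1 : G) = 1 := by
  classical
  refine ext_lp_single fun y v => ?_
  rw [leftReg_single, one_mul, one_apply_eq_self]

lemma star_leftReg [Group G] [CompleteSpace E] (g : G) :
    star (leftReg E g) = leftReg E g⁻¹ := by
  classical
  refine ext_lp_single fun y v => ext_inner_lp_single fun z w => ?_
  rw [ContinuousLinearMap.star_eq_adjoint, ContinuousLinearMap.adjoint_inner_right,
    leftReg_single, leftReg_single, inner_lp_single_single, inner_lp_single_single]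
  simp only [eq_inv_mul_iff_mul_eq]

end Shift

section Regular

variable {A : Type*} [CStarAlgebra A] {G : Type*} [Group G]
  {H : Type*} [NormedAddCommGroup H] [InnerProductSpace ℂ H] [CompleteSpace H]
  {τ : TwistingPair A G} {π : A →⋆ₐ[ℂ] (H →L[ℂ] H)} {U : G → unitary (H →L[ℂ] H)}

/-- The operators `Π(a δₓ)` of the regular representation, linear and bounded in `a`. -/
def regularMap (τ : TwistingPair A G) (π : A →⋆ₐ[ℂ] (H →L[ℂ] H)) (x : G) :
    A →L[ℂ] (lp (fun _ : G => H) 2 →L[ℂ] lp (fun _ : G => H) 2) :=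
  LinearMap.mkContinuous
    { toFun := fun a => weightedShift (fun z => π (τ.ρ z⁻¹ a * τ.σ z⁻¹ x)) ‖a‖
        (norm_regular_le τ π x a) (Equiv.mulLeft x⁻¹)
      map_add' := fun a b => by
        ext f z
        change π (τ.ρ z⁻¹ (a + b) * τ.σ z⁻¹ x) (f (x⁻¹ * z)) =
          π (τ.ρ z⁻¹ a * τ.σ z⁻¹ x) (f (x⁻¹ * z)) + π (τ.ρ z⁻¹ b * τ.σ z⁻¹ x) (f (x⁻¹ * z))
        rw [map_add, add_mul, map_add, add_apply]
      map_smul' := fun c a => by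
        ext f z
        change π (τ.ρ z⁻¹ (c • a) * τ.σ z⁻¹ x) (f (x⁻¹ * z)) =
          c • π (τ.ρ z⁻¹ a * τ.σ z⁻¹ x) (f (x⁻¹ * z))
        rw [map_smul, smul_mul_assoc, map_smul, smul_apply] }
    1 fun a => by
      rw [one_mul]
      exact norm_weightedShift_le _ _ (norm_regular_le τ π x a) _

lemma regularMap_single [DecidableEq G] (x : G) (a : A) (y : G) (ξ : H) :
    regularMap τ π x a (lp.single 2 y ξ) =
      lp.single 2 (x * y) (π (τ.ρ (x * y)⁻¹ a * τ.σ (x * y)⁻¹ x) ξ) := by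
  have h := weightedShift_single _ _ (norm_regular_le τ π x a) (Equiv.mulLeft x⁻¹) y ξ
  rwa [Equiv.mulLeft_symm_apply, inv_inv] at h

end Regular

section OrthogonalIsometries

variable {K L : Type*} [NormedAddCommGroup K] [InnerProductSpace ℂ K] [CompleteSpace K]
  [NormedAddCommGroup L] [InnerProductSpace ℂ L] [CompleteSpace L] {ι : Type*} [Fintype ι]
  {J : ι → K →L[ℂ] L}

open ContinuousLinearMap in
/-- Isometries `Jₖ : K → L` whose ranges decompose `L` orthogonally: the Cuntz relations
`Jₖ^* Jₗ = δₖₗ` and `∑ Jₖ Jₖ^* = 1`. -/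
structure IsCuntzFamily (J : ι → K →L[ℂ] L) : Prop where
  adjoint_comp_self : ∀ k, adjoint (J k) ∘L J k = ContinuousLinearMap.id ℂ K
  adjoint_comp_of_ne : ∀ k l, k ≠ l → adjoint (J k) ∘L J l = 0
  sum_comp_adjoint : ∑ k, J k ∘L adjoint (J k) = ContinuousLinearMap.id ℂ L

open ContinuousLinearMap in
lemma IsCuntzFamily.sum_conj_mul_sum_conj (hJ : IsCuntzFamily J) (S T : K →L[ℂ] K) :
    (∑ k, J k ∘L S ∘L adjoint (J k)) * ∑ k, J k ∘L T ∘L adjoint (J k) =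
      ∑ k, J k ∘L (S * T) ∘L adjoint (J k) := by
  have hmul (k l : ι) : (J k ∘L S ∘L adjoint (J k)) * (J l ∘L T ∘L adjoint (J l)) =
      J k ∘L S ∘L (adjoint (J k) ∘L J l) ∘L T ∘L adjoint (J l) := rfl
  rw [Finset.sum_mul_sum]
  refine Finset.sum_congr rfl fun k _ => ?_
  rw [Finset.sum_eq_single_of_mem k (Finset.mem_univ k) fun l _ hl => ?_, hmul,
    hJ.adjoint_comp_self, id_comp]
  · rfl
  · rw [hmul, hJ.adjoint_comp_of_ne k l hl.symm, zero_comp, comp_zero, comp_zero]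

open ContinuousLinearMap in
/-- The amplification `T ↦ ∑ₖ Jₖ T Jₖ^*` along a Cuntz family. -/
def IsCuntzFamily.amplification (hJ : IsCuntzFamily J) : (K →L[ℂ] K) →⋆ₐ[ℂ] (L →L[ℂ] L) :=
  StarAlgHom.mk
    (AlgHom.ofLinearMap
      { toFun := fun T => ∑ k, J k ∘L T ∘L adjoint (J k)
        map_add' := fun S T => by simp only [add_comp, comp_add, Finset.sum_add_distrib]
        map_smul' := fun c T => by
          simp only [smul_comp, comp_smul, Finset.smul_sum, RingHom.id_apply] }
      hJ.sum_comp_adjoint fun S T => (hJ.sum_conj_mul_sum_conj S T).symm)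
    fun T => by
      change ∑ k, J k ∘L star T ∘L adjoint (J k) = star (∑ k, J k ∘L T ∘L adjoint (J k))
      simp only [star_sum, star_eq_adjoint, adjoint_comp, adjoint_adjoint, comp_assoc]

open ContinuousLinearMap in
lemma IsCuntzFamily.amplification_eq_of_intertwines (hJ : IsCuntzFamily J) {S : L →L[ℂ] L}
    {T : K →L[ℂ] K} (h : ∀ k, J k ∘L T = S ∘L J k) : hJ.amplification T = S :=
  calc hJ.amplification T = ∑ k, S * (J k ∘L adjoint (J k)) :=
        Finset.sum_congr rfl fun k _ => by rw [← comp_assoc, h, comp_assoc]; rfl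
    _ = S := by rw [← Finset.mul_sum, hJ.sum_comp_adjoint]; exact mul_one S

end OrthogonalIsometries

section FellAbsorption

variable {A : Type*} [CStarAlgebra A] {G : Type*} [Group G]
  {H : Type*} [NormedAddCommGroup H] [InnerProductSpace ℂ H] [CompleteSpace H]
  {V : Type*} [NormedAddCommGroup V] [InnerProductSpace ℂ V]
  {τ : TwistingPair A G} {π : A →⋆ₐ[ℂ] (H →L[ℂ] H)} {U : G → unitary (H →L[ℂ] H)}

/-- The embedding `ξ ↦ U_{y⁻¹}^* ξ ⊗ δ_y ⊗ v` of the fibre of `ℓ²(G, H)` over `y`. -/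
def fiberMap [DecidableEq G] (U : G → unitary (H →L[ℂ] H)) (v : V) (y : G) :
    H →L[ℂ] HilbertTensor H (lp (fun _ : G => V) 2) :=
  (htmulL H (lp (fun _ : G => V) 2)).flip (lp.single 2 y v) ∘L star (U y⁻¹ : H →L[ℂ] H)

lemma fiberMap_apply [DecidableEq G] (v : V) (y : G) (ξ : H) :
    fiberMap U v y ξ = htmul (star (U y⁻¹ : H →L[ℂ] H) ξ) (lp.single 2 y v) := rfl

lemma inner_fiberMap [DecidableEq G] (v w : V) (y z : G) (ξ η : H) :
    inner ℂ (fiberMap U v y ξ) (fiberMap U w z η) =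
      if y = z then inner ℂ ξ η * inner ℂ v w else 0 := by
  rw [fiberMap_apply, fiberMap_apply, inner_htmul, inner_lp_single_single]
  split_ifs with h
  · subst h
    rw [ContinuousLinearMap.star_eq_adjoint, ContinuousLinearMap.adjoint_inner_left,
      ← ContinuousLinearMap.star_eq_adjoint, ← mul_apply_eq_comp,
      Unitary.mul_star_self_of_mem (U y⁻¹).2, one_apply_eq_self]
  · rw [mul_zero]

/-- `fiberMap` for a unit vector `v`, bundled as an isometry. -/
def fiberIsometry [DecidableEq G] (U : G → unitary (H →L[ℂ] H)) {v : V} (hv : ‖v‖ = 1) (y : G) :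
    H →ₗᵢ[ℂ] HilbertTensor H (lp (fun _ : G => V) 2) :=
  LinearMap.isometryOfInner (fiberMap U v y).toLinearMap fun ξ η => by
    refine (inner_fiberMap v v y y ξ η).trans ?_
    rw [if_pos rfl, inner_self_eq_norm_sq_to_K, hv]
    simp

lemma orthogonalFamily_fiberIsometry [DecidableEq G] (U : G → unitary (H →L[ℂ] H)) {v : V}
    (hv : ‖v‖ = 1) : OrthogonalFamily ℂ (fun _ : G => H) (fiberIsometry U hv) :=
  fun y z hyz ξ η => (inner_fiberMap v v y z ξ η).trans (if_neg hyz)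

open Classical in
/-- The Fell absorption isometry `ξ ⊗ δ_y ↦ U_{y⁻¹}^* ξ ⊗ δ_y ⊗ v` of `ℓ²(G, H)` into
`H ⊗ ℓ²(G) ⊗ V`. -/
def fellIsometry (U : G → unitary (H →L[ℂ] H)) {v : V} (hv : ‖v‖ = 1) :
    lp (fun _ : G => H) 2 →ₗᵢ[ℂ] HilbertTensor H (lp (fun _ : G => V) 2) :=
  (orthogonalFamily_fiberIsometry U hv).linearIsometry

open Classical in
lemma fellIsometry_single {v : V} (hv : ‖v‖ = 1) (y : G) (ξ : H) :
    fellIsometry U hv (lp.single 2 y ξ) = htmul (star (U y⁻¹ : H →L[ℂ] H) ξ) (lp.single 2 y v) :=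
  (orthogonalFamily_fiberIsometry U hv).linearIsometry_apply_single ξ

variable (V) in
/-- The operators `π(a) Uₓ ⊗ λₓ ⊗ 1` representing `a δₓ` on `H ⊗ ℓ²(G) ⊗ V`. -/
def tensorMap (π : A →⋆ₐ[ℂ] (H →L[ℂ] H)) (U : G → unitary (H →L[ℂ] H)) (x : G) (a : A) :
    HilbertTensor H (lp (fun _ : G => V) 2) →L[ℂ] HilbertTensor H (lp (fun _ : G => V) 2) :=
  tensorOp (covariantMap π U x a) (leftReg V x)

lemma IsCovariantRep.isCrossedRep_tensorMap [CompleteSpace V] (h : IsCovariantRep τ π U) :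
    IsCrossedRep τ (tensorMap V π U) where
  one := by rw [tensorMap, h.isCrossedRep.one, leftReg_one, tensorOp_one]
  mul x y a b := by
    rw [tensorMap, tensorMap, tensorOp_mul, h.isCrossedRep.mul, leftReg_mul, tensorMap]
  star x a := by rw [tensorMap, star_tensorOp, h.isCrossedRep.star, star_leftReg, tensorMap]

lemma IsCovariantRep.star_unitary_mul_apply (h : IsCovariantRep τ π U) (x y : G) (a : A) :
    star (U (x * y)⁻¹ : H →L[ℂ] H) * π (τ.ρ (x * y)⁻¹ a * τ.σ (x * y)⁻¹ x) =
      π a * U x * star (U y⁻¹ : H →L[ℂ] H) := by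
  have hmul := h.mul (x * y)⁻¹ x
  rw [show (x * y)⁻¹ * x = y⁻¹ by group] at hmul
  have hσ : π (τ.σ (x * y)⁻¹ x) = U (x * y)⁻¹ * U x * star (U y⁻¹ : H →L[ℂ] H) := by
    rw [hmul, mul_assoc, Unitary.mul_star_self_of_mem (U y⁻¹).2, mul_one]
  rw [map_mul, hσ, h.covariant]
  simp only [← mul_assoc]
  rw [Unitary.star_mul_self_of_mem (U (x * y)⁻¹).2, one_mul, mul_assoc (π a),
    Unitary.star_mul_self_of_mem (U (x * y)⁻¹).2, mul_one]

lemma fellIsometry_comp_regularMap (h : IsCovariantRep τ π U) {v : V} (hv : ‖v‖ = 1) (x : G)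
    (a : A) : (fellIsometry U hv).toContinuousLinearMap ∘L regularMap τ π x a =
      tensorMap V π U x a ∘L (fellIsometry U hv).toContinuousLinearMap := by
  classical
  refine ext_lp_single fun y ξ => ?_
  simp only [ContinuousLinearMap.comp_apply, LinearIsometry.coe_toContinuousLinearMap]
  rw [regularMap_single, fellIsometry_single, fellIsometry_single, tensorMap, tensorOp_htmul,
    leftReg_single, ← mul_apply_eq_comp, h.star_unitary_mul_apply, mul_apply_eq_comp,
    covariantMap_apply]

lemma IsCovariantRep.isCrossedRep_regularMap (h : IsCovariantRep τ π U) :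
    IsCrossedRep τ fun x => regularMap τ π x :=
  h.isCrossedRep_tensorMap.of_intertwines (fellIsometry U (norm_one (α := ℂ)))
    fun x a => DFunLike.congr_fun (fellIsometry_comp_regularMap h norm_one x a)

open ContinuousLinearMap in
lemma adjoint_fellIsometry_comp_fellIsometry {v w : V} (hv : ‖v‖ = 1) (hw : ‖w‖ = 1) :
    adjoint (fellIsometry U hv).toContinuousLinearMap ∘L
        (fellIsometry U hw).toContinuousLinearMap =
      (inner ℂ v w : ℂ) • ContinuousLinearMap.id ℂ (lp (fun _ : G => H) 2) := by
  classical
  refine ext_lp_single fun y ξ => ext_inner_lp_single fun z η => ?_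
  rw [comp_apply, adjoint_inner_right, LinearIsometry.coe_toContinuousLinearMap,
    LinearIsometry.coe_toContinuousLinearMap, fellIsometry_single, fellIsometry_single,
    ← fiberMap_apply, ← fiberMap_apply, inner_fiberMap, smul_apply, inner_smul_right,
    id_apply, inner_lp_single_single, mul_ite, mul_zero, mul_comm]

open Classical ContinuousLinearMap in
lemma adjoint_fellIsometry_htmul [CompleteSpace V] {v : V} (hv : ‖v‖ = 1) (x : H) (y : G) (w : V) :
    adjoint (fellIsometry U hv).toContinuousLinearMap (htmul x (lp.single 2 y w)) =
      (inner ℂ v w : ℂ) • lp.single 2 y ((U y⁻¹ : H →L[ℂ] H) x) := by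
  refine ext_inner_lp_single fun z η => ?_
  rw [adjoint_inner_right, LinearIsometry.coe_toContinuousLinearMap, fellIsometry_single,
    inner_htmul, inner_lp_single_single, inner_smul_right, inner_lp_single_single]
  split_ifs with h
  · subst h
    rw [star_eq_adjoint, adjoint_inner_left, mul_comm]
  · rw [mul_zero, mul_zero]

variable [CompleteSpace V] {ι : Type*} [Fintype ι]

open ContinuousLinearMap in
lemma sum_fellIsometry_comp_adjoint (v : OrthonormalBasis ι ℂ V) :
    ∑ k, (fellIsometry U (v.norm_eq_one k)).toContinuousLinearMap ∘L
        adjoint (fellIsometry U (v.norm_eq_one k)).toContinuousLinearMap =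
      ContinuousLinearMap.id ℂ (HilbertTensor H (lp (fun _ : G => V) 2)) := by
  classical
  let J (k : ι) := (fellIsometry (G := G) U (v.norm_eq_one k)).toContinuousLinearMap
  refine ext_htmul fun x f => ?_
  suffices hx : (∑ k, J k ∘L adjoint (J k)) ∘L htmulL H _ x = htmulL H _ x from
    DFunLike.congr_fun hx f
  have hJ (k : ι) (y : G) (w : V) : J k (adjoint (J k) (htmul x (lp.single 2 y w))) =
      htmulL H _ x (lp.singleContinuousLinearMap ℂ (fun _ : G => V) 2 y
        ((inner ℂ (v k) w : ℂ) • v k)) := by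
    rw [adjoint_fellIsometry_htmul, map_smul, LinearIsometry.coe_toContinuousLinearMap,
      fellIsometry_single, ← mul_apply_eq_comp, Unitary.star_mul_self_of_mem (U y⁻¹).2,
      one_apply_eq_self, map_smul, map_smul, lp.singleContinuousLinearMap_apply, htmulL_apply]
  refine ext_lp_single fun y w => ?_
  simp only [comp_apply, sum_apply]
  rw [htmulL_apply, Finset.sum_congr rfl fun k _ => hJ k y w, ← map_sum, ← map_sum,
    v.sum_repr', lp.singleContinuousLinearMap_apply, htmulL_apply]

lemma isCuntzFamily_fellIsometry (U : G → unitary (H →L[ℂ] H)) (v : OrthonormalBasis ι ℂ V) :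
    IsCuntzFamily fun k => (fellIsometry (G := G) U (v.norm_eq_one k)).toContinuousLinearMap where
  adjoint_comp_self k := by
    rw [adjoint_fellIsometry_comp_fellIsometry, v.inner_eq_one, one_smul]
  adjoint_comp_of_ne k l hkl := by
    rw [adjoint_fellIsometry_comp_fellIsometry, v.inner_eq_zero hkl, zero_smul]
  sum_comp_adjoint := sum_fellIsometry_comp_adjoint v

/-- The extension to the reduced crossed product of the representation `equivariantRep`; the
regular representation absorbs `U` because the Fell isometries intertwine it with `tensorMap`. -/
def equivariantHom (τ : TwistingPair A G) (π : A →⋆ₐ[ℂ] (H →L[ℂ] H))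
    (U : G → unitary (H →L[ℂ] H)) (v : OrthonormalBasis ι ℂ V) :
    reducedCrossedProduct τ π →⋆ₐ[ℂ] (EquivariantSpace H G V →L[ℂ] EquivariantSpace H G V) :=
  ((doubleHom _).comp (isCuntzFamily_fellIsometry U v).amplification).comp
    (reducedCrossedProduct τ π).subtype

lemma equivariantHom_toImage (h : IsCovariantRep τ π U) (v : OrthonormalBasis ι ℂ V)
    (f : G →₀ A) :
    equivariantHom τ π U v (toImage (regularRep τ π) f) = equivariantRep V π U f := by
  let Ψ := (doubleHom _).comp (isCuntzFamily_fellIsometry U v).amplification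
  calc equivariantHom τ π U v (toImage (regularRep τ π) f) =
        Ψ (f.sum fun x a => regularMap τ π x a) := rfl
    _ = f.sum fun x a => Ψ (regularMap τ π x a) := map_finsuppSum Ψ _ _
    _ = equivariantRep V π U f := Finset.sum_congr rfl fun x _ => congrArg doubleOp <|
        (isCuntzFamily_fellIsometry U v).amplification_eq_of_intertwines
          fun k => fellIsometry_comp_regularMap h (v.norm_eq_one k) x (f x)

end FellAbsorption

section Consequences

variable {A : Type*} [CStarAlgebra A] {G : Type*}
  {H : Type*} [NormedAddCommGroup H] [InnerProductSpace ℂ H] [CompleteSpace H]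
  {𝒜 : StarSubalgebra ℂ A} {π : A →⋆ₐ[ℂ] (H →L[ℂ] H)} {D : H →ₗ.[ℂ] H}
  {U : G → unitary (H →L[ℂ] H)}

lemma isRegularOp_mul_unitary (hreg : IsRegular (integratedForm π U '' finSupp G 𝒜) D) (g : G)
    {a : A} (ha : a ∈ 𝒜) : IsRegularOp D (π a * U g) :=
  hreg _ ⟨_, single_mem_finSupp g ha, crossedSum_single (covariantMap π U) g a⟩

variable [Group G] {τ : TwistingPair A G}

lemma IsEquivariantTriple.isRegularOp_unitary_iff (h : IsEquivariantTriple τ 𝒜 π D U) (g : G) :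
    IsRegularOp D (U g : H →L[ℂ] H) ↔ IsLaplaceCompatible D (U g : H →L[ℂ] H) :=
  IsRegularOp.iff_isLaplaceCompatible h.isSpectralTriple.selfAdjoint
    h.isSpectralTriple.compactResolvent (h.boundedCommutator g)

lemma IsEquivariantTriple.isRegular_integratedForm (h : IsEquivariantTriple τ 𝒜 π D U)
    (hreg : IsRegular (π '' (𝒜 : Set A)) D)
    (hU : ∀ g, IsLaplaceCompatible D (U g : H →L[ℂ] H)) :
    IsRegular (integratedForm π U '' finSupp G 𝒜) D := by
  rintro _ ⟨f, hf, rfl⟩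
  exact IsRegularOp.sum fun g _ =>
    IsRegularOp.mul (hreg _ ⟨_, hf g, rfl⟩) ((h.isRegularOp_unitary_iff g).2 (hU g))

lemma IsEquivariantTriple.isSpectralTriple_integratedForm (h : IsEquivariantTriple τ 𝒜 π D U)
    (hreg : IsRegular (integratedForm π U '' finSupp G 𝒜) D) :
    IsSpectralTriple (toImage (integratedForm π U) '' finSupp G 𝒜)
      (cstarImage (integratedForm π U)).subtype D := by
  have hrep := h.isCovariantRep.isCrossedRep
  have htriple := h.isSpectralTriple
  refine ⟨hrep.exists_starSubalgebra h.isSmooth,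
    hrep.dense_toImage_finSupp h.isSmooth htriple.dense, htriple.denseDomain,
    htriple.selfAdjoint, htriple.compactResolvent, ?_⟩
  rintro _ ⟨f, hf, rfl⟩
  obtain ⟨-, C, hC, -⟩ := hreg _ ⟨f, hf, rfl⟩
  exact ⟨C, hC⟩

lemma IsEquivariantTriple.isRegular_of_isRegular_integratedForm
    (h : IsEquivariantTriple τ 𝒜 π D U)
    (hreg : IsRegular (integratedForm π U '' finSupp G 𝒜) D) :
    IsRegular (π '' (𝒜 : Set A)) D := by
  rintro _ ⟨a, ha, rfl⟩
  have hreg_mul := isRegularOp_mul_unitary hreg 1 ha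
  rwa [h.isCovariantRep.unitary_one, mul_one] at hreg_mul

lemma IsEquivariantTriple.isLaplaceCompatible_unitary (h : IsEquivariantTriple τ 𝒜 π D U)
    (hreg : IsRegular (integratedForm π U '' finSupp G 𝒜) D) (g : G) :
    IsLaplaceCompatible D (U g : H →L[ℂ] H) := by
  have hreg_mul := isRegularOp_mul_unitary hreg g 𝒜.one_mem
  rw [map_one, one_mul] at hreg_mul
  exact (h.isRegularOp_unitary_iff g).1 hreg_mul

variable {V : Type*} [NormedAddCommGroup V] [InnerProductSpace ℂ V]

lemma IsEquivariantTriple.isSpectralTriple_equivariantDirac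
    (h : IsEquivariantTriple τ 𝒜 π D U) {ℓ : G → V →L[ℂ] V}
    (hsa : IsSelfAdjoint (equivariantDirac D ℓ))
    (hcompact : HasCompactResolvent (equivariantDirac D ℓ))
    (hreg : ∀ f ∈ finSupp G 𝒜, IsRegularOp (equivariantDirac D ℓ) (equivariantRep V π U f))
    {Φ : reducedCrossedProduct τ π →⋆ₐ[ℂ] (EquivariantSpace H G V →L[ℂ] EquivariantSpace H G V)}
    (hΦ : ∀ f : G →₀ A, Φ (toImage (regularRep τ π) f) = equivariantRep V π U f) :
    IsSpectralTriple (toImage (regularRep τ π) '' finSupp G 𝒜) Φ (equivariantDirac D ℓ) ∧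
      IsRegular (Φ '' (toImage (regularRep τ π) '' finSupp G 𝒜)) (equivariantDirac D ℓ) := by
  have hrep := h.isCovariantRep.isCrossedRep_regularMap
  refine ⟨⟨hrep.exists_starSubalgebra h.isSmooth,
    hrep.dense_toImage_finSupp h.isSmooth h.isSpectralTriple.dense, hsa.dense_domain, hsa,
    hcompact, ?_⟩, ?_⟩
  · rintro _ ⟨f, hf, rfl⟩
    obtain ⟨-, C, hC, -⟩ := hreg f hf
    exact ⟨C, (hΦ f).symm ▸ hC⟩
  · rintro _ ⟨_, ⟨f, hf, rfl⟩, rfl⟩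
    rw [hΦ]
    exact hreg f hf

variable [CompleteSpace V]

lemma isRegularOp_leftReg {M : lp (fun _ : G => V) 2 →ₗ.[ℂ] lp (fun _ : G => V) 2}
    (hreg : IsRegular (groupAlgebraOps G V) M) (g : G) : IsRegularOp M (leftReg V g) :=
  hreg _ ⟨Finsupp.single g 1, by simp⟩

lemma isRegularOp_equivariantRep {ι κ : Type*} {b : HilbertBasis ι ℂ H}
    {c : HilbertBasis κ ℂ (lp (fun _ : G => V) 2)} {d : ι → ℝ} {e : κ → ℝ} {ℓ : G → V →L[ℂ] V}
    (hD : IsDiagonal D b d) (hM : IsDiagonal (mulLength ℓ) c e)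
    (hreg : IsRegular (integratedForm π U '' finSupp G 𝒜) D)
    (hreg' : IsRegular (groupAlgebraOps G V) (mulLength ℓ)) {f : G →₀ A} (hf : f ∈ finSupp G 𝒜) :
    IsRegularOp (equivariantDirac D ℓ) (equivariantRep V π U f) :=
  IsRegularOp.sum fun g _ => IsRegularOp.doubleOp_tensorOp hD hM
    (isRegularOp_mul_unitary hreg g (hf g)) (isRegularOp_leftReg hreg' g)

end Consequences

end TwistedTriple

end

open TwistedTriple in
theorem theorem4p3_general {A : Type*} [CStarAlgebra A] {G : Type*} [Group G]
    {H : Type*} [NormedAddCommGroup H] [InnerProductSpace ℂ H] [CompleteSpace H]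
    {V : Type*} [NormedAddCommGroup V] [InnerProductSpace ℂ V] [FiniteDimensional ℂ V]
    [CompleteSpace V]
    (τ : TwistingPair A G) (𝒜 : StarSubalgebra ℂ A)
    (π : A →⋆ₐ[ℂ] (H →L[ℂ] H)) (D : H →ₗ.[ℂ] H) (U : G → unitary (H →L[ℂ] H))
    (hequiv : IsEquivariantTriple τ 𝒜 π D U)
    (ℓ : G → V →L[ℂ] V) (hsa : ∀ x, IsSelfAdjoint (ℓ x))
    (hproper : ∀ R : ℝ, {x | (spectrum ℝ (ℓ x) ∩ Set.Icc (-R) R).Nonempty}.Finite) :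
    (IsRegular (integratedForm π U '' finSupp G 𝒜) D →
      IsRegular (groupAlgebraOps G V) (mulLength ℓ) →
      ∃ Φ : reducedCrossedProduct τ π →⋆ₐ[ℂ]
          (EquivariantSpace H G V →L[ℂ] EquivariantSpace H G V),
        (∀ f : G →₀ A, Φ (toImage (regularRep τ π) f) = equivariantRep V π U f) ∧
        IsSpectralTriple (toImage (regularRep τ π) '' finSupp G 𝒜) Φ (equivariantDirac D ℓ) ∧
        IsRegular (Φ '' (toImage (regularRep τ π) '' finSupp G 𝒜)) (equivariantDirac D ℓ)) ∧
    (IsRegular (π '' (𝒜 : Set A)) D →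
      (∀ g, IsLaplaceCompatible D (U g : H →L[ℂ] H)) →
      IsSpectralTriple (toImage (integratedForm π U) '' finSupp G 𝒜)
        (cstarImage (integratedForm π U)).subtype D ∧
      IsRegular (integratedForm π U '' finSupp G 𝒜) D) ∧
    (IsRegular (integratedForm π U '' finSupp G 𝒜) D →
      IsRegular (π '' (𝒜 : Set A)) D ∧
      ∀ g, IsLaplaceCompatible D (U g : H →L[ℂ] H)) := by
  refine ⟨fun hreg hreg' => ?_, fun hreg hU => ?_, fun hreg =>
    ⟨hequiv.isRegular_of_isRegular_integratedForm hreg, hequiv.isLaplaceCompatible_unitary hreg⟩⟩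
  · have hcompact := hequiv.isSpectralTriple.compactResolvent
    obtain ⟨ι, b, d, hD⟩ := exists_isDiagonal hequiv.isSpectralTriple.selfAdjoint hcompact
    obtain ⟨c, e, hM, he⟩ := exists_isDiagonal_mulLength hsa hproper
    have hd := hD.finite_of_hasCompactResolvent hcompact
    have hΦ := equivariantHom_toImage hequiv.isCovariantRep (stdOrthonormalBasis ℂ V)
    exact ⟨_, hΦ, hequiv.isSpectralTriple_equivariantDirac (isSelfAdjoint_productDirac hD hM)
      (hasCompactResolvent_productDirac hD hM hd he)
      (fun f hf => isRegularOp_equivariantRep hD hM hreg hreg' hf) hΦ⟩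
  · have hreg' := hequiv.isRegular_integratedForm hreg hU
    exact ⟨hequiv.isSpectralTriple_integratedForm hreg', hreg'⟩

open TwistedTriple in
theorem theorem4p3 {A : Type*} [CStarAlgebra A] {G : Type*} [Group G]
    {H : Type*} [NormedAddCommGroup H] [InnerProductSpace ℂ H] [CompleteSpace H]
    {V : Type*} [NormedAddCommGroup V] [InnerProductSpace ℂ V] [FiniteDimensional ℂ V]
    [CompleteSpace V]
    (τ : TwistingPair A G) (𝒜 : StarSubalgebra ℂ A)
    (π : A →⋆ₐ[ℂ] (H →L[ℂ] H)) (hπ : Function.Injective π)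
    (D : H →ₗ.[ℂ] H) (U : G → unitary (H →L[ℂ] H))
    (hequiv : IsEquivariantTriple τ 𝒜 π D U)
    (ℓ : G → V →L[ℂ] V) (hℓ : IsProperTranslationBounded ℓ) :
    -- (1)
    (IsRegular (integratedForm π U '' finSupp G 𝒜) D →
      IsRegular (groupAlgebraOps G V) (mulLength ℓ) →
      ∃ Φ : reducedCrossedProduct τ π →⋆ₐ[ℂ]
          (EquivariantSpace H G V →L[ℂ] EquivariantSpace H G V),
        (∀ f : G →₀ A, Φ (toImage (regularRep τ π) f) = equivariantRep V π U f) ∧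
        IsSpectralTriple (toImage (regularRep τ π) '' finSupp G 𝒜) Φ (equivariantDirac D ℓ) ∧
        IsRegular (Φ '' (toImage (regularRep τ π) '' finSupp G 𝒜)) (equivariantDirac D ℓ)) ∧
    -- (2)
    (IsRegular (π '' (𝒜 : Set A)) D →
      (∀ g, IsLaplaceCompatible D (U g : H →L[ℂ] H)) →
      IsSpectralTriple (toImage (integratedForm π U) '' finSupp G 𝒜)
        (cstarImage (integratedForm π U)).subtype D ∧
      IsRegular (integratedForm π U '' finSupp G 𝒜) D) ∧
    -- (3)
    (IsRegular (integratedForm π U '' finSupp G 𝒜) D →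
      IsRegular (π '' (𝒜 : Set A)) D ∧
      ∀ g, IsLaplaceCompatible D (U g : H →L[ℂ] H)) := by
  exact theorem4p3_general τ 𝒜 π D U hequiv ℓ hℓ.selfAdjoint
    hℓ.finite_setOf_spectrum_inter_Icc_nonempty
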